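/- Let $k$ be an algebraically closed field of characteristic different from $2$, and let $F\subset\mathbb{P}^2$ be a smooth plane cubic over $k$. Write $i:F\to\mathbb{P}^2$ for the inclusion; it is the map associated to the class $H\in\mathrm{Pic}^3(F)$ of a line section. Let $\beta\in\mathrm{Pic}(F)$ satisfy $\beta\neq 0$ and $2\beta=0$. For every point $p\in F$ there is a unique point $q\in F$ whose class in $\mathrm{Pic}(F)$ is $[p]+\beta$; it is denoted $p+\beta$, and $p+\beta\ne p$. Let $F/\beta$ be the quotient variety of $F$ by the involution $p\mapsto p+\beta$: its points are the pairs $\{p,p+\beta\}$, and its topology and its regular functions are those that become open sets and regular functions after pullback to $F$. The chord construction is the well-defined map $$i':F/\beta\to(\mathbb{P}^2)^*,\qquad \{p,p+\beta\}\mapsto\overline{i(p)\,i(p+\beta)},$$ which sends $\{p,p+\beta\}$ to the line through $i(p)$ and $i(p+\beta)$. Then $i'$ is a closed embedding of algebraic varieties (it is injective with closed image, and it is an isomorphism of $F/\beta$ onto its image with the structure of a closed subvariety), and its image is a curve of degree $3$, that is, the zero locus of an irreducible cubic form on $(\mathbb{P}^2)^*$. -/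

import Mathlib

open MvPolynomial
open scoped LinearAlgebra.Projectivization Topology

namespace ChordConstruction

/-- The points of the projective plane `ℙ²` over `k`, in homogeneous coordinates. The dual plane
`(ℙ²)*` is given by dual coordinates: `[u₀ : u₁ : u₂]` stands for the line
`u₀ x₀ + u₁ x₁ + u₂ x₂ = 0`, so it has the same underlying type. -/
abbrev Plane (k : Type*) [Field k] := ℙ k (Fin 3 → k)

/-- The polynomial ring `k[x₀, x₁, x₂]`. -/
abbrev CoordRing (k : Type*) [Field k] := MvPolynomial (Fin 3) k

/-- `f` is a cubic form with no singular zero in the plane. -/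
structure IsSmoothCubic {k : Type*} [Field k] (f : CoordRing k) : Prop where
  homogeneous : f.IsHomogeneous 3
  smooth : ∀ v : Fin 3 → k, v ≠ 0 → eval v f = 0 → ∃ j, eval v (pderiv j f) ≠ 0

/-- The zero locus of a form in the plane. -/
def zeroLocus {k : Type*} [Field k] (f : CoordRing k) : Set (Plane k) := {p | eval p.rep f = 0}

/-- The point `p` lies on the line with dual coordinates `l`. -/
def Incident {k : Type*} [Field k] (p l : Plane k) : Prop := l.rep ⬝ᵥ p.rep = 0

/-! ### Divisors and the Picard group of a smooth plane curve -/

section Picard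

variable {k : Type*} [Field k]

/-- The homogeneous ideal of a point of the plane. -/
noncomputable def pointIdeal (p : Plane k) : Ideal (CoordRing k) :=
  Ideal.span {G | ∃ d : ℕ, G.IsHomogeneous d ∧ eval p.rep G = 0}

/-- The order of vanishing at `p` of the form `G` on the curve `f = 0`: the largest `n` such that
the germ of `G` lies in the `n`-th power of the maximal ideal of the local ring of the curve
at `p`. The factor `A`, a form that does not vanish at `p`, expresses the localization at `p`. It
is used at points of a smooth curve `f = 0` and for forms `G` that are not multiples of `f`, where
the supremum is a maximum. -/
noncomputable def ord (f : CoordRing k) (p : Plane k) (G : CoordRing k) : ℕ :=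
  sSup {n | ∃ (e : ℕ) (A : CoordRing k), A.IsHomogeneous e ∧ eval p.rep A ≠ 0 ∧
    A * G ∈ pointIdeal p ^ n ⊔ Ideal.span {f}}

/-- Divisors on the curve `f = 0`. -/
abbrev Divisor (f : CoordRing k) := zeroLocus f →₀ ℤ

/-- `D` is the divisor of a nonzero rational function `G / H` on the curve `f = 0`, where `G`
and `H` are forms of the same degree that do not vanish identically on the curve. -/
def IsPrincipal (f : CoordRing k) (D : Divisor f) : Prop :=
  ∃ (d : ℕ) (G H : CoordRing k), G.IsHomogeneous d ∧ H.IsHomogeneous d ∧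
    G ∉ Ideal.span {f} ∧ H ∉ Ideal.span {f} ∧
    ∀ p : zeroLocus f, D p = (ord f p G : ℤ) - (ord f p H : ℤ)

/-- The group of principal divisors. -/
noncomputable def principalDivisors (f : CoordRing k) : AddSubgroup (Divisor f) :=
  AddSubgroup.closure {D | IsPrincipal f D}

/-- The Picard group of the (smooth) curve `f = 0`: divisors modulo linear equivalence. -/
abbrev Pic (f : CoordRing k) := Divisor f ⧸ principalDivisors f

/-- The class in the Picard group of a point of the curve. -/
noncomputable def pointClass {f : CoordRing k} (p : zeroLocus f) : Pic f :=
  QuotientAddGroup.mk (Finsupp.single p 1)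

/-- `q = p + β` for points `p`, `q` of the curve `f = 0` and `β ∈ Pic`: the divisor `q` is in the
class of `p` plus `β`. -/
def IsTranslate {f : CoordRing k} (β : Pic f) (p q : zeroLocus f) : Prop :=
  pointClass q = pointClass p + β

/-- Two points of the curve are equivalent if they differ by a multiple of `β`. -/
def translateSetoid {f : CoordRing k} (β : Pic f) : Setoid (zeroLocus f) where
  r p q := pointClass q - pointClass p ∈ AddSubgroup.zmultiples β
  iseqv :=
    { refl := fun p => by simp
      symm := fun {p q} h => by simpa using neg_mem h
      trans := fun {p q r} h₁ h₂ => by simpa using add_mem h₂ h₁ }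

/-- The set of points of `F / β`. If `β` has order two, its elements are the pairs
`{p, p + β}`. -/
abbrev QuotientCurve {f : CoordRing k} (β : Pic f) := Quotient (translateSetoid β)

/-- The quotient map `π : F → F / β`. -/
def proj {f : CoordRing k} (β : Pic f) (p : zeroLocus f) : QuotientCurve β :=
  Quotient.mk (translateSetoid β) p

end Picard

/-- `c : F / β → (ℙ²)*` is the chord construction: it sends the class `{p, p + β}` to the line
through the two distinct points `p` and `p + β`. -/
def IsChordMap {k : Type*} [Field k] {f : CoordRing k} (β : Pic f)
    (c : QuotientCurve β → Plane k) : Prop :=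
  ∀ p q : zeroLocus f, IsTranslate β p q →
    p ≠ q ∧ Incident p.1 (c (proj β p)) ∧ Incident q.1 (c (proj β p))

/-! ### Varieties over an algebraically closed field as spaces with functions -/

/-- A topology on `X`, and for each open set `U` of `X` the `k`-valued functions that are regular
on `U`. (Functions are total; only the values on `U` matter.) -/
structure SpaceWithFunctions (k : Type*) (X : Type*) where
  top : TopologicalSpace X
  Regular : Set X → (X → k) → Prop

namespace SpaceWithFunctions

variable {k X Y : Type*}

/-- The structure that a map `g : X → Y` induces on `X`: the coarsest topology that makes `g`
continuous, and the functions that are locally pulled back from regular functions on `Y`. If `g` is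
the inclusion of a closed subset of a variety, this is the usual structure of a closed
subvariety. -/
def induced (g : X → Y) (S : SpaceWithFunctions k Y) : SpaceWithFunctions k X where
  top := S.top.induced g
  Regular U ψ := ∀ x ∈ U, ∃ (V : Set Y) (φ : Y → k), IsOpen[S.top] V ∧ g x ∈ V ∧ S.Regular V φ ∧
    ∀ x' ∈ U, g x' ∈ V → ψ x' = φ (g x')

/-- The quotient structure along a map `g : X → Y`: a set is open if its preimage is, and a
function is regular if its pullback is. If `g` is the quotient map of a variety by a finite group,
this is the usual structure of the quotient variety. -/
def coinduced (g : X → Y) (S : SpaceWithFunctions k X) : SpaceWithFunctions k Y where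
  top := S.top.coinduced g
  Regular U φ := S.Regular (g ⁻¹' U) (φ ∘ g)

/-- `g : X → Y` is a (closed) embedding of varieties: it is injective with closed image, and it is
an isomorphism of `X` with its image as a closed subvariety of `Y`. -/
structure IsEmbedding (S : SpaceWithFunctions k X) (T : SpaceWithFunctions k Y) (g : X → Y) :
    Prop where
  injective : Function.Injective g
  isClosed_range : IsClosed[T.top] (Set.range g)
  top_eq : S.top = (T.induced g).top
  regular_iff : ∀ (U : Set X) (φ : X → k), IsOpen[S.top] U →
    (S.Regular U φ ↔ (T.induced g).Regular U φ)

end SpaceWithFunctions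

/-- The projective plane as a variety: the Zariski topology, and the functions that are locally
quotients of two forms of the same degree. -/
def planeSpace (k : Type*) [Field k] : SpaceWithFunctions k (Plane k) where
  top := TopologicalSpace.generateFrom
    {U | ∃ (d : ℕ) (G : CoordRing k), G.IsHomogeneous d ∧ U = (zeroLocus G)ᶜ}
  Regular U φ := ∀ p ∈ U, ∃ (d : ℕ) (A B : CoordRing k), A.IsHomogeneous d ∧ B.IsHomogeneous d ∧
    eval p.rep B ≠ 0 ∧ ∀ q ∈ U, eval q.rep B ≠ 0 → φ q = eval q.rep A / eval q.rep B

/-- The plane curve `f = 0` as a closed subvariety of the plane. -/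
def curveSpace {k : Type*} [Field k] (f : CoordRing k) : SpaceWithFunctions k (zeroLocus f) :=
  (planeSpace k).induced Subtype.val

/-- The quotient variety `F / β` of the curve `F : f = 0`. -/
def quotientSpace {k : Type*} [Field k] {f : CoordRing k} (β : Pic f) :
    SpaceWithFunctions k (QuotientCurve β) :=
  (curveSpace f).coinduced (proj β)

end ChordConstruction

namespace ChordConstruction

/-! ### Forms in three variables: restriction to lines, linear factors, irreducibility of a smooth
cubic. -/

section Forms

variable {k : Type*} [Field k]

/-! In suitable coordinates, translation by `β` becomes the standard quadratic involution, and the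
chords become the lines that contain a conjugate pair of a net of conics. The image of the chord map
is then the Cayleyan of the net.

Coordinates. Let `q = p + β` and let `2p + r` be the tangent section at `p`. Since `2β = 0`, also
`2q + r` is a line section, so the tangents at `p` and `q` meet at `r` on the curve. For a suitable
`p` the points `p`, `q`, `r` are distinct (`IsSmoothCubic.exists_good_point`), and then they are not
collinear. With these points as coordinate vertices and after scaling, the cubic is `a y (x² + z²) +
b x (y² + z²) + e x y z`, the Jacobian of the net spanned by `x² - z²`, `y² - z²` and `2 a x z + 2 b
y z + e x²`. The points of the Jacobian are those with a point conjugate to them under the whole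
net, and conjugate points differ by `β` (`isTranslate_of_conjugate`): the chords from them to `q`
and `p` respectively meet the curve in the same third point.

Image and injectivity. A pair `X`, `Y` is conjugate if and only if `X Yᵀ + Y Xᵀ` is apolar to the
net. The apolar symmetric matrices form a three-dimensional space, parametrized by `n ↦ S(n)`, and
`S(n) U = 0` is the linear system `apolarMatrix U · n = 0`. Hence a line `U` contains a conjugate
pair if and only if `det (apolarMatrix U) = 0`, a cubic equation in `U`. The kernel is at most
one-dimensional (`eq_smul_of_apolarMatrix`) because the curve does not contain the line; so a chord
determines its pair. A linear factor of this cubic would make every line through some point a chord,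
which is excluded by comparing a cubic form in `X` with `f`.

Embedding. The topologies agree since nonempty open sets are the cofinite ones on both sides.
Pullbacks of regular functions are regular because the chord is locally given by cubic forms.
Conversely, an invariant regular function is a quotient of symmetrized forms in `(P, Q)`, hence of
forms in the products `P_i Q_j + P_j Q_i` (`isFormIn_symmetrize`), and these products are locally
quadratic forms in the chord (`IsNormalForm.exists_local_tensor`).

The Picard group enters through line sections. Smoothness makes the local rings discrete valuation
rings, Noether's theorem (`IsSmoothCubic.exists_mul_of_ord_le`) shows that distinct points are
inequivalent, and chords and tangents reduce every class to `p + n o`, so that `p + β` is a unique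
point. -/

theorem _root_.MvPolynomial.IsHomogeneous.eval_smul {σ : Type*} {G : MvPolynomial σ k} {d : ℕ}
    (hG : G.IsHomogeneous d) (t : k) (v : σ → k) : eval (t • v) G = t ^ d * eval v G := by
  rw [eval_eq, eval_eq, Finset.mul_sum]
  refine Finset.sum_congr rfl fun m hm => ?_
  rw [hG.degree_eq_sum_deg_support hm]
  simp only [Pi.smul_apply, smul_eq_mul, mul_pow, Finset.prod_mul_distrib, Finset.prod_pow_eq_pow_sum]
  ring

/-- The linear form with the given coefficients. -/
noncomputable def lin (w : Fin 3 → k) : CoordRing k := ∑ j, C (w j) * X j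

@[simp] theorem eval_lin (w v : Fin 3 → k) : eval v (lin w) = w ⬝ᵥ v := by
  simp [lin, dotProduct]

theorem isHomogeneous_lin (w : Fin 3 → k) : (lin w).IsHomogeneous 1 :=
  IsHomogeneous.sum _ _ _ fun _ _ => isHomogeneous_C_mul_X _ _

@[simp] theorem pderiv_lin (j : Fin 3) (w : Fin 3 → k) : pderiv j (lin w) = C (w j) := by
  simp [lin, Fin.sum_univ_three]
  fin_cases j <;> simp

theorem lin_smul (c : k) (w : Fin 3 → k) : lin (c • w) = C c * lin w := by
  simp [lin, Finset.mul_sum, mul_assoc]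

theorem lin_add (u w : Fin 3 → k) : lin (u + w) = lin u + lin w := by
  simp [lin, Finset.sum_add_distrib, add_mul]

theorem lin_ne_zero {w : Fin 3 → k} (hw : w ≠ 0) : lin w ≠ 0 := by
  intro h
  refine hw (funext fun j => ?_)
  have := congrArg (pderiv j) h
  simpa using this

theorem exists_eq_lin {G : CoordRing k} (hG : G.IsHomogeneous 1) : ∃ w, G = lin w := by
  have h : G ∈ homogeneousSubmodule (Fin 3) k 1 := hG
  rw [homogeneousSubmodule_one_eq_span_X, Submodule.mem_span_range_iff_exists_fun] at h
  obtain ⟨c, rfl⟩ := h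
  exact ⟨c, by simp [lin, smul_eq_C_mul]⟩

theorem homogeneous_succ_induction {n : ℕ} {p : CoordRing k → Prop}
    (mul : ∀ (w : Fin 3 → k) (G : CoordRing k), G.IsHomogeneous n → p (lin w * G))
    (add : ∀ G H, p G → p H → p (G + H)) {G : CoordRing k} (hG : G.IsHomogeneous (n + 1)) : p G := by
  have h : G ∈ homogeneousSubmodule (Fin 3) k (n + 1) := hG
  rw [← homogeneousSubmodule_one_pow, pow_succ', homogeneousSubmodule_one_pow] at h
  refine Submodule.mul_induction_on h (fun m hm n hn => ?_) add
  obtain ⟨w, rfl⟩ := exists_eq_lin hm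
  exact mul w n hn

/-- The gradient of a polynomial at a vector. -/
noncomputable def grad (f : CoordRing k) (v : Fin 3 → k) : Fin 3 → k := fun j => eval v (pderiv j f)

theorem grad_mul (f g : CoordRing k) (v : Fin 3 → k) :
    grad (f * g) v = eval v f • grad g v + eval v g • grad f v := by
  funext j
  simp [grad]

theorem grad_add (f g : CoordRing k) (v : Fin 3 → k) : grad (f + g) v = grad f v + grad g v := by
  funext j
  simp [grad]

@[simp] theorem grad_lin (w v : Fin 3 → k) : grad (lin w) v = w := by
  funext j
  simp [grad]

theorem eval_line_quadratic {q : CoordRing k} (hq : q.IsHomogeneous 2) (P W : Fin 3 → k) :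
    (∀ α γ : k, eval (α • P + γ • W) q =
      α ^ 2 * eval P q + α * γ * (grad q P ⬝ᵥ W) + γ ^ 2 * eval W q) ∧
    grad q P ⬝ᵥ W = grad q W ⬝ᵥ P := by
  refine homogeneous_succ_induction (p := fun q => (∀ α γ : k, eval (α • P + γ • W) q =
      α ^ 2 * eval P q + α * γ * (grad q P ⬝ᵥ W) + γ ^ 2 * eval W q) ∧
    grad q P ⬝ᵥ W = grad q W ⬝ᵥ P) (fun w G hG => ?_) (fun G H hG hH => ?_) hq
  · obtain ⟨u, rfl⟩ := exists_eq_lin hG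
    simp only [map_mul, eval_lin, grad_mul, grad_lin, dotProduct_add, dotProduct_smul, add_dotProduct,
      smul_dotProduct, smul_eq_mul]
    exact ⟨fun α γ => by ring, by ring⟩
  · simp only [map_add, grad_add, add_dotProduct, hG.1, hH.1, hG.2, hH.2, and_true]
    exact fun α γ => by ring

/-- Checking the expansion on products of linear forms avoids Taylor coefficients with denominators,
so it holds in every characteristic. The two middle coefficients are the polars that later give
tangents and third intersection points. -/
theorem eval_line {f : CoordRing k} (hf : f.IsHomogeneous 3) (P W : Fin 3 → k) (α γ : k) :
    eval (α • P + γ • W) f = α ^ 3 * eval P f + α ^ 2 * γ * (grad f P ⬝ᵥ W) +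
      α * γ ^ 2 * (grad f W ⬝ᵥ P) + γ ^ 3 * eval W f := by
  refine homogeneous_succ_induction (p := fun f => eval (α • P + γ • W) f = α ^ 3 * eval P f +
    α ^ 2 * γ * (grad f P ⬝ᵥ W) + α * γ ^ 2 * (grad f W ⬝ᵥ P) + γ ^ 3 * eval W f)
    (fun w G hG => ?_) (fun G H hG hH => ?_) hf
  · have h := eval_line_quadratic hG P W
    simp only [map_mul, eval_lin, grad_mul, grad_lin, dotProduct_add, dotProduct_smul, add_dotProduct,
      smul_dotProduct, smul_eq_mul, h.1, ← h.2]
    ring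
  · simp only [map_add, grad_add, add_dotProduct, hG, hH]
    ring

theorem sub_aeval_mem {I : Ideal (CoordRing k)} {s : Fin 3 → CoordRing k}
    (hs : ∀ i, X i - s i ∈ I) (G : CoordRing k) : G - aeval s G ∈ I := by
  rw [← Ideal.Quotient.mk_eq_mk_iff_sub_mem]
  have : (Ideal.Quotient.mkₐ k I) = (Ideal.Quotient.mkₐ k I).comp (aeval s) := by
    refine MvPolynomial.algHom_ext fun i => ?_
    simpa using (Ideal.Quotient.mk_eq_mk_iff_sub_mem _ _).2 (hs i)
  exact DFunLike.congr_fun this G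

theorem eval_aeval (s : Fin 3 → CoordRing k) (G : CoordRing k) (v : Fin 3 → k) :
    eval v (aeval s G) = eval (fun i => eval v (s i)) G := by
  induction G using MvPolynomial.induction_on with
  | C a => simp
  | add p q hp hq => simp only [map_add, hp, hq]
  | mul_X p i hp => simp only [map_mul, hp, aeval_X, eval_X]

theorem lin_dvd_of_forall [Infinite k] {w : Fin 3 → k} (hw : w ≠ 0) {G : CoordRing k}
    (h : ∀ v, w ⬝ᵥ v = 0 → eval v G = 0) : lin w ∣ G := by
  obtain ⟨j, hj⟩ := Function.ne_iff.1 hw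
  simp only [Pi.zero_apply] at hj
  -- The substitution `s` projects along the `j`-th axis onto the plane `w · v = 0` and is the
  -- identity modulo `lin w`.
  let s : Fin 3 → CoordRing k := fun i => X i - (if i = j then C (w j)⁻¹ else 0) * lin w
  have h1 : G - aeval s G ∈ Ideal.span {lin w} := by
    refine sub_aeval_mem (fun i => ?_) G
    simp only [s, sub_sub_cancel]
    exact Ideal.mul_mem_left _ _ (Ideal.mem_span_singleton_self _)
  have h2 : aeval s G = 0 := by
    refine MvPolynomial.funext fun v => ?_
    rw [eval_aeval, map_zero]
    refine h _ ?_
    have : (fun i => eval v (s i)) = v - ((w j)⁻¹ * (w ⬝ᵥ v)) • Pi.single j 1 := by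
      funext i
      by_cases hi : i = j
      · subst hi; simp [s]
      · simp [s, hi]
    rw [this]
    simp [dotProduct_sub, dotProduct_smul]
    field_simp
    ring
  rwa [h2, sub_zero, Ideal.mem_span_singleton] at h1

theorem homogeneousComponent_mul_of_totalDegree {f g : CoordRing k} :
    homogeneousComponent (f.totalDegree + g.totalDegree) (f * g) =
      homogeneousComponent f.totalDegree f * homogeneousComponent g.totalDegree g := by
  have h : f * g = (∑ i ∈ Finset.range (f.totalDegree + 1), homogeneousComponent i f) *
      ∑ i ∈ Finset.range (g.totalDegree + 1), homogeneousComponent i g := by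
    rw [sum_homogeneousComponent, sum_homogeneousComponent]
  rw [h, Finset.sum_mul_sum, map_sum]
  simp_rw [map_sum]
  rw [Finset.sum_eq_single f.totalDegree, Finset.sum_eq_single g.totalDegree]
  · rw [homogeneousComponent_of_mem (m := f.totalDegree + g.totalDegree), if_pos rfl]
    exact (homogeneousComponent_isHomogeneous _ _).mul (homogeneousComponent_isHomogeneous _ _)
  · intro j hj hne
    rw [homogeneousComponent_of_mem ((homogeneousComponent_isHomogeneous _ _).mul
      (homogeneousComponent_isHomogeneous _ _)), if_neg (by omega)]
  · intro h; simp at h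
  · intro i hi hne
    refine Finset.sum_eq_zero fun j hj => ?_
    simp only [Finset.mem_range] at hi hj
    rw [homogeneousComponent_of_mem ((homogeneousComponent_isHomogeneous _ _).mul
      (homogeneousComponent_isHomogeneous _ _)), if_neg (by omega)]
  · intro h; simp at h

/-- The factors need not be known to be homogeneous: their top-degree components already multiply to
`f`, and degrees adding up to three leave only `1 + 2`. -/
theorem exists_linear_factor {f : CoordRing k} (hf : f.IsHomogeneous 3) (h0 : f ≠ 0)
    (hirr : ¬ Irreducible f) : ∃ (w : Fin 3 → k) (q : CoordRing k), q.IsHomogeneous 2 ∧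
      f = lin w * q := by
  have hu : ¬ IsUnit f := by
    intro hu
    have := (isUnit_iff_totalDegree_of_isReduced.1 hu).2
    rw [hf.totalDegree h0] at this
    omega
  rw [irreducible_iff] at hirr
  push Not at hirr
  obtain ⟨g, h, rfl, hg, hh⟩ := hirr hu
  have hg0 : g ≠ 0 := left_ne_zero_of_mul h0
  have hh0 : h ≠ 0 := right_ne_zero_of_mul h0
  have hdeg := totalDegree_mul_of_isDomain hg0 hh0
  rw [hf.totalDegree h0] at hdeg
  have pos : ∀ g : CoordRing k, g ≠ 0 → ¬ IsUnit g → 0 < g.totalDegree := by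
    intro g hg0 hg
    by_contra hd
    have hd : g.totalDegree = 0 := by omega
    rw [totalDegree_eq_zero_iff_eq_C] at hd
    rw [hd] at hg hg0
    exact hg ((isUnit_iff_ne_zero.2 (by simpa using hg0)).map C)
  have hgp := pos g hg0 hg
  have hhp := pos h hh0 hh
  have key := homogeneousComponent_mul_of_totalDegree (f := g) (g := h)
  rw [← hdeg, homogeneousComponent_eq_self hf] at key
  have h1 := homogeneousComponent_isHomogeneous g.totalDegree g
  have h2 := homogeneousComponent_isHomogeneous h.totalDegree h
  rcases (by omega : g.totalDegree = 1 ∧ h.totalDegree = 2 ∨ g.totalDegree = 2 ∧ h.totalDegree = 1)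
    with ⟨e1, e2⟩ | ⟨e1, e2⟩
  · rw [e1] at h1 key
    rw [e2] at h2 key
    obtain ⟨w, hw⟩ := exists_eq_lin h1
    exact ⟨w, _, h2, by rw [key, hw]⟩
  · rw [e1] at h1 key
    rw [e2] at h2 key
    obtain ⟨w, hw⟩ := exists_eq_lin h2
    exact ⟨w, _, h1, by rw [key, hw, mul_comm]⟩

theorem exists_orthogonal_pair (w : Fin 3 → k) : ∃ a b : Fin 3 → k, w ⬝ᵥ a = 0 ∧ w ⬝ᵥ b = 0 ∧
    ∀ α γ : k, α • a + γ • b = 0 → α = 0 ∧ γ = 0 := by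
  have : 2 ≤ Module.finrank k (LinearMap.ker (dotProductBilin k k w : (Fin 3 → k) →ₗ[k] k)) := by
    have h1 := LinearMap.finrank_range_add_finrank_ker (dotProductBilin k k w : (Fin 3 → k) →ₗ[k] k)
    have h2 := Submodule.finrank_le (LinearMap.range (dotProductBilin k k w : (Fin 3 → k) →ₗ[k] k))
    simp at h1 h2
    omega
  obtain ⟨v, hv⟩ := exists_linearIndependent_of_le_finrank this
  refine ⟨v 0, v 1, (v 0).2, (v 1).2, fun α γ h => ?_⟩
  have h' : α • v 0 + γ • v 1 = 0 := Subtype.ext h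
  have := Fintype.linearIndependent_iff.1 hv ![α, γ] (by simpa using h')
  exact ⟨this 0, this 1⟩

theorem exists_zero_quadratic [IsAlgClosed k] (A B D : k) :
    ∃ α γ : k, (α ≠ 0 ∨ γ ≠ 0) ∧ α ^ 2 * A + α * γ * B + γ ^ 2 * D = 0 := by
  by_cases hA : A = 0
  · exact ⟨1, 0, by simp, by simp [hA]⟩
  · obtain ⟨x, hx⟩ := IsAlgClosed.exists_root
      (Polynomial.C A * Polynomial.X ^ 2 + Polynomial.C B * Polynomial.X + Polynomial.C D) (by
        rw [Polynomial.degree_quadratic hA]; simp)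
    refine ⟨x, 1, by simp, ?_⟩
    simp [Polynomial.IsRoot] at hx
    linear_combination hx

theorem IsSmoothCubic.ne_zero {f : CoordRing k} (hf : IsSmoothCubic f) : f ≠ 0 := by
  rintro rfl
  obtain ⟨j, hj⟩ := hf.smooth (fun _ => 1) (fun h => one_ne_zero (congrFun h 0)) (by simp)
  simp at hj

theorem IsSmoothCubic.grad_ne_zero {f : CoordRing k} (hf : IsSmoothCubic f) {v : Fin 3 → k}
    (hv : v ≠ 0) (h : eval v f = 0) : grad f v ≠ 0 := by
  obtain ⟨j, hj⟩ := hf.smooth v hv h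
  exact fun h0 => hj (congrFun h0 j)

/-- Over an algebraically closed field the line meets the residual conic, and the product is
singular at a common point. -/
theorem IsSmoothCubic.not_lin_dvd [IsAlgClosed k] {f : CoordRing k} (hf : IsSmoothCubic f)
    (w : Fin 3 → k) (q : CoordRing k) (hq : q.IsHomogeneous 2) : f ≠ lin w * q := by
  rintro rfl
  obtain ⟨a, b, ha, hb, hab⟩ := exists_orthogonal_pair w
  obtain ⟨α, γ, hne, h⟩ := exists_zero_quadratic (eval a q) (grad q a ⬝ᵥ b) (eval b q)
  rw [← (eval_line_quadratic hq a b).1] at h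
  have hw : w ⬝ᵥ (α • a + γ • b) = 0 := by simp [dotProduct_add, dotProduct_smul, ha, hb]
  refine hf.grad_ne_zero (v := α • a + γ • b) (fun h0 => ?_) (by simp [h]) ?_
  · have := hab _ _ h0; tauto
  · simp [grad_mul, h, hw]

theorem IsSmoothCubic.irreducible [IsAlgClosed k] {f : CoordRing k} (hf : IsSmoothCubic f) :
    Irreducible f := by
  by_contra h
  obtain ⟨w, q, hq, h⟩ := exists_linear_factor hf.homogeneous hf.ne_zero h
  exact hf.not_lin_dvd w q hq h

theorem IsSmoothCubic.isPrime [IsAlgClosed k] {f : CoordRing k} (hf : IsSmoothCubic f) :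
    (Ideal.span {f}).IsPrime :=
  (Ideal.span_singleton_prime hf.ne_zero).2 hf.irreducible.prime

end Forms

/-! ### Valuations at locally principal primes of a Noetherian domain. -/

section LocalRing

variable {R : Type*} [CommRing R] [IsDomain R] [IsNoetherianRing R]

/-- A Noetherian domain is a discrete valuation ring locally at a prime that is locally generated by
one nonzero element. -/
theorem isDiscreteValuationRing_localization {P : Ideal R} [P.IsPrime] {s t : R} (hs : s ∉ P)
    (ht : t ∈ P) (ht0 : t ≠ 0) (h : ∀ x ∈ P, s * x ∈ Ideal.span {t}) :
    IsDiscreteValuationRing (Localization.AtPrime P) ∧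
      IsLocalRing.maximalIdeal (Localization.AtPrime P) =
        Ideal.span {algebraMap R (Localization.AtPrime P) t} := by
  have hmax : IsLocalRing.maximalIdeal (Localization.AtPrime P) =
      Ideal.span {algebraMap R (Localization.AtPrime P) t} := by
    rw [← Localization.AtPrime.map_eq_maximalIdeal]
    refine le_antisymm (Ideal.map_le_iff_le_comap.2 fun x hx => ?_) ?_
    · have hu : IsUnit (algebraMap R (Localization.AtPrime P) s) :=
        IsLocalization.map_units (Localization.AtPrime P) (⟨s, hs⟩ : P.primeCompl)
      rw [Ideal.mem_comap, ← Ideal.unit_mul_mem_iff_mem _ hu, ← map_mul]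
      have := Ideal.mem_map_of_mem (algebraMap R (Localization.AtPrime P)) (h x hx)
      rwa [Ideal.map_span, Set.image_singleton] at this
    · rw [Ideal.span_singleton_le_iff_mem]
      exact Ideal.mem_map_of_mem _ ht
  have hinj : Function.Injective (algebraMap R (Localization.AtPrime P)) :=
    IsLocalization.injective _ P.primeCompl_le_nonZeroDivisors
  have hne : algebraMap R (Localization.AtPrime P) t ≠ 0 := by
    rwa [Ne, map_eq_zero_iff _ hinj]
  have : IsNoetherianRing (Localization.AtPrime P) :=
    IsLocalization.isNoetherianRing P.primeCompl _ inferInstance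
  have hfield : ¬ IsField (Localization.AtPrime P) := by
    rw [IsLocalRing.isField_iff_maximalIdeal_eq, hmax, Ideal.span_singleton_eq_bot]
    exact hne
  have h4 : IsDiscreteValuationRing (Localization.AtPrime P) ↔
      (IsLocalRing.maximalIdeal (Localization.AtPrime P)).IsPrincipal :=
    (IsDiscreteValuationRing.TFAE (Localization.AtPrime P) hfield).out 0 4
  exact ⟨h4.2 ⟨⟨_, hmax⟩⟩, hmax⟩

/-- The valuation attached to a prime of a Noetherian domain that is locally generated by one
nonzero element. -/
theorem exists_valuation_of_prime {P : Ideal R} [P.IsPrime] {s t : R} (hs : s ∉ P)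
    (ht : t ∈ P) (ht0 : t ≠ 0) (h : ∀ x ∈ P, s * x ∈ Ideal.span {t}) :
    ∃ v : R → ℕ∞, (∀ x y, v (x * y) = v x + v y) ∧ (∀ x, v x = ⊤ ↔ x = 0) ∧
      (∀ (n : ℕ) x, n ≤ v x ↔ ∃ a ∉ P, a * x ∈ P ^ n) ∧
      (∀ x y, v y ≤ v x ↔ ∃ a ∉ P, a * x ∈ Ideal.span {y}) ∧ v t = 1 := by
  obtain ⟨hd, hmax⟩ := isDiscreteValuationRing_localization hs ht ht0 h
  have hinj : Function.Injective (algebraMap R (Localization.AtPrime P)) :=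
    IsLocalization.injective _ P.primeCompl_le_nonZeroDivisors
  have mem_map : ∀ (I : Ideal R) (x : R), algebraMap R (Localization.AtPrime P) x ∈
      I.map (algebraMap R (Localization.AtPrime P)) ↔ ∃ a ∉ P, a * x ∈ I := by
    intro I x
    rw [IsLocalization.algebraMap_mem_map_algebraMap_iff P.primeCompl]
    simp [Ideal.primeCompl]
  refine ⟨fun x => IsDiscreteValuationRing.addVal _ (algebraMap R (Localization.AtPrime P) x),
    fun x y => by simp, fun x => ?_, fun n x => ?_, fun x y => ?_,
    IsDiscreteValuationRing.addVal_uniformizer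
      ((IsDiscreteValuationRing.irreducible_iff_uniformizer _).2 hmax)⟩
  · rw [IsDiscreteValuationRing.addVal_eq_top_iff, map_eq_zero_iff _ hinj]
  · have hirr : Irreducible (algebraMap R (Localization.AtPrime P) t) :=
      (IsDiscreteValuationRing.irreducible_iff_uniformizer _).2 hmax
    rw [← mem_map, Ideal.map_pow, Localization.AtPrime.map_eq_maximalIdeal, hmax,
      Ideal.span_singleton_pow, Ideal.mem_span_singleton,
      ← IsDiscreteValuationRing.addVal_le_iff_dvd, hirr.addVal_pow]
  · rw [IsDiscreteValuationRing.addVal_le_iff_dvd, ← Ideal.mem_span_singleton, ← mem_map,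
      Ideal.map_span, Set.image_singleton]

/-- A locally principal prime has height one: if `x ∈ Q` has valuation `n`, then the `n`-th power of
any element of `P` is locally a multiple of `x`. This will make point ideals minimal over a form
vanishing at the point. -/
theorem eq_of_le_of_mem_of_ne_zero {P Q : Ideal R} [P.IsPrime] [hQ : Q.IsPrime] {s t : R} (hs : s ∉ P)
    (ht : t ∈ P) (ht0 : t ≠ 0) (h : ∀ x ∈ P, s * x ∈ Ideal.span {t}) (hQP : Q ≤ P) {x : R}
    (hx : x ∈ Q) (hx0 : x ≠ 0) : Q = P := by
  obtain ⟨v, hmul, htop, hpow, hle, -⟩ := exists_valuation_of_prime hs ht ht0 h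
  have h0 : ∀ a, v a = 0 ↔ a ∉ P := by
    intro a
    rw [← not_iff_not, not_not, ← ne_eq, ← Order.one_le_iff_ne_zero]
    have := hpow 1 a
    rw [Nat.cast_one] at this
    rw [this]
    constructor
    · rintro ⟨b, hb, hba⟩
      rw [pow_one] at hba
      exact (Ideal.IsPrime.mem_or_mem ‹_› hba).resolve_left hb
    · intro ha
      exact ⟨s, hs, by rw [pow_one]; exact Ideal.mul_mem_left _ _ ha⟩
  refine le_antisymm hQP fun y hy => ?_
  -- a power of `y` is locally divisible by `x`
  obtain ⟨n, hn⟩ := ENat.ne_top_iff_exists.1 (mt (htop x).1 hx0)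
  have hpown : ∀ m : ℕ, (m : ℕ∞) ≤ v (y ^ m) := by
    intro m
    rw [hpow]
    exact ⟨s, hs, Ideal.mul_mem_left _ _ (Ideal.pow_mem_pow hy m)⟩
  have := hpown n
  rw [hn, hle] at this
  obtain ⟨a, ha, hay⟩ := this
  have h1 : a * y ^ n ∈ Q := (Ideal.span_singleton_le_iff_mem _).2 hx hay
  have h2 := (hQ.mem_or_mem h1).resolve_left fun h => ha (hQP h)
  exact hQ.mem_of_pow_mem _ h2

end LocalRing

/-! ### The homogeneous prime ideal of a point. -/

section PointIdeal

attribute [local instance] MvPolynomial.gradedAlgebra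

variable {k : Type*} [Field k]

/-- The restriction of a polynomial to the line spanned by a vector. -/
noncomputable def coneMap (v : Fin 3 → k) : CoordRing k →ₐ[k] Polynomial k :=
  aeval fun i => Polynomial.C (v i) * Polynomial.X

theorem coneMap_of_isHomogeneous (v : Fin 3 → k) {G : CoordRing k} {d : ℕ} (hG : G.IsHomogeneous d) :
    coneMap v G = Polynomial.C (eval v G) * Polynomial.X ^ d := by
  rw [coneMap, aeval_def, eval₂_eq, eval_eq, map_sum, Finset.sum_mul]
  refine Finset.sum_congr rfl fun m hm => ?_
  rw [hG.degree_eq_sum_deg_support hm]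
  simp only [mul_pow, Finset.prod_mul_distrib, Finset.prod_pow_eq_pow_sum, map_mul, map_prod, map_pow]
  rw [mul_assoc]
  rfl

/-- Restricted to the line over `p`, the components of a polynomial become monomials of different
degrees, so they vanish separately. Primality follows because the target is a domain. -/
theorem pointIdeal_eq_ker (p : Plane k) : pointIdeal p = RingHom.ker (coneMap p.rep) := by
  apply le_antisymm
  · refine Ideal.span_le.2 ?_
    rintro G ⟨d, hG, h0⟩
    simp [RingHom.mem_ker, coneMap_of_isHomogeneous _ hG, h0]
  · intro G hG
    rw [← sum_homogeneousComponent G]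
    refine Ideal.sum_mem _ fun d _ => Ideal.subset_span ⟨d, homogeneousComponent_isHomogeneous _ _, ?_⟩
    rw [RingHom.mem_ker, ← sum_homogeneousComponent G, map_sum] at hG
    have := congrArg (Polynomial.coeff · d) hG
    simp only [coneMap_of_isHomogeneous _ (homogeneousComponent_isHomogeneous _ G),
      Polynomial.finsetSum_coeff, Polynomial.coeff_C_mul, Polynomial.coeff_X_pow,
      Polynomial.coeff_zero] at this
    by_cases hd : d ∈ Finset.range (G.totalDegree + 1)
    · simpa [Finset.sum_ite_eq, hd] using this
    · contradiction

instance (p : Plane k) : (pointIdeal p).IsPrime := by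
  rw [pointIdeal_eq_ker]
  exact RingHom.ker_isPrime _

theorem mem_pointIdeal {p : Plane k} {G : CoordRing k} {d : ℕ} (hG : G.IsHomogeneous d) :
    G ∈ pointIdeal p ↔ eval p.rep G = 0 := by
  rw [pointIdeal_eq_ker, RingHom.mem_ker, coneMap_of_isHomogeneous _ hG]
  simp

theorem homogeneousComponent_mul_form (A : CoordRing k) {G : CoordRing k} {d e : ℕ}
    (hG : G.IsHomogeneous d) :
    homogeneousComponent (e + d) (A * G) = homogeneousComponent e A * G := by
  conv_lhs => rw [← sum_homogeneousComponent A, Finset.sum_mul, map_sum]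
  have : ∀ i, homogeneousComponent (e + d) (homogeneousComponent i A * G) =
      if i = e then homogeneousComponent e A * G else 0 := by
    intro i
    rw [homogeneousComponent_of_mem ((homogeneousComponent_isHomogeneous i A).mul hG)]
    by_cases hi : i = e
    · simp [hi]
    · rw [if_neg (by omega), if_neg hi]
  simp_rw [this]
  rw [Finset.sum_ite_eq']
  split_ifs with hr
  · rfl
  · rw [homogeneousComponent_eq_zero _ _ (by simpa using hr), zero_mul]

/-- Some homogeneous component of `A` lies outside the point ideal, and it multiplies `G` into the
homogeneous ideal `J`. This reconciles the definition of `ord`, which uses forms, with localization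
at a prime of the full coordinate ring. -/
theorem exists_form_notMem_pointIdeal {p : Plane k} {A : CoordRing k} (hA : A ∉ pointIdeal p)
    {J : Ideal (CoordRing k)} (hJ : J.IsHomogeneous (homogeneousSubmodule (Fin 3) k))
    {G : CoordRing k} {d : ℕ} (hG : G.IsHomogeneous d) (h : A * G ∈ J) :
    ∃ (e : ℕ) (B : CoordRing k), B.IsHomogeneous e ∧ eval p.rep B ≠ 0 ∧ B * G ∈ J := by
  by_contra! hc
  refine hA ?_
  rw [← sum_homogeneousComponent A]
  refine Ideal.sum_mem _ fun e _ => ?_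
  have he := homogeneousComponent_isHomogeneous e A
  rw [mem_pointIdeal he]
  by_contra h0
  refine hc e _ he h0 ?_
  rw [← homogeneousComponent_mul_form A hG]
  exact homogeneousComponent_mem_of_mem hJ h (e + d)

theorem isHomogeneous_pointIdeal (p : Plane k) :
    (pointIdeal p).IsHomogeneous (homogeneousSubmodule (Fin 3) k) := by
  refine Ideal.homogeneous_span _ _ ?_
  rintro G ⟨d, hG, -⟩
  exact ⟨d, hG⟩

theorem isHomogeneous_pow {I : Ideal (CoordRing k)}
    (hI : I.IsHomogeneous (homogeneousSubmodule (Fin 3) k)) (n : ℕ) :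
    (I ^ n).IsHomogeneous (homogeneousSubmodule (Fin 3) k) := by
  induction n with
  | zero => rw [pow_zero, Ideal.one_eq_top]; exact Ideal.IsHomogeneous.top _
  | succ n ih => rw [pow_succ]; exact ih.mul hI

theorem isHomogeneous_span_pair {G H : CoordRing k} {d e : ℕ} (hG : G.IsHomogeneous d)
    (hH : H.IsHomogeneous e) :
    (Ideal.span {G, H}).IsHomogeneous (homogeneousSubmodule (Fin 3) k) := by
  refine Ideal.homogeneous_span _ _ ?_
  rintro x (rfl | rfl)
  exacts [⟨d, hG⟩, ⟨e, hH⟩]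

theorem isHomogeneous_span_singleton {G : CoordRing k} {d : ℕ} (hG : G.IsHomogeneous d) :
    (Ideal.span {G}).IsHomogeneous (homogeneousSubmodule (Fin 3) k) := by
  refine Ideal.homogeneous_span _ _ ?_
  rintro x rfl
  exact ⟨d, hG⟩

end PointIdeal

/-! ### The order of vanishing on a smooth cubic as a discrete valuation. -/

section Order

attribute [local instance] MvPolynomial.gradedAlgebra

variable {k : Type*} [Field k]

theorem eval_eq_zero_of_mem_pointIdeal {p : Plane k} {G : CoordRing k} (hG : G ∈ pointIdeal p) :
    eval p.rep G = 0 := by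
  rw [pointIdeal] at hG
  induction hG using Submodule.span_induction with
  | mem x hx => obtain ⟨d, -, h⟩ := hx; exact h
  | zero => simp
  | add x y _ _ hx hy => simp [hx, hy]
  | smul a x _ hx => simp [hx]

theorem exists_relation {v a b c : Fin 3 → k} (hv : v ≠ 0) (ha : a ⬝ᵥ v = 0) (hb : b ⬝ᵥ v = 0)
    (hc : c ⬝ᵥ v = 0) : ∃ x y z : k, (x ≠ 0 ∨ y ≠ 0 ∨ z ≠ 0) ∧ x • a + y • b + z • c = 0 := by
  have h1 : (Matrix.of ![a, b, c]).det = 0 := by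
    rw [← Matrix.exists_mulVec_eq_zero_iff]
    refine ⟨v, hv, ?_⟩
    funext i
    fin_cases i <;> simpa [Matrix.mulVec]
  obtain ⟨w, hw, h⟩ := Matrix.exists_vecMul_eq_zero_iff.2 h1
  refine ⟨w 0, w 1, w 2, ?_, ?_⟩
  · by_contra! hc
    exact hw (funext fun i => by fin_cases i <;> simp [hc])
  · rw [← h]
    funext i
    simp [Matrix.vecMul, dotProduct, Fin.sum_univ_three]

theorem exists_eq_combination {v a b c : Fin 3 → k} (hv : v ≠ 0) (ha : a ⬝ᵥ v = 0) (hb : b ⬝ᵥ v = 0)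
    (hc : c ⬝ᵥ v = 0) (hb0 : b ≠ 0) (hab : ∀ x : k, a ≠ x • b) :
    ∃ x y : k, c = x • a + y • b := by
  obtain ⟨x, y, z, hne, h⟩ := exists_relation hv ha hb hc
  have hi : ∀ i, x * a i + y * b i + z * c i = 0 := fun i => by simpa using congrFun h i
  have hz : z ≠ 0 := by
    rintro rfl
    have hx : x = 0 := by
      by_contra hx
      refine hab (-(x⁻¹ * y)) (funext fun i => ?_)
      simp only [Pi.smul_apply, smul_eq_mul]
      field_simp
      linear_combination hi i
    subst hx
    simp [hb0] at h
    simp [h] at hne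
  refine ⟨-(z⁻¹ * x), -(z⁻¹ * y), funext fun i => ?_⟩
  simp only [Pi.add_apply, Pi.smul_apply, smul_eq_mul]
  field_simp
  linear_combination hi i

theorem notMem_span_of_degree_lt {f : CoordRing k} (hf : f.IsHomogeneous 3) {G : CoordRing k} {d : ℕ}
    (hG : G.IsHomogeneous d) (hd : d < 3) (h0 : G ≠ 0) : G ∉ Ideal.span {f} := by
  rw [Ideal.mem_span_singleton]
  rintro ⟨q, rfl⟩
  have hq := right_ne_zero_of_mul h0
  have hf0 := left_ne_zero_of_mul h0
  have h1 := totalDegree_mul_of_isDomain hf0 hq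
  rw [hG.totalDegree h0, hf.totalDegree hf0] at h1
  omega

theorem lin_mem_pointIdeal {p : Plane k} {w : Fin 3 → k} : lin w ∈ pointIdeal p ↔ w ⬝ᵥ p.rep = 0 := by
  rw [mem_pointIdeal (isHomogeneous_lin w), eval_lin]

theorem pointIdeal_le_span {p : Plane k} {I : Ideal (CoordRing k)}
    (h : ∀ w : Fin 3 → k, w ⬝ᵥ p.rep = 0 → lin w ∈ I) : pointIdeal p ≤ I := by
  obtain ⟨j, hj⟩ := Function.ne_iff.1 p.rep_nonzero
  simp only [Pi.zero_apply] at hj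
  refine Ideal.span_le.2 ?_
  rintro G ⟨d, hG, h0⟩
  have h1 : ∀ i, X i - C (p.rep i * (p.rep j)⁻¹) * X j ∈ I := by
    intro i
    convert h (Pi.single i 1 - (p.rep i * (p.rep j)⁻¹) • Pi.single j 1) ?_ using 1
    · simp [lin, Pi.single_apply, sub_mul, Finset.sum_sub_distrib, apply_ite C]
    · simp [sub_dotProduct, smul_dotProduct, hj]
  -- Replacing each `X i` by `(p i / p j) X j` changes nothing modulo the linear forms through `p`,
  -- and it sends `G` to a multiple of its value at `p`.
  have h2 := sub_aeval_mem h1 G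
  have h3 : aeval (fun i => C (p.rep i * (p.rep j)⁻¹) * X j) G = (0 : CoordRing k) := by
    have e : (aeval (fun i => C (p.rep i * (p.rep j)⁻¹) * X j) : CoordRing k →ₐ[k] CoordRing k) =
        (Polynomial.aeval (C (p.rep j)⁻¹ * X j)).comp (coneMap p.rep) := by
      refine MvPolynomial.algHom_ext fun i => ?_
      simp [coneMap, mul_assoc, algebraMap_eq]
    rw [e, AlgHom.comp_apply, coneMap_of_isHomogeneous _ hG, h0]
    simp
  rwa [h3, sub_zero] at h2

theorem IsSmoothCubic.mem_pointIdeal {f : CoordRing k} (hf : IsSmoothCubic f) (p : zeroLocus f) :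
    f ∈ pointIdeal p.1 :=
  (ChordConstruction.mem_pointIdeal hf.homogeneous).2 p.2

theorem grad_dotProduct_self {f : CoordRing k} (hf : f.IsHomogeneous 3) (v : Fin 3 → k) :
    grad f v ⬝ᵥ v = 3 * eval v f := by
  have := hf.sum_X_mul_pderiv
  have := congrArg (eval v) this
  simp only [map_sum, map_mul, eval_X, nsmul_eq_mul] at this
  simp only [dotProduct, grad]
  simp_rw [mul_comm (eval v _)]
  rw [this]
  simp

/-- A line through a point of a smooth cubic that is not the tangent line generates the ideal of the
point in the local ring of the curve. -/
theorem IsSmoothCubic.exists_local_generator {f : CoordRing k} (hf : IsSmoothCubic f)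
    (p : zeroLocus f) {w : Fin 3 → k} (hw : w ⬝ᵥ p.1.rep = 0)
    (hT : ∀ c : k, w ≠ c • grad f p.1.rep) :
    ∃ B ∉ pointIdeal p.1, ∀ G ∈ pointIdeal p.1, B * G ∈ Ideal.span {lin w, f} := by
  have hp : eval p.1.rep f = 0 := p.2
  have hT0 := hf.grad_ne_zero p.1.rep_nonzero hp
  have hTp : grad f p.1.rep ⬝ᵥ p.1.rep = 0 := by
    rw [grad_dotProduct_self hf.homogeneous, hp, mul_zero]
  have hle : pointIdeal p.1 ≤ Ideal.span {lin w, lin (grad f p.1.rep)} := by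
    refine pointIdeal_le_span fun u hu => ?_
    obtain ⟨x, y, rfl⟩ := exists_eq_combination p.1.rep_nonzero hw hTp hu hT0 hT
    rw [lin_add, lin_smul, lin_smul]
    exact Ideal.mem_span_pair.2 ⟨_, _, rfl⟩
  -- Write `f = A · lin w + B · lin T` with `T` the tangent. Gradients at `p` give `T = A(p) w +
  -- B(p) T`; so `B(p) ≠ 0`, since `w` is not a multiple of `T`. Modulo `f`, the form `B · lin T` is
  -- a multiple of `lin w`.
  obtain ⟨A, B, h⟩ := Ideal.mem_span_pair.1 (hle (hf.mem_pointIdeal p))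
  have hgrad : grad f p.1.rep = eval p.1.rep A • w + eval p.1.rep B • grad f p.1.rep := by
    have := congrArg (grad · p.1.rep) h
    simpa [grad_add, grad_mul, hw, hTp] using this.symm
  have hB : eval p.1.rep B ≠ 0 := by
    intro h0
    rw [h0, zero_smul, add_zero] at hgrad
    have hA : eval p.1.rep A ≠ 0 := fun hA => hT0 (by rw [hgrad, hA, zero_smul])
    refine hT (eval p.1.rep A)⁻¹ ?_
    rw [hgrad, smul_smul, inv_mul_cancel₀ hA, one_smul]
  refine ⟨B, fun h => hB (eval_eq_zero_of_mem_pointIdeal h), fun G hG => ?_⟩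
  obtain ⟨x, y, rfl⟩ := Ideal.mem_span_pair.1 (hle hG)
  refine Ideal.mem_span_pair.2 ⟨B * x - y * A, y, ?_⟩
  linear_combination (-y) * h

theorem exists_transversal {f : CoordRing k} (p : zeroLocus f) : ∃ w : Fin 3 → k, w ⬝ᵥ p.1.rep = 0 ∧ ∀ c : k, w ≠ c • grad f p.1.rep := by
  obtain ⟨a, b, ha, hb, hab⟩ := exists_orthogonal_pair p.1.rep
  by_contra! hc
  obtain ⟨x, hx⟩ := hc a (by rwa [dotProduct_comm])
  obtain ⟨y, hy⟩ := hc b (by rwa [dotProduct_comm])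
  have h1 := hab y (-x) (by rw [hx, hy, smul_smul, smul_smul, ← add_smul]; ring_nf; simp)
  have h2 : y = 0 := h1.1
  have h3 : x = 0 := by simpa using h1.2
  have := hab 1 0 (by rw [hx, h3]; simp)
  simp at this

theorem mk_mem_map_iff {f : CoordRing k} {I : Ideal (CoordRing k)} {G : CoordRing k} :
    Ideal.Quotient.mk (Ideal.span {f}) G ∈ I.map (Ideal.Quotient.mk (Ideal.span {f})) ↔
      G ∈ I ⊔ Ideal.span {f} := by
  rw [← Ideal.mem_comap, Ideal.comap_map_of_surjective' _ Ideal.Quotient.mk_surjective,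
    Ideal.mk_ker]

theorem pointIdeal_injective : Function.Injective (pointIdeal : Plane k → Ideal (CoordRing k)) := by
  intro p q h
  have h1 : ∀ w : Fin 3 → k, w ⬝ᵥ p.rep = 0 → w ⬝ᵥ q.rep = 0 := by
    intro w hw
    rw [← lin_mem_pointIdeal] at hw ⊢
    rwa [← h]
  rw [← p.mk_rep, ← q.mk_rep, Projectivization.mk_eq_mk_iff_crossProduct_eq_zero]
  have h2 := h1 ![0, -p.rep 2, p.rep 1] (by simp [dotProduct, Fin.sum_univ_three]; ring)
  have h3 := h1 ![p.rep 2, 0, -p.rep 0] (by simp [dotProduct, Fin.sum_univ_three]; ring)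
  have h4 := h1 ![-p.rep 1, p.rep 0, 0] (by simp [dotProduct, Fin.sum_univ_three]; ring)
  simp [dotProduct, Fin.sum_univ_three] at h2 h3 h4
  rw [cross_apply]
  funext i
  fin_cases i <;> simp
  · linear_combination h2
  · linear_combination h3
  · linear_combination h4

theorem IsSmoothCubic.ord_eq {f : CoordRing k} (hf : IsSmoothCubic f) (p : zeroLocus f)
    {v : CoordRing k → ℕ∞} (htop : ∀ G, v G = ⊤ ↔ G ∈ Ideal.span {f})
    (hpow : ∀ (n : ℕ) G, n ≤ v G ↔
      ∃ A ∉ pointIdeal p.1, A * G ∈ pointIdeal p.1 ^ n ⊔ Ideal.span {f})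
    {G : CoordRing k} {d : ℕ} (hG : G.IsHomogeneous d) (hGf : G ∉ Ideal.span {f}) :
    (ord f p.1 G : ℕ∞) = v G := by
  obtain ⟨m, hm⟩ := ENat.ne_top_iff_exists.1 (mt (htop G).1 hGf)
  have hset : {n : ℕ | ∃ (e : ℕ) (A : CoordRing k), A.IsHomogeneous e ∧ eval p.1.rep A ≠ 0 ∧
      A * G ∈ pointIdeal p.1 ^ n ⊔ Ideal.span {f}} = Set.Iic m := by
    ext n
    rw [Set.mem_Iic, ← Nat.cast_le (α := ℕ∞), hm, hpow]
    constructor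
    · rintro ⟨e, A, hA, hA0, h⟩
      exact ⟨A, by rwa [ChordConstruction.mem_pointIdeal hA], h⟩
    · rintro ⟨A, hA, h⟩
      exact exists_form_notMem_pointIdeal hA ((isHomogeneous_pow (isHomogeneous_pointIdeal _) n).sup
        (isHomogeneous_span_singleton hf.homogeneous)) hG h
  rw [ord, hset, csSup_Iic, hm]

variable [IsAlgClosed k]

/-- The valuation of the local ring of a smooth cubic at a point. -/
theorem IsSmoothCubic.exists_valuation {f : CoordRing k} (hf : IsSmoothCubic f) (p : zeroLocus f) :
    ∃ v : CoordRing k → ℕ∞, (∀ G H, v (G * H) = v G + v H) ∧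
      (∀ G, v G = ⊤ ↔ G ∈ Ideal.span {f}) ∧
      (∀ (n : ℕ) G, n ≤ v G ↔ ∃ A ∉ pointIdeal p.1, A * G ∈ pointIdeal p.1 ^ n ⊔ Ideal.span {f}) ∧
      (∀ G H, v H ≤ v G ↔ ∃ A ∉ pointIdeal p.1, A * G ∈ Ideal.span {H, f}) ∧
      (∀ w : Fin 3 → k, w ⬝ᵥ p.1.rep = 0 → (∀ c : k, w ≠ c • grad f p.1.rep) → v (lin w) = 1) := by
  have := hf.isPrime
  obtain ⟨π, hπ⟩ : ∃ π, π = Ideal.Quotient.mk (Ideal.span {f}) := ⟨_, rfl⟩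
  have hsurj : Function.Surjective π := hπ ▸ Ideal.Quotient.mk_surjective
  have hker : RingHom.ker π = Ideal.span {f} := hπ ▸ Ideal.mk_ker
  have hzero : ∀ G, π G = 0 ↔ G ∈ Ideal.span {f} := by
    intro G; rw [← RingHom.mem_ker, hker]
  have hmap : ∀ (I : Ideal (CoordRing k)) G, π G ∈ I.map π ↔ G ∈ I ⊔ Ideal.span {f} := by
    intro I G; rw [hπ, mk_mem_map_iff]
  have hfp : Ideal.span {f} ≤ pointIdeal p.1 :=
    (Ideal.span_singleton_le_iff_mem _).2 (hf.mem_pointIdeal p)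
  have hprime : ((pointIdeal p.1).map π).IsPrime :=
    Ideal.map_isPrime_of_surjective hsurj (by rwa [hker])
  have hmem : ∀ G, π G ∈ (pointIdeal p.1).map π ↔ G ∈ pointIdeal p.1 := by
    intro G
    rw [hmap, sup_eq_left.2 hfp]
  have hspan : ∀ G H, π G ∈ Ideal.span {π H} ↔ G ∈ Ideal.span {H, f} := by
    intro G H
    rw [← Set.image_singleton, ← Ideal.map_span, hmap, ← Ideal.span_union,
      Set.singleton_union]
  obtain ⟨w, hw, hT⟩ := exists_transversal p
  obtain ⟨B, hB, hgen⟩ := hf.exists_local_generator p hw hT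
  have hw0 : w ≠ 0 := fun h => hT 0 (by rw [h, zero_smul])
  obtain ⟨v, hmul, htop, hpow, hle, hone⟩ := exists_valuation_of_prime (P := (pointIdeal p.1).map π)
    (s := π B) (t := π (lin w)) (by rwa [hmem]) (by rwa [hmem, lin_mem_pointIdeal])
    (by
      rw [Ne, hzero]
      exact notMem_span_of_degree_lt hf.homogeneous (isHomogeneous_lin w) (by norm_num)
        (lin_ne_zero hw0))
    (by
      intro x hx
      obtain ⟨G, rfl⟩ := hsurj x
      rw [← map_mul, hspan]
      exact hgen G ((hmem G).1 hx))
  have hle' : ∀ G H, v (π H) ≤ v (π G) ↔ ∃ A ∉ pointIdeal p.1, A * G ∈ Ideal.span {H, f} := by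
    intro G H
    rw [hle, hsurj.exists]
    simp only [hmem, ← map_mul, hspan]
  refine ⟨fun G => v (π G), fun G H => by simp only [map_mul, hmul], fun G => ?_, fun n G => ?_, hle',
    fun u hu huT => ?_⟩
  · rw [htop, hzero]
  · rw [hpow, hsurj.exists]
    simp only [hmem, ← map_mul, ← Ideal.map_pow, hmap]
  · obtain ⟨D, hD, hgen'⟩ := hf.exists_local_generator p hu huT
    rw [← hone]
    refine le_antisymm ((hle' _ _).2 ⟨D, hD, hgen' _ (lin_mem_pointIdeal.2 hw)⟩)
      ((hle' _ _).2 ⟨B, hB, hgen _ (lin_mem_pointIdeal.2 hu)⟩)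

theorem IsSmoothCubic.ord_mul {f : CoordRing k} (hf : IsSmoothCubic f) (p : zeroLocus f)
    {G H : CoordRing k} {d e : ℕ} (hG : G.IsHomogeneous d) (hGf : G ∉ Ideal.span {f})
    (hH : H.IsHomogeneous e) (hHf : H ∉ Ideal.span {f}) :
    ord f p.1 (G * H) = ord f p.1 G + ord f p.1 H := by
  obtain ⟨v, hmul, htop, hpow, -⟩ := hf.exists_valuation p
  have hGH : G * H ∉ Ideal.span {f} := fun h => (hf.isPrime.mem_or_mem h).elim hGf hHf
  rw [← Nat.cast_inj (R := ℕ∞), Nat.cast_add, hf.ord_eq p htop hpow hG hGf,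
    hf.ord_eq p htop hpow hH hHf, hf.ord_eq p htop hpow (hG.mul hH) hGH, hmul]

theorem IsSmoothCubic.ord_le_iff {f : CoordRing k} (hf : IsSmoothCubic f) (p : zeroLocus f)
    {G H : CoordRing k} {d e : ℕ} (hG : G.IsHomogeneous d) (hGf : G ∉ Ideal.span {f})
    (hH : H.IsHomogeneous e) (hHf : H ∉ Ideal.span {f}) :
    ord f p.1 H ≤ ord f p.1 G ↔ ∃ (e : ℕ) (A : CoordRing k), A.IsHomogeneous e ∧
      eval p.1.rep A ≠ 0 ∧ A * G ∈ Ideal.span {H, f} := by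
  obtain ⟨v, hmul, htop, hpow, hle, -⟩ := hf.exists_valuation p
  rw [← Nat.cast_le (α := ℕ∞), hf.ord_eq p htop hpow hG hGf, hf.ord_eq p htop hpow hH hHf, hle]
  constructor
  · rintro ⟨A, hA, h⟩
    exact exists_form_notMem_pointIdeal hA (isHomogeneous_span_pair hH hf.homogeneous) hG h
  · rintro ⟨e, A, hA, hA0, h⟩
    exact ⟨A, by rwa [ChordConstruction.mem_pointIdeal hA], h⟩

theorem IsSmoothCubic.ord_eq_zero_iff {f : CoordRing k} (hf : IsSmoothCubic f) (p : zeroLocus f)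
    {G : CoordRing k} {d : ℕ} (hG : G.IsHomogeneous d) (hGf : G ∉ Ideal.span {f}) :
    ord f p.1 G = 0 ↔ eval p.1.rep G ≠ 0 := by
  obtain ⟨v, hmul, htop, hpow, -⟩ := hf.exists_valuation p
  have h1 := hpow 1 G
  rw [← hf.ord_eq p htop hpow hG hGf, Nat.cast_le] at h1
  rw [← not_iff_not, not_not, ← ne_eq, ← Nat.one_le_iff_ne_zero, h1,
    ← ChordConstruction.mem_pointIdeal hG, pow_one,
    sup_eq_left.2 ((Ideal.span_singleton_le_iff_mem _).2 (hf.mem_pointIdeal p))]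
  exact ⟨fun ⟨A, hA, h⟩ => ((inferInstance : (pointIdeal p.1).IsPrime).mem_or_mem h).resolve_left hA,
    fun h => ⟨1, (Ideal.ne_top_iff_one _).1 (Ideal.IsPrime.ne_top inferInstance), by simpa⟩⟩

theorem IsSmoothCubic.ord_lin {f : CoordRing k} (hf : IsSmoothCubic f) (p : zeroLocus f)
    {w : Fin 3 → k} (hw : w ⬝ᵥ p.1.rep = 0) (hT : ∀ c : k, w ≠ c • grad f p.1.rep) :
    ord f p.1 (lin w) = 1 := by
  obtain ⟨v, hmul, htop, hpow, -, hlin⟩ := hf.exists_valuation p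
  have hw0 : w ≠ 0 := fun h => hT 0 (by rw [h, zero_smul])
  rw [← Nat.cast_inj (R := ℕ∞), hf.ord_eq p htop hpow (isHomogeneous_lin w)
    (notMem_span_of_degree_lt hf.homogeneous (isHomogeneous_lin w) (by norm_num) (lin_ne_zero hw0)),
    hlin w hw hT, Nat.cast_one]

/-- A form that does not vanish identically on a smooth cubic has finitely many zeros on it. -/
theorem IsSmoothCubic.finite_zeros {f : CoordRing k} (hf : IsSmoothCubic f)
    {G : CoordRing k} {d : ℕ} (hG : G.IsHomogeneous d) (hGf : G ∉ Ideal.span {f}) :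
    {p : zeroLocus f | eval p.1.rep G = 0}.Finite := by
  have := hf.isPrime
  obtain ⟨π, hπ⟩ : ∃ π, π = Ideal.Quotient.mk (Ideal.span {f}) := ⟨_, rfl⟩
  have hsurj : Function.Surjective π := hπ ▸ Ideal.Quotient.mk_surjective
  have hker : RingHom.ker π = Ideal.span {f} := hπ ▸ Ideal.mk_ker
  have hzero : ∀ G, π G = 0 ↔ G ∈ Ideal.span {f} := by
    intro G; rw [← RingHom.mem_ker, hker]
  have hmap : ∀ (I : Ideal (CoordRing k)) G, π G ∈ I.map π ↔ G ∈ I ⊔ Ideal.span {f} := by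
    intro I G; rw [hπ, mk_mem_map_iff]
  have hfin := Ideal.finite_minimalPrimes_of_isNoetherianRing _ (Ideal.span {π G})
  have hfp : ∀ p : zeroLocus f, Ideal.span {f} ≤ pointIdeal p.1 := fun p =>
    (Ideal.span_singleton_le_iff_mem _).2 (hf.mem_pointIdeal p)
  have hmem : ∀ (p : zeroLocus f) G, π G ∈ (pointIdeal p.1).map π ↔ G ∈ pointIdeal p.1 := by
    intro p G
    rw [hmap, sup_eq_left.2 (hfp p)]
  have hinj : Function.Injective fun p : zeroLocus f => (pointIdeal p.1).map π := by
    intro p q h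
    refine Subtype.ext (pointIdeal_injective (Ideal.ext fun x => ?_))
    rw [← hmem p, ← hmem q]
    exact iff_of_eq (congrArg (π x ∈ ·) h)
  refine (hfin.preimage hinj.injOn).subset fun p hp => ?_
  have hprime : ((pointIdeal p.1).map π).IsPrime :=
    Ideal.map_isPrime_of_surjective hsurj (by rw [hker]; exact hfp p)
  obtain ⟨w, hw, hT⟩ := exists_transversal p
  obtain ⟨B, hB, hgen⟩ := hf.exists_local_generator p hw hT
  have hw0 : w ≠ 0 := fun h => hT 0 (by rw [h, zero_smul])
  have hGp : π G ∈ (pointIdeal p.1).map π := by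
    rw [hmem, ChordConstruction.mem_pointIdeal hG]; exact hp
  -- Each zero gives a minimal prime over `G` modulo `f`, of which a Noetherian ring has finitely
  -- many. Minimality is the height-one property.
  refine ⟨⟨hprime, (Ideal.span_singleton_le_iff_mem _).2 hGp⟩, ?_⟩
  rintro Q ⟨hQ, hGQ⟩ hQP
  refine (eq_of_le_of_mem_of_ne_zero (s := π B) (t := π (lin w)) (by rwa [hmem])
    (by rwa [hmem, lin_mem_pointIdeal]) ?_ ?_ hQP ((Ideal.span_singleton_le_iff_mem _).1 hGQ) ?_).ge
  · rw [Ne, hzero]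
    exact notMem_span_of_degree_lt hf.homogeneous (isHomogeneous_lin w) (by norm_num)
        (lin_ne_zero hw0)
  · intro x hx
    obtain ⟨H, rfl⟩ := hsurj x
    have := hgen H ((hmem p H).1 hx)
    rwa [← map_mul, ← Set.image_singleton, ← Ideal.map_span, hmap, ← Ideal.span_union,
      Set.singleton_union]
  · rwa [Ne, hzero]

end Order

/-! ### Noether's theorem: from divisors to divisibility modulo the cubic. -/

section Noether

/-- Division by `q` is possible as its leading coefficient is a unit. The remainders satisfy `y ·
rem a = x · rem b`, so coprimality makes `x` divide every coefficient of `rem a`. In other words,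
`q, x, y` is a regular sequence. -/
theorem exists_eq_smul_add_mul {A : Type*} [CommRing A] [IsDomain A] [UniqueFactorizationMonoid A]
    {q a b e : Polynomial A} (hq : IsUnit q.leadingCoeff) {x y : A} (hxy : IsRelPrime x y)
    (h : Polynomial.C y * a - Polynomial.C x * b = q * e) :
    ∃ a' e' : Polynomial A, a = Polynomial.C x * a' + q * e' := by
  obtain ⟨u, hu⟩ := hq
  have hmonic : (Polynomial.C (↑u⁻¹ : A) * q).Monic := by
    rw [Polynomial.Monic, Polynomial.leadingCoeff_mul, Polynomial.leadingCoeff_C, ← hu]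
    simp
  set r := Polynomial.C (↑u⁻¹ : A) * q with hr
  have hqr : q = r * Polynomial.C (u : A) := by
    rw [hr, mul_right_comm, ← Polynomial.C_mul]
    simp
  have h1 : y • (a %ₘ r) = x • (b %ₘ r) := by
    rw [← Polynomial.smul_modByMonic, ← Polynomial.smul_modByMonic, ← sub_eq_zero,
      ← Polynomial.sub_modByMonic, Polynomial.modByMonic_eq_zero_iff_dvd hmonic,
      Polynomial.smul_eq_C_mul, Polynomial.smul_eq_C_mul, h, hqr, mul_assoc]
    exact dvd_mul_right _ _
  have h2 : Polynomial.C x ∣ a %ₘ r := by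
    rw [Polynomial.C_dvd_iff_dvd_coeff]
    intro i
    have := congrArg (Polynomial.coeff · i) h1
    simp only [Polynomial.coeff_smul, smul_eq_mul] at this
    exact hxy.dvd_of_dvd_mul_left ⟨_, this⟩
  obtain ⟨a', ha'⟩ := h2
  refine ⟨a', Polynomial.C (↑u⁻¹ : A) * (a /ₘ r), ?_⟩
  rw [← ha']
  conv_lhs => rw [← Polynomial.modByMonic_add_div a r]
  rw [hr]
  ring

variable {k : Type*} [Field k]

/-- The shear `X₀ ↦ X₀`, `Xᵢ ↦ Xᵢ + cᵢ X₀`. -/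
noncomputable def shear (c : Fin 3 → k) : CoordRing k →ₐ[k] CoordRing k :=
  aeval ![X 0, X 1 + C (c 1) * X 0, X 2 + C (c 2) * X 0]

theorem shear_comp_neg (c : Fin 3 → k) : (shear c).comp (shear (-c)) = AlgHom.id k _ := by
  refine MvPolynomial.algHom_ext fun i => ?_
  fin_cases i <;> simp [shear, algebraMap_eq]

/-- The shear as an automorphism of the polynomial ring. -/
noncomputable def shearEquiv (c : Fin 3 → k) : CoordRing k ≃ₐ[k] CoordRing k :=
  AlgEquiv.ofAlgHom (shear c) (shear (-c)) (shear_comp_neg c)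
    (by simpa using shear_comp_neg (-c))

theorem isRelPrime_X_pow (N : ℕ) :
    IsRelPrime ((X 0 : MvPolynomial (Fin 2) k) ^ N) ((X 1 : MvPolynomial (Fin 2) k) ^ N) := by
  refine IsRelPrime.pow ?_
  have h : Prime (X 0 : MvPolynomial (Fin 2) k) := X_prime
  rw [h.irreducible.isRelPrime_iff_not_dvd, X_dvd_X]
  simp

/-- The coefficient of `X₀³` is a constant, namely the value of `f` at `(1, 0, 0)`. -/
theorem isUnit_leadingCoeff_finSuccEquiv {f : CoordRing k} (hf : f.IsHomogeneous 3)
    (h : eval ![1, 0, 0] f ≠ 0) : IsUnit (finSuccEquiv k 2 f).leadingCoeff := by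
  have hf0 : f ≠ 0 := by rintro rfl; simp at h
  have hdeg : (finSuccEquiv k 2 f).natDegree ≤ 3 := by
    rw [natDegree_finSuccEquiv]
    exact (degreeOf_le_totalDegree f 0).trans hf.totalDegree_le
  have hc : ∀ i j, i + j = 3 → ((finSuccEquiv k 2 f).coeff i).IsHomogeneous j :=
    fun i j hij => IsHomogeneous.finSuccEquiv_coeff_isHomogeneous hf i j hij
  have hev : ∀ i, i < 3 → eval 0 ((finSuccEquiv k 2 f).coeff i) = 0 := by
    intro i hi
    have := (hc i (3 - i) (by omega)).eval_smul (0 : k) 0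
    rw [zero_smul, zero_pow (by omega), zero_mul] at this
    exact this
  have key : eval 0 ((finSuccEquiv k 2 f).coeff 3) = eval ![1, 0, 0] f := by
    have h1 : (![1, 0, 0] : Fin 3 → k) = Fin.cons 1 (0 : Fin 2 → k) := by
      funext i; fin_cases i <;> rfl
    rw [h1, eval_eq_eval_mv_eval', Polynomial.eval_map,
      Polynomial.eval₂_eq_sum_range' _ (n := 4) (by omega)]
    simp only [Finset.sum_range_succ, Finset.sum_range_zero, zero_add, one_pow, mul_one,
      hev 0 (by norm_num), hev 1 (by norm_num), hev 2 (by norm_num)]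
  have h3 := (totalDegree_zero_iff_isHomogeneous _).2 (hc 3 0 rfl)
  rw [totalDegree_eq_zero_iff_eq_C] at h3
  have hcoeff : coeff 0 ((finSuccEquiv k 2 f).coeff 3) ≠ 0 := by
    intro h0
    rw [h0] at h3
    rw [h3] at key
    simp at key
    exact h key.symm
  have hnat : (finSuccEquiv k 2 f).natDegree = 3 := by
    refine le_antisymm hdeg (Polynomial.le_natDegree_of_ne_zero fun h0 => hcoeff ?_)
    rw [h0]; simp
  rw [Polynomial.leadingCoeff, hnat, h3]
  exact (isUnit_iff_ne_zero.2 hcoeff).map C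

/-- Two linear forms, a nonzero cubic form and the powers of the linear forms are regular
sequences if the three forms have no common zero. -/
theorem exists_regular_pair [Infinite k] {f : CoordRing k} (hf : f.IsHomogeneous 3) (h0 : f ≠ 0) :
    ∃ w₁ w₂ : Fin 3 → k, w₁ ≠ 0 ∧ ∀ (N : ℕ) (a b : CoordRing k),
      lin w₂ ^ N * a - lin w₁ ^ N * b ∈ Ideal.span {f} →
        ∃ a', a - lin w₁ ^ N * a' ∈ Ideal.span {f} := by
  -- The factor `X 0` makes the direction normalizable to first coordinate one; the shear then moves
  -- it to `(1, 0, 0)`, off the curve.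
  obtain ⟨v, hv⟩ : ∃ v, eval v (X 0 * f) ≠ 0 := by
    by_contra! hc
    exact mul_ne_zero (X_ne_zero 0) h0 (MvPolynomial.funext fun v => by rw [hc, map_zero])
  rw [map_mul, eval_X, mul_ne_zero_iff] at hv
  set c : Fin 3 → k := (v 0)⁻¹ • v with hc
  have hfc : eval ![1, c 1, c 2] f ≠ 0 := by
    have : (![1, c 1, c 2] : Fin 3 → k) = (v 0)⁻¹ • v := by
      funext i; fin_cases i <;> simp [hc, hv.1]
    rw [this, hf.eval_smul]
    exact mul_ne_zero (pow_ne_zero _ (inv_ne_zero hv.1)) hv.2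
  obtain ⟨Φ, hΦ⟩ : ∃ Φ : CoordRing k ≃ₐ[k] Polynomial (MvPolynomial (Fin 2) k),
      ∀ x, Φ x = finSuccEquiv k 2 (shear c x) :=
    ⟨(shearEquiv c).trans (finSuccEquiv k 2), fun _ => rfl⟩
  have hunit : IsUnit (Φ f).leadingCoeff := by
    rw [hΦ]
    refine isUnit_leadingCoeff_finSuccEquiv (f := shear c f) ?_ ?_
    · have := hf.aeval (![X 0, X 1 + C (c 1) * X 0, X 2 + C (c 2) * X 0] : Fin 3 → CoordRing k) (n := 1) (by
        intro i
        fin_cases i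
        · exact isHomogeneous_X _ _
        · exact (isHomogeneous_X _ _).add (isHomogeneous_C_mul_X _ _)
        · exact (isHomogeneous_X _ _).add (isHomogeneous_C_mul_X _ _))
      rwa [one_mul] at this
    · rw [shear, eval_aeval]
      convert hfc using 3
      funext i; fin_cases i <;> simp
  refine ⟨![-c 1, 1, 0], ![-c 2, 0, 1], fun h => by simpa using congrFun h 1, fun N a b h => ?_⟩
  have e1 : Φ (lin ![-c 1, 1, 0]) = Polynomial.C (X 0) := by
    have : (shear c) (lin ![-c 1, 1, 0]) = X (Fin.succ 0) := by
      simp [lin, shear, Fin.sum_univ_three, algebraMap_eq]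
    rw [hΦ, this, finSuccEquiv_X_succ]
  have e2 : Φ (lin ![-c 2, 0, 1]) = Polynomial.C (X 1) := by
    have : (shear c) (lin ![-c 2, 0, 1]) = X (Fin.succ 1) := by
      simp [lin, shear, Fin.sum_univ_three, algebraMap_eq]
    rw [hΦ, this, finSuccEquiv_X_succ]
  obtain ⟨e, he⟩ := Ideal.mem_span_singleton.1 h
  have h' := congrArg Φ he
  rw [map_sub, map_mul, map_mul, map_mul, map_pow, map_pow, e1, e2, ← Polynomial.C_pow,
    ← Polynomial.C_pow] at h'
  obtain ⟨a', e', ha'⟩ := exists_eq_smul_add_mul hunit (isRelPrime_X_pow N) h'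
  refine ⟨Φ.symm a', Ideal.mem_span_singleton.2 ⟨Φ.symm e', Φ.injective ?_⟩⟩
  rw [map_sub, map_mul, map_mul, map_pow, e1, AlgEquiv.apply_symm_apply,
    AlgEquiv.apply_symm_apply, ← Polynomial.C_pow]
  rw [ha']
  ring

attribute [local instance] MvPolynomial.gradedAlgebra

variable [IsAlgClosed k]

/-- Noether's theorem for a smooth cubic: a form whose divisor contains that of another form is a
multiple of it on the curve. -/
theorem IsSmoothCubic.exists_mul_of_ord_le {f : CoordRing k} (hf : IsSmoothCubic f)
    {G H : CoordRing k} {d e : ℕ} (hG : G.IsHomogeneous (e + d)) (hGf : G ∉ Ideal.span {f})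
    (hH : H.IsHomogeneous d) (hHf : H ∉ Ideal.span {f})
    (h : ∀ p : zeroLocus f, ord f p.1 H ≤ ord f p.1 G) :
    ∃ M : CoordRing k, M.IsHomogeneous e ∧ G - M * H ∈ Ideal.span {f} := by
  have hprime := hf.isPrime
  -- The hypothesis on orders says that `G` lies in `(H, f)` locally at each point of the curve.
  -- Hence `J` has no zero but the origin, and the Nullstellensatz puts powers of all linear forms
  -- in `J`.
  let J : Ideal (CoordRing k) := (Ideal.span {H, f}).colon {G}
  have hJ : ∀ A, A ∈ J ↔ A * G ∈ Ideal.span {H, f} := fun A => by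
    simp [J, Submodule.mem_colon_singleton]
  have hzero : ∀ v ∈ MvPolynomial.zeroLocus k J, v = 0 := by
    intro v hv
    by_contra hv0
    have hvf : eval v f = 0 := hv f ((hJ f).2 (Ideal.mul_mem_right _ _
      (Ideal.subset_span (by simp))))
    obtain ⟨u, hu⟩ := Projectivization.exists_smul_eq_mk_rep k v hv0
    have hp : Projectivization.mk k v hv0 ∈ zeroLocus f := by
      rw [zeroLocus, Set.mem_ofPred_eq, ← hu, Units.smul_def, hf.homogeneous.eval_smul, hvf, mul_zero]
    obtain ⟨e, A, hA, hA0, hAG⟩ := (hf.ord_le_iff ⟨_, hp⟩ hG hGf hH hHf).1 (h ⟨_, hp⟩)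
    have := hv A ((hJ A).2 hAG)
    refine hA0 ?_
    change eval v A = 0 at this
    change eval (Projectivization.mk k v hv0).rep A = 0
    rw [← hu, Units.smul_def, hA.eval_smul, this, mul_zero]
  have hrad : ∀ w : Fin 3 → k, ∃ N, lin w ^ N ∈ J := by
    intro w
    rw [← Ideal.mem_radical_iff, ← vanishingIdeal_zeroLocus_eq_radical (K := k), mem_vanishingIdeal_iff]
    intro v hv
    rw [hzero v hv]
    change eval 0 (lin w) = 0
    rw [eval_lin, dotProduct_zero]
  obtain ⟨w₁, w₂, hw₁, hreg⟩ := exists_regular_pair hf.homogeneous hf.ne_zero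
  obtain ⟨N₁, hN₁⟩ := hrad w₁
  obtain ⟨N₂, hN₂⟩ := hrad w₂
  have h1 : lin w₁ ^ (N₁ + N₂) ∈ J := by rw [pow_add]; exact Ideal.mul_mem_right _ _ hN₁
  have h2 : lin w₂ ^ (N₁ + N₂) ∈ J := by rw [pow_add]; exact Ideal.mul_mem_left _ _ hN₂
  rw [hJ] at h1 h2
  obtain ⟨a, a₂, ha⟩ := Ideal.mem_span_pair.1 h1
  obtain ⟨b, b₂, hb⟩ := Ideal.mem_span_pair.1 h2
  set N := N₁ + N₂
  have h3 : (lin w₂ ^ N * a - lin w₁ ^ N * b) * H ∈ Ideal.span {f} := by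
    refine Ideal.mem_span_singleton.2 ⟨lin w₁ ^ N * b₂ - lin w₂ ^ N * a₂, ?_⟩
    linear_combination lin w₂ ^ N * ha - lin w₁ ^ N * hb
  -- Modulo `f`, `lin w₁ ^ N * G = a * H` and `lin w₂ ^ N * G = b * H`. Eliminating `G` and
  -- cancelling `H` gives the relation to which the regular sequence applies; then `lin w₁ ^ N`
  -- cancels from the first equation.
  obtain ⟨a', ha'⟩ := hreg N a b ((hprime.mem_or_mem h3).resolve_right hHf)
  have h4 : lin w₁ ^ N * (G - a' * H) ∈ Ideal.span {f} := by
    obtain ⟨c, hc⟩ := Ideal.mem_span_singleton.1 ha'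
    refine Ideal.mem_span_singleton.2 ⟨a₂ + c * H, ?_⟩
    linear_combination H * hc - ha
  have h5 : lin w₁ ∉ Ideal.span {f} :=
    notMem_span_of_degree_lt hf.homogeneous (isHomogeneous_lin w₁) (by norm_num) (lin_ne_zero hw₁)
  have h6 := (hprime.mem_or_mem h4).resolve_left fun h => h5 (hprime.mem_of_pow_mem _ h)
  refine ⟨homogeneousComponent e a', homogeneousComponent_isHomogeneous _ _, ?_⟩
  have h7 := homogeneousComponent_mem_of_mem (isHomogeneous_span_singleton hf.homogeneous) h6 (e + d)
  rwa [map_sub, homogeneousComponent_eq_self hG, homogeneousComponent_mul_form a' hH] at h7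

end Noether

/-! ### Homogeneous coordinates and cross products. -/

section Represents

variable {k : Type*} [Field k]

/-- The vector `v` is a vector of homogeneous coordinates of the point `p`. -/
def Represents (v : Fin 3 → k) (p : Plane k) : Prop := ∃ a : k, a ≠ 0 ∧ v = a • p.rep

theorem represents_rep (p : Plane k) : Represents p.rep p := ⟨1, one_ne_zero, (one_smul _ _).symm⟩

theorem Represents.ne_zero {v : Fin 3 → k} {p : Plane k} (h : Represents v p) : v ≠ 0 := by
  obtain ⟨a, ha, rfl⟩ := h
  exact smul_ne_zero ha p.rep_nonzero

theorem exists_represents {v : Fin 3 → k} (hv : v ≠ 0) : ∃ p : Plane k, Represents v p := by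
  obtain ⟨u, hu⟩ := Projectivization.exists_smul_eq_mk_rep k v hv
  exact ⟨_, ↑u⁻¹, u⁻¹.ne_zero, by rw [← hu, Units.smul_def, smul_smul, Units.inv_mul, one_smul]⟩

theorem Represents.eval_eq_zero_iff {v : Fin 3 → k} {p : Plane k} (h : Represents v p)
    {G : CoordRing k} {d : ℕ} (hG : G.IsHomogeneous d) : eval v G = 0 ↔ eval p.rep G = 0 := by
  obtain ⟨a, ha, rfl⟩ := h
  rw [hG.eval_smul, mul_eq_zero, or_iff_right (pow_ne_zero _ ha)]

theorem Represents.dotProduct_eq_zero_iff {v w : Fin 3 → k} {p : Plane k} (h : Represents v p) :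
    w ⬝ᵥ v = 0 ↔ w ⬝ᵥ p.rep = 0 := by
  obtain ⟨a, ha, rfl⟩ := h
  rw [dotProduct_smul, smul_eq_mul, mul_eq_zero, or_iff_right ha]

theorem Represents.smul {v : Fin 3 → k} {p : Plane k} (h : Represents v p) {c : k} (hc : c ≠ 0) :
    Represents (c • v) p := by
  obtain ⟨a, ha, rfl⟩ := h
  exact ⟨c * a, mul_ne_zero hc ha, by rw [smul_smul]⟩

theorem Represents.eq_iff {v w : Fin 3 → k} {p q : Plane k} (hv : Represents v p)
    (hw : Represents w q) : p = q ↔ ∃ c : k, v = c • w := by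
  obtain ⟨a, ha, rfl⟩ := hv
  obtain ⟨b, hb, rfl⟩ := hw
  constructor
  · rintro rfl
    exact ⟨a * b⁻¹, by rw [smul_smul, inv_mul_cancel_right₀ hb]⟩
  · rintro ⟨c, hc⟩
    rw [← p.mk_rep, ← q.mk_rep, Projectivization.mk_eq_mk_iff']
    exact ⟨a⁻¹ * (c * b), by
      rw [smul_smul] at hc
      rw [mul_smul, ← hc, smul_smul, inv_mul_cancel₀ ha, one_smul]⟩

theorem cross_eq_zero_iff {v w : Fin 3 → k} (hw : w ≠ 0) :
    crossProduct v w = 0 ↔ ∃ c : k, v = c • w := by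
  constructor
  · intro h
    by_cases hv : v = 0
    · exact ⟨0, by rw [hv, zero_smul]⟩
    · rw [← Projectivization.mk_eq_mk_iff_crossProduct_eq_zero hv hw,
        Projectivization.mk_eq_mk_iff'] at h
      obtain ⟨c, hc⟩ := h
      exact ⟨c, hc.symm⟩
  · rintro ⟨c, rfl⟩
    rw [map_smul, LinearMap.smul_apply, cross_self, smul_zero]

theorem exists_dual_pair {P W : Fin 3 → k} (h : crossProduct P W ≠ 0) :
    ∃ φ ψ : Fin 3 → k, φ ⬝ᵥ P = 1 ∧ φ ⬝ᵥ W = 0 ∧ ψ ⬝ᵥ P = 0 ∧ ψ ⬝ᵥ W = 1 := by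
  obtain ⟨j, hj⟩ := Function.ne_iff.1 h
  simp only [Pi.zero_apply] at hj
  set d := crossProduct P W j with hd
  set u : Fin 3 → k := Pi.single j 1 with hu
  have h1 : u ⬝ᵥ crossProduct P W = d := by simp [hu, hd]
  refine ⟨d⁻¹ • crossProduct W u, d⁻¹ • crossProduct u P, ?_, ?_, ?_, ?_⟩
  · rw [smul_dotProduct, dotProduct_comm, triple_product_permutation, triple_product_permutation, h1,
      smul_eq_mul, inv_mul_cancel₀ hj]
  · rw [smul_dotProduct, dotProduct_comm, dot_self_cross, smul_zero]
  · rw [smul_dotProduct, dotProduct_comm, dot_cross_self, smul_zero]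
  · rw [smul_dotProduct, dotProduct_comm, triple_product_permutation, h1,
      smul_eq_mul, inv_mul_cancel₀ hj]

theorem exists_combination_of_cross {P W x : Fin 3 → k} (h : crossProduct P W ≠ 0)
    (hx : crossProduct P W ⬝ᵥ x = 0) : ∃ α γ : k, x = α • P + γ • W := by
  have hW : W ≠ 0 := by rintro rfl; simp at h
  refine exists_eq_combination h (dot_self_cross P W) (dot_cross_self P W)
    (by rwa [dotProduct_comm]) hW fun c hc => h ?_
  rw [cross_eq_zero_iff hW]
  exact ⟨c, hc⟩

end Represents

/-! ### Principal divisors and the divisors of line sections. -/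

section Picard

variable {k : Type*} [Field k]

theorem ord_congr {f : CoordRing k} (p : Plane k) {G H : CoordRing k} (h : G - H ∈ Ideal.span {f}) :
    ord f p G = ord f p H := by
  unfold ord
  congr 1
  ext n
  have : ∀ A : CoordRing k, A * G ∈ pointIdeal p ^ n ⊔ Ideal.span {f} ↔
      A * H ∈ pointIdeal p ^ n ⊔ Ideal.span {f} := by
    intro A
    rw [← sub_add_cancel (A * G) (A * H), Ideal.add_mem_iff_right]
    rw [← mul_sub]
    exact Ideal.mul_mem_left _ _ (Ideal.mem_sup_right h)
  simp only [Set.mem_ofPred_eq, this]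

variable {f : CoordRing k}

theorem IsSmoothCubic.lin_notMem (hf : IsSmoothCubic f) {w : Fin 3 → k} (hw : w ≠ 0) :
    lin w ∉ Ideal.span {f} :=
  notMem_span_of_degree_lt hf.homogeneous (isHomogeneous_lin w) (by norm_num) (lin_ne_zero hw)

open Classical in
/-- The divisor of a line section of the curve is `p + q + r`. -/
def IsLineSection (p q r : zeroLocus f) (w : Fin 3 → k) : Prop :=
  w ≠ 0 ∧ ∀ x : zeroLocus f, ord f x.1 (lin w) =
    (if x = p then 1 else 0) + (if x = q then 1 else 0) + if x = r then 1 else 0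

theorem IsSmoothCubic.line_section_class (hf : IsSmoothCubic f) {p q r p' q' r' : zeroLocus f}
    {w w' : Fin 3 → k} (h : IsLineSection p q r w) (h' : IsLineSection p' q' r' w') :
    pointClass p + pointClass q + pointClass r = pointClass p' + pointClass q' + pointClass r' := by
  simp only [pointClass, ← QuotientAddGroup.mk_add]
  rw [eq_comm, QuotientAddGroup.eq]
  classical
  refine AddSubgroup.subset_closure ⟨1, lin w, lin w', isHomogeneous_lin _, isHomogeneous_lin _,
    hf.lin_notMem h.1, hf.lin_notMem h'.1, fun x => ?_⟩
  rw [h.2, h'.2]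
  simp only [Finsupp.add_apply, Finsupp.neg_apply, Finsupp.single_apply, @eq_comm _ x]
  push_cast
  ring

variable [IsAlgClosed k]

theorem IsSmoothCubic.ord_C_mul (hf : IsSmoothCubic f) (p : zeroLocus f) {c : k} (hc : c ≠ 0)
    {G : CoordRing k} {d : ℕ} (hG : G.IsHomogeneous d) (hGf : G ∉ Ideal.span {f}) :
    ord f p.1 (C c * G) = ord f p.1 G := by
  have h1 : (C c : CoordRing k) ∉ Ideal.span {f} :=
    notMem_span_of_degree_lt hf.homogeneous (isHomogeneous_C _ c) (by norm_num) (by simpa using hc)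
  rw [hf.ord_mul p (isHomogeneous_C _ c) h1 hG hGf,
    (hf.ord_eq_zero_iff p (isHomogeneous_C _ c) h1).2 (by simpa using hc), zero_add]

theorem IsSmoothCubic.isPrincipal_of_mem (hf : IsSmoothCubic f) {D : Divisor f}
    (hD : D ∈ principalDivisors f) : IsPrincipal f D := by
  have h1 : (1 : CoordRing k) ∉ Ideal.span {f} :=
    notMem_span_of_degree_lt hf.homogeneous (isHomogeneous_one _ _) (by norm_num) one_ne_zero
  induction hD using AddSubgroup.closure_induction with
  | mem x hx => exact hx
  | zero =>
    exact ⟨0, 1, 1, isHomogeneous_one _ _, isHomogeneous_one _ _, h1, h1, fun p => by simp⟩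
  | add x y _ _ hx hy =>
    obtain ⟨d, G, H, hG, hH, hGf, hHf, h⟩ := hx
    obtain ⟨d', G', H', hG', hH', hGf', hHf', h'⟩ := hy
    refine ⟨d + d', G * G', H * H', hG.mul hG', hH.mul hH',
      fun h => (hf.isPrime.mem_or_mem h).elim hGf hGf',
      fun h => (hf.isPrime.mem_or_mem h).elim hHf hHf', fun p => ?_⟩
    rw [hf.ord_mul p hG hGf hG' hGf', hf.ord_mul p hH hHf hH' hHf', Finsupp.add_apply, h, h']
    push_cast
    ring
  | neg x _ hx =>
    obtain ⟨d, G, H, hG, hH, hGf, hHf, h⟩ := hx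
    exact ⟨d, H, G, hH, hG, hHf, hGf, fun p => by rw [Finsupp.neg_apply, h, neg_sub]⟩

/-- Noether's theorem in degree `0` makes the numerator a constant times the denominator modulo `f`.
This replaces any use of the degree of a divisor. -/
theorem IsSmoothCubic.eq_zero_of_effective (hf : IsSmoothCubic f) {D : Divisor f}
    (hD : D ∈ principalDivisors f) (h0 : ∀ p, 0 ≤ D p) : D = 0 := by
  obtain ⟨d, G, H, hG, hH, hGf, hHf, h⟩ := hf.isPrincipal_of_mem hD
  obtain ⟨M, hM, hMH⟩ := hf.exists_mul_of_ord_le (e := 0) (by rwa [zero_add]) hGf hH hHf fun p => by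
    have h1 := h p
    have h2 := h0 p
    omega
  have := (totalDegree_zero_iff_isHomogeneous _).2 hM
  rw [totalDegree_eq_zero_iff_eq_C] at this
  rw [this] at hMH
  have hc : coeff 0 M ≠ 0 := by
    intro hc
    rw [hc] at hMH
    simp at hMH
    exact hGf hMH
  ext p
  rw [h, ord_congr p.1 hMH, hf.ord_C_mul p hc hH hHf, sub_self, Finsupp.zero_apply]

theorem IsLineSection.dotProduct_eq_zero (hf : IsSmoothCubic f) {p q r : zeroLocus f} {w : Fin 3 → k}
    (h : IsLineSection p q r w) :
    w ⬝ᵥ p.1.rep = 0 ∧ w ⬝ᵥ q.1.rep = 0 ∧ w ⬝ᵥ r.1.rep = 0 := by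
  have key : ∀ x : zeroLocus f, ord f x.1 (lin w) ≠ 0 → w ⬝ᵥ x.1.rep = 0 := by
    intro x hx
    rw [Ne, hf.ord_eq_zero_iff x (isHomogeneous_lin w) (hf.lin_notMem h.1), not_not, eval_lin] at hx
    exact hx
  refine ⟨key _ ?_, key _ ?_, key _ ?_⟩ <;> rw [h.2] <;> simp

theorem IsSmoothCubic.exists_eq_lin_mul_add (hf : IsSmoothCubic f) {w : Fin 3 → k} (hw : w ≠ 0)
    {g : CoordRing k} (hg : g.IsHomogeneous 3) (h : ∀ v, w ⬝ᵥ v = 0 → eval v f = eval v g) :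
    ∃ q : CoordRing k, q.IsHomogeneous 2 ∧ f = lin w * q + g := by
  obtain ⟨q, hq⟩ := lin_dvd_of_forall hw (G := f - g) fun v hv => by rw [map_sub, h v hv, sub_self]
  refine ⟨homogeneousComponent 2 q, homogeneousComponent_isHomogeneous _ _, ?_⟩
  have := homogeneousComponent_mul_form q (isHomogeneous_lin w) (e := 2)
  rw [mul_comm q, ← hq, homogeneousComponent_eq_self (hf.homogeneous.sub hg)] at this
  rw [mul_comm, ← this, sub_add_cancel]

theorem IsSmoothCubic.exists_eval_ne_zero (hf : IsSmoothCubic f) {w : Fin 3 → k} (hw : w ≠ 0) :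
    ∃ v, w ⬝ᵥ v = 0 ∧ eval v f ≠ 0 := by
  by_contra! hc
  obtain ⟨q, hq, h⟩ := hf.exists_eq_lin_mul_add hw (isHomogeneous_zero _ _ 3) (by simpa using hc)
  exact hf.not_lin_dvd w q hq (by rw [h, add_zero])

open Classical in
-- Extending the three factors on the line to linear forms `L i` gives `f = lin w * q + c L₀ L₁ L₂`,
-- with every `L i` transversal to the line `w`. Multiplicities along `w` are then read off from the
-- number of `L i` that vanish.
theorem IsSmoothCubic.isLineSection_of_factorization (hf : IsSmoothCubic f) {P W : Fin 3 → k}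
    (hPW : crossProduct P W ≠ 0) {a b : Fin 3 → k} (hab : ∀ i, a i ≠ 0 ∨ b i ≠ 0) {c : k}
    (h : ∀ α γ : k, eval (α • P + γ • W) f =
      c * ((α * b 0 - γ * a 0) * (α * b 1 - γ * a 1) * (α * b 2 - γ * a 2)))
    {p : Fin 3 → zeroLocus f} (hp : ∀ i, Represents (a i • P + b i • W) (p i).1) :
    IsLineSection (p 0) (p 1) (p 2) (crossProduct P W) := by
  obtain ⟨φ, ψ, hφP, hφW, hψP, hψW⟩ := exists_dual_pair hPW
  set w := crossProduct P W with hw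
  have hwP : w ⬝ᵥ P = 0 := by rw [dotProduct_comm]; exact dot_self_cross P W
  have hwW : w ⬝ᵥ W = 0 := by rw [dotProduct_comm]; exact dot_cross_self P W
  obtain ⟨L, hL⟩ : ∃ L : Fin 3 → Fin 3 → k, ∀ i, L i = b i • φ - a i • ψ :=
    ⟨fun i => b i • φ - a i • ψ, fun i => rfl⟩
  have hLP : ∀ i, L i ⬝ᵥ P = b i := fun i => by
    simp [hL, sub_dotProduct, smul_dotProduct, hφP, hψP]
  have hLW : ∀ i, L i ⬝ᵥ W = -a i := fun i => by
    simp [hL, sub_dotProduct, smul_dotProduct, hφW, hψW]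
  have hLe : ∀ i (α γ : k), L i ⬝ᵥ (α • P + γ • W) = α * b i - γ * a i := fun i α γ => by
    simp [dotProduct_add, dotProduct_smul, hLP, hLW]; ring
  have hL0 : ∀ i, L i ≠ 0 := by
    intro i h0
    have h1 := hLP i
    have h2 := hLW i
    rw [h0, zero_dotProduct] at h1 h2
    have := hab i
    simp [← h1, neg_eq_zero.1 h2.symm] at this
  have hLnot : ∀ i (t : k), L i ≠ t • w := by
    intro i t h0
    have h1 := hLP i
    have h2 := hLW i
    rw [h0, smul_dotProduct, hwP, smul_zero] at h1
    rw [h0, smul_dotProduct, hwW, smul_zero] at h2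
    have := hab i
    simp [← h1, neg_eq_zero.1 h2.symm] at this
  have hc : c ≠ 0 := by
    rintro rfl
    obtain ⟨v, hv, hv0⟩ := hf.exists_eval_ne_zero hPW
    obtain ⟨α, γ, rfl⟩ := exists_combination_of_cross hPW hv
    rw [h, zero_mul] at hv0
    exact hv0 rfl
  have hprodL : (C c * (lin (L 0) * lin (L 1) * lin (L 2))).IsHomogeneous 3 :=
    (((isHomogeneous_lin (L 0)).mul (isHomogeneous_lin (L 1))).mul (isHomogeneous_lin (L 2))).C_mul c
  obtain ⟨q, hq, hfq⟩ := hf.exists_eq_lin_mul_add hPW hprodL (by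
    intro v hv
    obtain ⟨α, γ, rfl⟩ := exists_combination_of_cross hPW hv
    rw [h]
    simp [hLe])
  refine ⟨hPW, fun x => ?_⟩
  by_cases hx : w ⬝ᵥ x.1.rep = 0
  swap
  · have hne : ∀ i, x ≠ p i := by
      rintro i rfl
      rw [← (hp i).dotProduct_eq_zero_iff, dotProduct_add, dotProduct_smul, dotProduct_smul, hwP,
        hwW] at hx
      simp at hx
    rw [(hf.ord_eq_zero_iff x (isHomogeneous_lin w) (hf.lin_notMem hPW)).2 (by rwa [eval_lin])]
    simp [hne]
  · obtain ⟨α, γ, hxe⟩ := exists_combination_of_cross hPW hx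
    have hxi : ∀ i, x = p i ↔ L i ⬝ᵥ x.1.rep = 0 := by
      intro i
      constructor
      · rintro rfl
        rw [← (hp i).dotProduct_eq_zero_iff, hLe]
        ring
      · intro h0
        rw [hxe, hLe] at h0
        refine Subtype.ext ((Represents.eq_iff (represents_rep x.1) (hp i)).2 ?_)
        rw [hxe]
        by_cases hbi : b i = 0
        · have hai : a i ≠ 0 := (hab i).resolve_right (by simp [hbi])
          have hγ : γ = 0 := by simpa [hbi, hai] using h0
          exact ⟨α / a i, by simp [hbi, hγ, smul_smul, div_mul_cancel₀ _ hai]⟩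
        · refine ⟨γ / b i, ?_⟩
          rw [smul_add, smul_smul, smul_smul, div_mul_cancel₀ _ hbi]
          congr 2
          field_simp
          linear_combination h0
    simp only [hxi]
    have hxf : eval x.1.rep f = 0 := x.2
    have hgrad0 := hf.grad_ne_zero x.1.rep_nonzero hxf
    have hprod : (L 0 ⬝ᵥ x.1.rep) * (L 1 ⬝ᵥ x.1.rep) * (L 2 ⬝ᵥ x.1.rep) = 0 := by
      rw [hxe, h] at hxf
      rw [hxe, hLe, hLe, hLe]
      exact (mul_eq_zero.1 hxf).resolve_left hc
    have hgrad : grad f x.1.rep = eval x.1.rep q • w +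
        c • (((L 0 ⬝ᵥ x.1.rep) * (L 1 ⬝ᵥ x.1.rep)) • L 2 + (L 2 ⬝ᵥ x.1.rep) •
          ((L 0 ⬝ᵥ x.1.rep) • L 1 + (L 1 ⬝ᵥ x.1.rep) • L 0)) := by
      have := congrArg (grad · x.1.rep) hfq
      simpa only [grad_add, grad_mul, grad_lin, eval_lin, hx, hprod, zero_smul, zero_add,
        add_zero, eval_C, map_mul] using this
    -- If `w` is not tangent at `x`, its order is one, and two vanishing `L i` would make the
    -- gradient a multiple of `w`. If it is tangent, then `q` is a unit at `x`, and the order of `w`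
    -- is the sum of the orders of the `L i`, each zero or one by transversality.
    by_cases hT : ∀ t : k, w ≠ t • grad f x.1.rep
    · rw [hf.ord_lin x hx hT]
      have hnot : grad f x.1.rep ≠ eval x.1.rep q • w := by
        intro h0
        have hq0 : eval x.1.rep q ≠ 0 := fun hq0 => hgrad0 (by rw [h0, hq0, zero_smul])
        exact hT (eval x.1.rep q)⁻¹ (by rw [h0, smul_smul, inv_mul_cancel₀ hq0, one_smul])
      by_cases h0 : L 0 ⬝ᵥ x.1.rep = 0 <;> by_cases h1 : L 1 ⬝ᵥ x.1.rep = 0 <;>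
        by_cases h2 : L 2 ⬝ᵥ x.1.rep = 0 <;> simp [h0, h1, h2] at hgrad hprod ⊢ <;>
        exact hnot hgrad
    · push Not at hT
      obtain ⟨t, ht⟩ := hT
      have ht0 : t ≠ 0 := by rintro rfl; exact hPW (by rw [ht, zero_smul])
      have hgw : grad f x.1.rep = t⁻¹ • w := by
        rw [ht, smul_smul, inv_mul_cancel₀ ht0, one_smul]
      have hordL : ∀ i, ord f x.1 (lin (L i)) = if L i ⬝ᵥ x.1.rep = 0 then 1 else 0 := by
        intro i
        split_ifs with hi
        · refine hf.ord_lin x hi fun s hs => hLnot i (s * t⁻¹) ?_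
          rw [hs, hgw, smul_smul]
        · rw [hf.ord_eq_zero_iff x (isHomogeneous_lin _) (hf.lin_notMem (hL0 i)), eval_lin]
          exact hi
      -- Otherwise the gradient would be a multiple of the `L i` vanishing at `x`, whereas it is a
      -- nonzero multiple of `w`.
      have hq0 : eval x.1.rep q ≠ 0 := by
        intro hq0
        rw [hq0, zero_smul, zero_add, hgw] at hgrad
        have key : ∀ i (s : k), t⁻¹ • w ≠ s • L i := by
          intro i s hs
          have hs0 : s ≠ 0 := by
            rintro rfl
            rw [zero_smul, ← hgw] at hs
            exact hgrad0 hs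
          refine hLnot i (s⁻¹ * t⁻¹) ?_
          rw [mul_smul, hs, smul_smul, inv_mul_cancel₀ hs0, one_smul]
        rcases mul_eq_zero.1 hprod with h01 | h2
        · rcases mul_eq_zero.1 h01 with h0 | h1
          · refine key 0 (c * ((L 2 ⬝ᵥ x.1.rep) * (L 1 ⬝ᵥ x.1.rep))) (hgrad.trans ?_)
            rw [h0, zero_mul, zero_smul, zero_smul, zero_add, zero_add, smul_smul, smul_smul, mul_assoc]
          · refine key 1 (c * ((L 2 ⬝ᵥ x.1.rep) * (L 0 ⬝ᵥ x.1.rep))) (hgrad.trans ?_)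
            rw [h1, mul_zero, zero_smul, zero_smul, zero_add, add_zero, smul_smul, smul_smul, mul_assoc]
        · refine key 2 (c * ((L 0 ⬝ᵥ x.1.rep) * (L 1 ⬝ᵥ x.1.rep))) (hgrad.trans ?_)
          rw [h2, zero_smul, add_zero, smul_smul]
      have hprime := hf.isPrime
      have hqf : q ∉ Ideal.span {f} := by
        rw [Ideal.mem_span_singleton]
        rintro ⟨s, rfl⟩
        rw [map_mul, hxf, zero_mul] at hq0
        exact hq0 rfl
      have h01 : lin (L 0) * lin (L 1) ∉ Ideal.span {f} := fun h0 =>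
        (hprime.mem_or_mem h0).elim (hf.lin_notMem (hL0 0)) (hf.lin_notMem (hL0 1))
      have h012 : lin (L 0) * lin (L 1) * lin (L 2) ∉ Ideal.span {f} := fun h0 =>
        (hprime.mem_or_mem h0).elim h01 (hf.lin_notMem (hL0 2))
      have e1 := hf.ord_mul x (isHomogeneous_lin w) (hf.lin_notMem hPW) hq hqf
      rw [(hf.ord_eq_zero_iff x hq hqf).2 hq0, add_zero] at e1
      rw [← e1, ord_congr (H := C (-c) * (lin (L 0) * lin (L 1) * lin (L 2))) x.1
        (Ideal.mem_span_singleton.2 ⟨1, by rw [C_neg]; linear_combination -hfq⟩),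
        hf.ord_C_mul x (neg_ne_zero.2 hc) (((isHomogeneous_lin (L 0)).mul
          (isHomogeneous_lin (L 1))).mul (isHomogeneous_lin (L 2))) h012,
        hf.ord_mul x ((isHomogeneous_lin (L 0)).mul (isHomogeneous_lin (L 1))) h01
          (isHomogeneous_lin (L 2)) (hf.lin_notMem (hL0 2)),
        hf.ord_mul x (isHomogeneous_lin (L 0)) (hf.lin_notMem (hL0 0))
          (isHomogeneous_lin (L 1)) (hf.lin_notMem (hL0 1)), hordL, hordL, hordL]

end Picard

/-! ### Chords, tangents and the points representing divisor classes. -/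

section GroupLaw

variable {k : Type*} [Field k] {f : CoordRing k}

theorem exists_point {v : Fin 3 → k} (hf : f.IsHomogeneous 3) (hv : v ≠ 0) (h : eval v f = 0) :
    ∃ p : zeroLocus f, Represents v p.1 := by
  obtain ⟨p, hp⟩ := exists_represents hv
  exact ⟨⟨p, (hp.eval_eq_zero_iff hf).1 h⟩, hp⟩

theorem cross_ne_zero_of_ne {P Q : Fin 3 → k} {p q : Plane k} (hP : Represents P p)
    (hQ : Represents Q q) (hpq : p ≠ q) : crossProduct P Q ≠ 0 := by
  rwa [Ne, cross_eq_zero_iff hQ.ne_zero, ← hP.eq_iff hQ]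

theorem combination_ne_zero {P W : Fin 3 → k} (h : crossProduct P W ≠ 0) {α γ : k}
    (hne : α ≠ 0 ∨ γ ≠ 0) : α • P + γ • W ≠ 0 := by
  obtain ⟨φ, ψ, hφP, hφW, hψP, hψW⟩ := exists_dual_pair h
  intro h0
  have h1 := congrArg (φ ⬝ᵥ ·) h0
  have h2 := congrArg (ψ ⬝ᵥ ·) h0
  simp [dotProduct_add, dotProduct_smul, hφP, hφW] at h1
  simp [dotProduct_add, dotProduct_smul, hψP, hψW] at h2
  simp [h1, h2] at hne

theorem exists_tangent_vector {P : Fin 3 → k} (hP : P ≠ 0) (g : Fin 3 → k) :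
    ∃ W, crossProduct P W ≠ 0 ∧ g ⬝ᵥ W = 0 := by
  obtain ⟨a, b, ha, hb, hab⟩ := exists_orthogonal_pair g
  by_cases h : crossProduct P a = 0
  · refine ⟨b, fun h' => ?_, hb⟩
    rw [← neg_eq_zero, cross_anticomm, cross_eq_zero_iff hP] at h h'
    obtain ⟨x, hx⟩ := h
    obtain ⟨y, hy⟩ := h'
    have h1 := hab y (-x) (by rw [hx, hy, smul_smul, smul_smul, ← add_smul]; ring_nf; simp)
    have := hab 1 0 (by rw [hx, neg_eq_zero.1 h1.2]; simp)
    simp at this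
  · exact ⟨a, h, ha⟩

theorem eq_smul_cross {P Q x : Fin 3 → k} (h : crossProduct P Q ≠ 0) (hP : x ⬝ᵥ P = 0)
    (hQ : x ⬝ᵥ Q = 0) : ∃ c : k, x = c • crossProduct P Q := by
  rw [← cross_eq_zero_iff h, cross_cross_eq_smul_sub_smul', hQ, dotProduct_comm P, hP]
  simp

theorem eq_smul_of_orthogonal {P Q m w : Fin 3 → k} (h : crossProduct P Q ≠ 0) (hw : w ≠ 0)
    (hmP : m ⬝ᵥ P = 0) (hmQ : m ⬝ᵥ Q = 0) (hwP : w ⬝ᵥ P = 0) (hwQ : w ⬝ᵥ Q = 0) :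
    ∃ c : k, m = c • w := by
  obtain ⟨c, hc⟩ := eq_smul_cross h hmP hmQ
  obtain ⟨d, rfl⟩ := eq_smul_cross h hwP hwQ
  have hd : d ≠ 0 := by rintro rfl; simp at hw
  exact ⟨c * d⁻¹, by rw [hc, smul_smul, inv_mul_cancel_right₀ hd]⟩

variable [IsAlgClosed k]

/-- The third intersection point of a chord. -/
theorem IsSmoothCubic.third_point_chord (hf : IsSmoothCubic f) {p q : zeroLocus f} {P Q : Fin 3 → k}
    (hP : Represents P p.1) (hQ : Represents Q q.1) (hpq : p ≠ q) :
    ∃ r : zeroLocus f, Represents ((grad f Q ⬝ᵥ P) • P - (grad f P ⬝ᵥ Q) • Q) r.1 ∧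
      IsLineSection p q r (crossProduct P Q) := by
  have hcr : crossProduct P Q ≠ 0 := cross_ne_zero_of_ne hP hQ fun h => hpq (Subtype.ext h)
  have hPf : eval P f = 0 := (hP.eval_eq_zero_iff hf.homogeneous).2 p.2
  have hQf : eval Q f = 0 := (hQ.eval_eq_zero_iff hf.homogeneous).2 q.2
  have hline := eval_line hf.homogeneous P Q
  simp only [hPf, hQf] at hline
  have hAB : grad f Q ⬝ᵥ P ≠ 0 ∨ -(grad f P ⬝ᵥ Q) ≠ 0 := by
    by_contra! hc
    obtain ⟨v, hv, hv0⟩ := hf.exists_eval_ne_zero hcr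
    obtain ⟨α, γ, rfl⟩ := exists_combination_of_cross hcr hv
    rw [hline, neg_eq_zero.1 hc.2, hc.1] at hv0
    simp at hv0
  have hS := combination_ne_zero hcr hAB
  rw [neg_smul, ← sub_eq_add_neg] at hS
  have hSf : eval ((grad f Q ⬝ᵥ P) • P - (grad f P ⬝ᵥ Q) • Q) f = 0 := by
    rw [sub_eq_add_neg, ← neg_smul, hline]
    ring
  obtain ⟨r, hr⟩ := exists_point hf.homogeneous hS hSf
  refine ⟨r, hr, ?_⟩
  refine hf.isLineSection_of_factorization hcr (a := ![1, 0, grad f Q ⬝ᵥ P])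
    (b := ![0, 1, -(grad f P ⬝ᵥ Q)]) (c := 1) (p := ![p, q, r]) ?_ ?_ ?_
  · intro i; fin_cases i
    · simp
    · simp
    · exact hAB
  · intro α γ
    rw [hline]
    simp
    ring
  · intro i; fin_cases i
    · simpa using hP
    · simpa using hQ
    · simpa [sub_eq_add_neg] using hr

/-- The third intersection point of a tangent line. -/
theorem IsSmoothCubic.third_point_tangent (hf : IsSmoothCubic f) {p : zeroLocus f} {P W : Fin 3 → k}
    (hP : Represents P p.1) (hcr : crossProduct P W ≠ 0) (hT : grad f P ⬝ᵥ W = 0) :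
    ∃ r : zeroLocus f, Represents (eval W f • P - (grad f W ⬝ᵥ P) • W) r.1 ∧
      IsLineSection p p r (crossProduct P W) := by
  have hPf : eval P f = 0 := (hP.eval_eq_zero_iff hf.homogeneous).2 p.2
  have hline := eval_line hf.homogeneous P W
  simp only [hPf, hT] at hline
  have hAB : eval W f ≠ 0 ∨ -(grad f W ⬝ᵥ P) ≠ 0 := by
    by_contra! hc
    obtain ⟨v, hv, hv0⟩ := hf.exists_eval_ne_zero hcr
    obtain ⟨α, γ, rfl⟩ := exists_combination_of_cross hcr hv
    rw [hline, neg_eq_zero.1 hc.2, hc.1] at hv0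
    simp at hv0
  have hS := combination_ne_zero hcr hAB
  rw [neg_smul, ← sub_eq_add_neg] at hS
  have hSf : eval (eval W f • P - (grad f W ⬝ᵥ P) • W) f = 0 := by
    rw [sub_eq_add_neg, ← neg_smul, hline]
    ring
  obtain ⟨r, hr⟩ := exists_point hf.homogeneous hS hSf
  refine ⟨r, hr, ?_⟩
  -- The restriction is `γ² (α (grad f W · P) + γ f(W))`; the sign `-1` comes from the factors `α b
  -- i - γ a i`.
  refine hf.isLineSection_of_factorization hcr (a := ![1, 1, eval W f])
    (b := ![0, 0, -(grad f W ⬝ᵥ P)]) (c := -1) (p := ![p, p, r]) ?_ ?_ ?_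
  · intro i; fin_cases i
    · simp
    · simp
    · exact hAB
  · intro α γ
    rw [hline]
    simp
    ring
  · intro i; fin_cases i
    · simpa using hP
    · simpa using hP
    · simpa [sub_eq_add_neg] using hr

theorem IsSmoothCubic.exists_third_point (hf : IsSmoothCubic f) (p q : zeroLocus f) :
    ∃ r w, IsLineSection p q r w := by
  by_cases hpq : p = q
  · subst hpq
    obtain ⟨W, hW, hT⟩ := exists_tangent_vector p.1.rep_nonzero (grad f p.1.rep)
    obtain ⟨r, -, hr⟩ := hf.third_point_tangent (represents_rep p.1) hW hT
    exact ⟨r, _, hr⟩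
  · obtain ⟨r, -, hr⟩ := hf.third_point_chord (represents_rep p.1) (represents_rep q.1) hpq
    exact ⟨r, _, hr⟩

theorem IsSmoothCubic.ord_smul (hf : IsSmoothCubic f) (p : zeroLocus f) {c : k} {w : Fin 3 → k}
    (h : c • w ≠ 0) : ord f p.1 (lin (c • w)) = ord f p.1 (lin w) := by
  rw [lin_smul, hf.ord_C_mul p (left_ne_zero_of_smul h) (isHomogeneous_lin w)
    (hf.lin_notMem (right_ne_zero_of_smul h))]

/-- Distinct points of a smooth cubic are not linearly equivalent. -/
theorem IsSmoothCubic.pointClass_injective (hf : IsSmoothCubic f) :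
    Function.Injective (pointClass : zeroLocus f → Pic f) := by
  classical
  intro p q h
  by_contra hpq
  rw [pointClass, pointClass, eq_comm, QuotientAddGroup.eq] at h
  obtain ⟨d, G, H, hG, hH, hGf, hHf, hD⟩ := hf.isPrincipal_of_mem h
  obtain ⟨r, w, hw0, hw⟩ := hf.exists_third_point p q
  obtain ⟨hwp, hwq, hwr⟩ := IsLineSection.dotProduct_eq_zero hf ⟨hw0, hw⟩
  simp only [Finsupp.add_apply, Finsupp.neg_apply, Finsupp.single_apply] at hD
  simp only [@eq_comm _ _ p, @eq_comm _ _ q, @eq_comm _ _ r] at hw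
  have hprime := hf.isPrime
  have hGw : G * lin w ∉ Ideal.span {f} := fun h =>
    (hprime.mem_or_mem h).elim hGf (hf.lin_notMem hw0)
  have hord : ∀ x : zeroLocus f, ord f x.1 (G * lin w) = ord f x.1 G + ord f x.1 (lin w) :=
    fun x => hf.ord_mul x hG hGf (isHomogeneous_lin w) (hf.lin_notMem hw0)
  -- If `p - q = div (G / H)` and the line `w` cuts out `p + q + r`, then `G * lin w` has divisor
  -- `div H + 2p + r`. Noether's theorem produces a line `m` with divisor `2p + r`.
  obtain ⟨M, hM, hMH⟩ := hf.exists_mul_of_ord_le (e := 1) (d := d)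
    (by rw [add_comm]; exact hG.mul (isHomogeneous_lin w)) hGw hH hHf fun x => by
      have h1 := hD x
      have h2 := hw x
      rw [hord]
      split_ifs at h1 h2 <;> omega
  obtain ⟨m, rfl⟩ := exists_eq_lin hM
  have hm0 : m ≠ 0 := by
    rintro rfl
    rw [show lin (0 : Fin 3 → k) = 0 by simp [lin], zero_mul, sub_zero] at hMH
    exact hGw hMH
  have hm : ∀ x : zeroLocus f, ord f x.1 (lin m) =
      2 * (if p = x then 1 else 0) + if r = x then 1 else 0 := by
    intro x
    have h1 := hD x
    have h2 := hw x
    have h3 := ord_congr x.1 hMH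
    rw [hord, hf.ord_mul x hM (hf.lin_notMem hm0) hH hHf] at h3
    split_ifs at h1 h2 ⊢ <;> omega
  -- Both lines pass through `p` and `r`, or are tangent at `p` if `r = p`; so they coincide.
  -- Comparing the orders at `q` then contradicts `p ≠ q`.
  have hprop : ∃ c : k, m = c • w := by
    by_cases hrp : r = p
    · subst hrp
      have h1 := hm r
      have h2 := hw r
      simp only [if_true] at h1 h2
      have hmr : m ⬝ᵥ r.1.rep = 0 := by
        by_contra h0
        rw [(hf.ord_eq_zero_iff r (isHomogeneous_lin m) (hf.lin_notMem hm0)).2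
          (by rwa [eval_lin])] at h1
        omega
      have hmT : ∃ c : k, m = c • grad f r.1.rep := by
        by_contra! hc
        rw [hf.ord_lin r hmr hc] at h1
        omega
      have hwT : ∃ c : k, w = c • grad f r.1.rep := by
        by_contra! hc
        rw [hf.ord_lin r hwr hc] at h2
        split_ifs at h2 <;> omega
      obtain ⟨c, hc⟩ := hmT
      obtain ⟨e, rfl⟩ := hwT
      have he : e ≠ 0 := left_ne_zero_of_smul hw0
      exact ⟨c * e⁻¹, by rw [hc, smul_smul, inv_mul_cancel_right₀ he]⟩
    · have key : ∀ x : zeroLocus f, ord f x.1 (lin m) ≠ 0 → m ⬝ᵥ x.1.rep = 0 := by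
        intro x hx
        rw [Ne, hf.ord_eq_zero_iff x (isHomogeneous_lin m) (hf.lin_notMem hm0), not_not,
          eval_lin] at hx
        exact hx
      refine eq_smul_of_orthogonal (cross_ne_zero_of_ne (represents_rep p.1) (represents_rep r.1)
        fun h => hrp (Subtype.ext h.symm)) hw0 (key p ?_) (key r ?_) hwp hwr <;> rw [hm] <;> simp
  obtain ⟨c, rfl⟩ := hprop
  have h1 := hm q
  have h2 := hw q
  rw [hf.ord_smul q hm0, h2] at h1
  simp [hpq] at h1

theorem IsSmoothCubic.line_section_third_eq (hf : IsSmoothCubic f) {p q r s : zeroLocus f}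
    {w w' : Fin 3 → k} (h : IsLineSection p q r w) (h' : IsLineSection p q s w') : r = s :=
  hf.pointClass_injective (add_left_cancel (hf.line_section_class h h'))

/-- The chord construction of the group law: all line sections are equivalent, so `p + q + r = r + o
+ t`. -/
theorem IsSmoothCubic.exists_add (hf : IsSmoothCubic f) (o p q : zeroLocus f) :
    ∃ t, (pointClass p + pointClass q : Pic f) = pointClass t + pointClass o := by
  obtain ⟨r, w, h⟩ := hf.exists_third_point p q
  obtain ⟨t, w', h'⟩ := hf.exists_third_point r o
  have := hf.line_section_class h h'
  refine ⟨t, ?_⟩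
  rw [← sub_eq_zero] at this ⊢
  rw [← this]
  abel

theorem IsSmoothCubic.exists_sub (hf : IsSmoothCubic f) (o p q : zeroLocus f) :
    ∃ t, (pointClass p - pointClass q : Pic f) = pointClass t - pointClass o := by
  obtain ⟨r, w, h⟩ := hf.exists_third_point p o
  obtain ⟨t, w', h'⟩ := hf.exists_third_point r q
  have := hf.line_section_class h h'
  refine ⟨t, ?_⟩
  rw [← sub_eq_zero] at this ⊢
  rw [← this]
  abel

/-- Every class is the class of a point plus a multiple of a given point. -/
theorem IsSmoothCubic.exists_class_eq (hf : IsSmoothCubic f) (o : zeroLocus f) (x : Pic f) :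
    ∃ (p : zeroLocus f) (n : ℤ), x = pointClass p + n • pointClass o := by
  have step : ∀ (q : zeroLocus f) (m : ℤ) (x : Pic f),
      (∃ (p : zeroLocus f) (n : ℤ), x = pointClass p + n • pointClass o) →
      ∃ (p : zeroLocus f) (n : ℤ), m • pointClass q + x = pointClass p + n • pointClass o := by
    intro q m
    induction m with
    | zero => intro x hx; simpa using hx
    | succ i ih =>
      intro x hx
      obtain ⟨p, n, h⟩ := ih x hx
      obtain ⟨t, ht⟩ := hf.exists_add o p q
      refine ⟨t, n + 1, ?_⟩
      have := congrArg₂ (· + ·) h ht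
      rw [add_zsmul, add_zsmul, one_zsmul, one_zsmul]
      rw [← sub_eq_zero] at this ⊢
      rw [← this]
      abel
    | pred i ih =>
      intro x hx
      obtain ⟨p, n, h⟩ := ih x hx
      obtain ⟨t, ht⟩ := hf.exists_sub o p q
      refine ⟨t, n - 1, ?_⟩
      have := congrArg₂ (· + ·) h ht
      rw [sub_zsmul, sub_zsmul, one_zsmul, one_zsmul]
      rw [← sub_eq_zero] at this ⊢
      rw [← this]
      abel
  obtain ⟨D, rfl⟩ := QuotientAddGroup.mk_surjective x
  induction D using Finsupp.induction with
  | zero => exact ⟨o, -1, by simp⟩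
  | single_add a m D _ _ ih =>
    have : (QuotientAddGroup.mk (Finsupp.single a m) : Pic f) = m • pointClass a := by
      rw [pointClass, ← QuotientAddGroup.mk_zsmul, Finsupp.smul_single, smul_eq_mul, mul_one]
    rw [QuotientAddGroup.mk_add, this]
    exact step a m _ ih

/-- The sum of a point and a class of order two is the class of a point. -/
theorem IsSmoothCubic.exists_translate (hf : IsSmoothCubic f) {β : Pic f} (hβ : 2 • β = 0)
    (p : zeroLocus f) : ∃ q, IsTranslate β p q := by
  -- A class `q + n p` with `n ≥ 0` cannot be killed by `2`, because a nonzero effective divisor is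
  -- not principal. Applied to `β` or to `-β`, this forces the coefficient `-1` in `β = q + n p`.
  have key : ∀ (q : zeroLocus f) (n : ℕ),
      (2 • (pointClass q + n • pointClass p) : Pic f) ≠ 0 := by
    intro q n h0
    have : (2 • (Finsupp.single q 1 + n • Finsupp.single p 1) : Divisor f) ∈ principalDivisors f := by
      rw [← QuotientAddGroup.eq_zero_iff]
      exact h0
    have h1 := hf.eq_zero_of_effective this (fun x => by
      classical
      simp only [Finsupp.smul_apply, Finsupp.add_apply, Finsupp.single_apply, nsmul_eq_mul]
      positivity)
    have h2 := DFunLike.congr_fun h1 q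
    classical
    simp only [Finsupp.smul_apply, Finsupp.add_apply, Finsupp.single_apply, nsmul_eq_mul, if_true,
      Finsupp.zero_apply] at h2
    push_cast at h2
    split_ifs at h2 <;> omega
  obtain ⟨q, n, hq⟩ := hf.exists_class_eq p β
  rcases lt_trichotomy n (-1) with hn | rfl | hn
  · obtain ⟨t, ht⟩ := hf.exists_sub p p q
    obtain ⟨m, hm⟩ := Int.eq_ofNat_of_zero_le (show 0 ≤ -n - 2 by omega)
    have h1 : -β = pointClass t + m • pointClass p := by
      rw [← natCast_zsmul, ← hm, hq, sub_zsmul, neg_zsmul, two_zsmul]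
      rw [← sub_eq_zero] at ht ⊢
      rw [← ht]
      abel
    refine absurd ?_ (key t m)
    rw [← h1, neg_nsmul, hβ, neg_zero]
  · refine ⟨q, ?_⟩
    rw [IsTranslate, hq, neg_one_zsmul]
    abel
  · obtain ⟨m, rfl⟩ := Int.eq_ofNat_of_zero_le (show 0 ≤ n by omega)
    refine absurd ?_ (key q m)
    rw [← natCast_zsmul (pointClass p) m, ← hq, hβ]

theorem IsSmoothCubic.existsUnique_translate (hf : IsSmoothCubic f) {β : Pic f} (hβ : 2 • β = 0)
    (p : zeroLocus f) : ∃! q, IsTranslate β p q := by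
  obtain ⟨q, hq⟩ := hf.exists_translate hβ p
  exact ⟨q, hq, fun r hr => hf.pointClass_injective (Eq.trans hr hq.symm)⟩

end GroupLaw

/-! ### A point whose tangent leads to a third point outside the `β`-orbit. -/

section GoodPoint

variable {k : Type*} [Field k] {f : CoordRing k} {β : Pic f}

theorem IsTranslate.ne (hβ : β ≠ 0) {p q : zeroLocus f} (h : IsTranslate β p q) : p ≠ q := by
  rintro rfl
  exact hβ (left_eq_add.1 h)

theorem IsTranslate.symm (hβ2 : 2 • β = 0) {p q : zeroLocus f} (h : IsTranslate β p q) :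
    IsTranslate β q p := by
  rw [IsTranslate] at h ⊢
  rw [h, add_assoc, ← two_nsmul, hβ2, add_zero]

theorem nonempty_zeroLocus (hβ : β ≠ 0) : Nonempty (zeroLocus f) := by
  by_contra h
  rw [not_nonempty_iff] at h
  refine hβ ?_
  obtain ⟨D, rfl⟩ := QuotientAddGroup.mk_surjective β
  rw [Subsingleton.elim D 0, QuotientAddGroup.mk_zero]

theorem linear_coeff_eq (hk : (2 : k) ≠ 0) {a a' b b' c : k}
    (h : ∀ t : k, a * t + b * t ^ 2 + c * t ^ 3 = a' * t + b' * t ^ 2 + c * t ^ 3) : a = a' := by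
  have h1 := h 1
  have h2 := h (-1)
  refine mul_left_cancel₀ hk ?_
  linear_combination h1 - h2

theorem quadratic_coeff_eq (hk : (2 : k) ≠ 0) {a a' b b' : k}
    (h : ∀ t : k, a * t + b * t ^ 2 = a' * t + b' * t ^ 2) : b = b' := by
  have h1 := h 1
  have h2 := h (-1)
  refine mul_left_cancel₀ hk ?_
  linear_combination h1 + h2

theorem exists_dotProduct_eq_one {T : Fin 3 → k} (hT : T ≠ 0) : ∃ Z, T ⬝ᵥ Z = 1 := by
  obtain ⟨j, hj⟩ := Function.ne_iff.1 hT
  exact ⟨Pi.single j (T j)⁻¹, by simpa using mul_inv_cancel₀ hj⟩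

theorem isHomogeneous_polar (hf : f.IsHomogeneous 3) (P : Fin 3 → k) :
    (∑ j, C (P j) * pderiv j f).IsHomogeneous 2 :=
  IsHomogeneous.sum _ _ _ fun _ _ => (IsHomogeneous.pderiv hf).C_mul _

theorem eval_polar (P v : Fin 3 → k) : eval v (∑ j, C (P j) * pderiv j f) = grad f v ⬝ᵥ P := by
  simp [grad, dotProduct, mul_comm]

variable [IsAlgClosed k]

/-- The root `y₁` is taken from the quotient by `y - y₀`; if it equals `y₀`, the root is double and
the derivative vanishes. -/
theorem exists_roots_cubic {B : k} (hB : B ≠ 0) (e g d : k) : ∃ y₀ y₁ : k,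
    B * y₀ ^ 3 + e * y₀ ^ 2 + g * y₀ + d = 0 ∧ B * y₁ ^ 3 + e * y₁ ^ 2 + g * y₁ + d = 0 ∧
    (y₀ ≠ y₁ ∨ 3 * B * y₀ ^ 2 + 2 * e * y₀ + g = 0) := by
  obtain ⟨y₀, h0⟩ := IsAlgClosed.exists_root
    (Polynomial.C B * Polynomial.X ^ 3 + Polynomial.C e * Polynomial.X ^ 2 +
      Polynomial.C g * Polynomial.X + Polynomial.C d) (by
        rw [Polynomial.degree_cubic hB]; simp)
  obtain ⟨y₁, h1⟩ := IsAlgClosed.exists_root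
    (Polynomial.C B * Polynomial.X ^ 2 + Polynomial.C (B * y₀ + e) * Polynomial.X +
      Polynomial.C (B * y₀ ^ 2 + e * y₀ + g)) (by
        rw [Polynomial.degree_quadratic hB]; simp)
  simp [Polynomial.IsRoot] at h0 h1
  refine ⟨y₀, y₁, h0, ?_, ?_⟩
  · linear_combination h0 + (y₁ - y₀) * h1
  · by_cases h : y₀ = y₁
    · subst h
      right
      linear_combination h1
    · exact Or.inl h

theorem IsSmoothCubic.grad_dotProduct_of_tangent (hf : IsSmoothCubic f) {p r : zeroLocus f}
    {w : Fin 3 → k} (h : IsLineSection p p r w) : grad f p.1.rep ⬝ᵥ r.1.rep = 0 := by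
  obtain ⟨h1, -, h2⟩ := h.dotProduct_eq_zero hf
  have : ∃ c : k, w = c • grad f p.1.rep := by
    by_contra! hc
    have := hf.ord_lin p h1 hc
    rw [h.2, if_pos rfl, add_assoc] at this
    omega
  obtain ⟨c, rfl⟩ := this
  rw [smul_dotProduct, smul_eq_mul] at h2
  exact (mul_eq_zero.1 h2).resolve_left (left_ne_zero_of_smul h.1)

/-- From a flex of a smooth cubic one can draw tangents to two other points of the cubic. -/
theorem IsSmoothCubic.exists_tangents_of_flex (hk : (2 : k) ≠ 0) (hf : IsSmoothCubic f)
    {o : zeroLocus f} {w₀ : Fin 3 → k} (ho : IsLineSection o o o w₀) :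
    ∃ p₁ p₂ : zeroLocus f, p₁ ≠ p₂ ∧ p₁ ≠ o ∧ p₂ ≠ o ∧ (∃ w, IsLineSection p₁ p₁ o w) ∧
      ∃ w, IsLineSection p₂ p₂ o w := by
  set P := o.1.rep with hP
  have hP0 : P ≠ 0 := o.1.rep_nonzero
  have hPf : eval P f = 0 := o.2
  set T := grad f P with hT
  have hT0 : T ≠ 0 := hf.grad_ne_zero hP0 hPf
  have hTP : T ⬝ᵥ P = 0 := by rw [hT, grad_dotProduct_self hf.homogeneous, hPf, mul_zero]
  obtain ⟨W, hPW, hTW⟩ := exists_tangent_vector hP0 T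
  obtain ⟨Z, hTZ⟩ := exists_dotProduct_eq_one hT0
  obtain ⟨r, hr, hrs⟩ := hf.third_point_tangent (represents_rep o.1) hPW hTW
  have hro := hf.line_section_third_eq hrs ho
  subst hro
  obtain ⟨c, hc⟩ := (hr.eq_iff (represents_rep r.1)).1 rfl
  rw [← hP] at hc
  -- At a flex the third tangent point is again `P`, so its coefficient along `W` vanishes.
  have hA : grad f W ⬝ᵥ P = 0 := by
    by_contra hA
    refine combination_ne_zero hPW (α := eval W f - c) (γ := -(grad f W ⬝ᵥ P))
      (Or.inr (neg_ne_zero.2 hA)) ?_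
    rw [sub_smul, ← hc, neg_smul]
    abel
  have hB : eval W f ≠ 0 := by
    intro hB
    rw [hB, hA] at hr
    exact hr.ne_zero (by simp)
  set B := eval W f
  set q := ∑ j, C (P j) * pderiv j f with hq
  have hqv : ∀ v, grad f v ⬝ᵥ P = eval v q := fun v => (eval_polar P v).symm
  set b := grad q W ⬝ᵥ Z
  set c := eval Z q
  set e := grad f W ⬝ᵥ Z
  set g := grad f Z ⬝ᵥ W
  set d := eval Z f
  have hqyz : ∀ y : k, eval (y • W + Z) q = b * y + c := by
    intro y
    have := (eval_line_quadratic (isHomogeneous_polar hf.homogeneous P) W Z).1 y 1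
    have hqW : eval W q = 0 := by rw [← hqv]; exact hA
    rw [one_smul, hqW] at this
    rw [this]
    ring
  have hfyz : ∀ y : k, eval (y • W + Z) f = B * y ^ 3 + e * y ^ 2 + g * y + d := by
    intro y
    have := eval_line hf.homogeneous W Z y 1
    rw [one_smul] at this
    rw [this]
    ring
  -- A Weierstrass equation with the flex at infinity. Tangents through the flex belong to the `y`
  -- for which the quadratic in `x` has a double root, that is, to the roots of the cubic left after
  -- completing the square.
  have hfxy : ∀ x y : k, eval (x • P + (y • W + Z)) f =
      x ^ 2 + x * (b * y + c) + (B * y ^ 3 + e * y ^ 2 + g * y + d) := by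
    intro x y
    have := eval_line hf.homogeneous P (y • W + Z) x 1
    rw [one_smul, hqv, hqyz, hfyz, hPf, ← hT, dotProduct_add, dotProduct_smul, hTW, hTZ] at this
    rw [this]
    simp
  have hgP : ∀ x y : k, grad f (x • P + (y • W + Z)) ⬝ᵥ P = 2 * x + (b * y + c) := by
    intro x y
    refine linear_coeff_eq hk (b := grad f P ⬝ᵥ (x • P + (y • W + Z))) (b' := 1) (c := 0) fun t => ?_
    have h1 := eval_line hf.homogeneous (x • P + (y • W + Z)) P 1 t
    rw [one_smul, show x • P + (y • W + Z) + t • P = (x + t) • P + (y • W + Z) by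
      rw [add_smul]; abel, hfxy, hfxy, hPf] at h1
    linear_combination -h1
  have hgW : ∀ x y : k, grad f (x • P + (y • W + Z)) ⬝ᵥ W =
      x * b + (3 * B * y ^ 2 + 2 * e * y + g) := by
    intro x y
    refine linear_coeff_eq hk (b := grad f W ⬝ᵥ (x • P + (y • W + Z))) (b' := 3 * B * y + e) (c := B)
      fun t => ?_
    have h1 := eval_line hf.homogeneous (x • P + (y • W + Z)) W 1 t
    rw [one_smul, show x • P + (y • W + Z) + t • W = x • P + ((y + t) • W + Z) by
      rw [add_smul]; abel, hfxy, hfxy] at h1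
    linear_combination -h1
  have hTv : ∀ x y : k, T ⬝ᵥ (x • P + (y • W + Z)) = 1 := by
    intro x y
    simp [dotProduct_add, dotProduct_smul, hTP, hTW, hTZ]
  have hv0 : ∀ x y : k, x • P + (y • W + Z) ≠ 0 := by
    intro x y h
    have := hTv x y
    rw [h, dotProduct_zero] at this
    exact zero_ne_one this
  obtain ⟨y₀, y₁, h0, h1, h01⟩ := exists_roots_cubic hB (e - b ^ 2 / 4) (g - b * c / 2)
    (d - c ^ 2 / 4)
  have h4 : (4 : k) ≠ 0 := by
    have := mul_ne_zero hk hk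
    norm_num at this
    exact this
  have hxf : ∀ y : k, B * y ^ 3 + (e - b ^ 2 / 4) * y ^ 2 + (g - b * c / 2) * y +
      (d - c ^ 2 / 4) = 0 → eval ((-(b * y + c) / 2) • P + (y • W + Z)) f = 0 := by
    intro y hy
    rw [hfxy]
    rw [← hy]
    field_simp
    ring
  have hxP : ∀ y : k, grad f ((-(b * y + c) / 2) • P + (y • W + Z)) ⬝ᵥ P = 0 := by
    intro y
    rw [hgP]
    field_simp
    ring
  -- At a double root the gradient would vanish on `P`, on `W` and, by Euler's relation, on the
  -- point itself, contradicting smoothness.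
  have hne : y₀ ≠ y₁ := by
    refine h01.resolve_right fun hD => ?_
    set x := -(b * y₀ + c) / 2 with hx
    refine hf.grad_ne_zero (hv0 x y₀) (hxf y₀ h0) ?_
    have hW : grad f (x • P + (y₀ • W + Z)) ⬝ᵥ W = 0 := by
      rw [hgW, hx, ← hD]
      field_simp
      ring
    have hV := grad_dotProduct_self hf.homogeneous (x • P + (y₀ • W + Z))
    rw [hxf y₀ h0, mul_zero] at hV
    obtain ⟨s, hs⟩ := eq_smul_cross hPW (hxP y₀) hW
    rw [hs] at hV
    obtain ⟨s', hs'⟩ := eq_smul_cross hPW hTP hTW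
    have hs'0 : s' ≠ 0 := by
      rintro rfl
      exact hT0 (by rw [hs', zero_smul])
    have : crossProduct P W = s'⁻¹ • T := by
      rw [hs', smul_smul, inv_mul_cancel₀ hs'0, one_smul]
    rw [this, smul_smul, smul_dotProduct, hTv, smul_eq_mul, mul_one] at hV
    rw [hs, this, smul_smul, hV, zero_smul]
  have key : ∀ y : k, B * y ^ 3 + (e - b ^ 2 / 4) * y ^ 2 + (g - b * c / 2) * y +
      (d - c ^ 2 / 4) = 0 → ∃ p : zeroLocus f,
        Represents ((-(b * y + c) / 2) • P + (y • W + Z)) p.1 ∧ p ≠ r ∧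
        ∃ w, IsLineSection p p r w := by
    intro y hy
    obtain ⟨p, hp⟩ := exists_point hf.homogeneous (hv0 _ y) (hxf y hy)
    have hpr : p ≠ r := by
      intro h
      obtain ⟨t, ht⟩ := (hp.eq_iff (represents_rep r.1)).1 (congrArg _ h)
      have := hTv (-(b * y + c) / 2) y
      rw [ht, dotProduct_smul, ← hP, hTP, smul_zero] at this
      exact zero_ne_one this
    refine ⟨p, hp, hpr, ?_⟩
    obtain ⟨s, hs, hsec⟩ := hf.third_point_tangent hp
      (cross_ne_zero_of_ne hp (represents_rep r.1) fun h => hpr (Subtype.ext h)) (hxP y)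
    rw [← hP, hPf, ← hT, hTv, zero_smul, zero_sub, one_smul] at hs
    have : s = r := Subtype.ext ((hs.eq_iff (represents_rep r.1)).2 ⟨-1, by simp [hP]⟩)
    subst this
    exact ⟨_, hsec⟩
  obtain ⟨p₁, hp₁, hp₁r, hs₁⟩ := key y₀ h0
  obtain ⟨p₂, hp₂, hp₂r, hs₂⟩ := key y₁ h1
  refine ⟨p₁, p₂, fun h => hne ?_, hp₁r, hp₂r, hs₁, hs₂⟩
  obtain ⟨t, ht⟩ := (hp₁.eq_iff hp₂).1 (congrArg _ h)
  have ht1 := congrArg (T ⬝ᵥ ·) ht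
  simp only [dotProduct_smul, hTv, smul_eq_mul, mul_one] at ht1
  rw [← ht1, one_smul] at ht
  by_contra hy
  refine combination_ne_zero hPW (α := -(b * y₀ + c) / 2 - -(b * y₁ + c) / 2) (γ := y₀ - y₁)
    (Or.inr (sub_ne_zero.2 hy)) ?_
  generalize -(b * y₀ + c) / 2 = x₀ at ht ⊢
  generalize -(b * y₁ + c) / 2 = x₁ at ht ⊢
  rw [sub_smul, sub_smul, ← sub_eq_zero.2 ht]
  abel

/-- There is a point `p` of the curve whose tangent meets the curve again outside `p` and
`p + β`. -/
theorem IsSmoothCubic.exists_good_point (hk : (2 : k) ≠ 0) (hf : IsSmoothCubic f) (hβ : β ≠ 0)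
    (hβ2 : 2 • β = 0) : ∃ (p q r : zeroLocus f) (w : Fin 3 → k), IsTranslate β p q ∧
      IsLineSection p p r w ∧ r ≠ p ∧ r ≠ q := by
  obtain ⟨p⟩ := nonempty_zeroLocus hβ
  obtain ⟨q, hq⟩ := hf.exists_translate hβ2 p
  obtain ⟨r, w, hr⟩ := hf.exists_third_point p p
  by_cases hgood : r ≠ p ∧ r ≠ q
  · exact ⟨p, q, r, w, hq, hr, hgood.1, hgood.2⟩
  -- If the tangent at `p` returns to `p`, then `p` is a flex. If it leads to `q = p + β`, then `2q
  -- + q = 2p + q` makes `q` a flex.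
  obtain ⟨o, w₀, ho⟩ : ∃ (o : zeroLocus f) (w₀ : Fin 3 → k), IsLineSection o o o w₀ := by
    by_cases hrp : r = p
    · subst hrp; exact ⟨_, _, hr⟩
    · have hrq : r = q := by by_contra h; exact hgood ⟨hrp, h⟩
      subst hrq
      obtain ⟨s, w', hs⟩ := hf.exists_third_point r r
      have h1 := hf.line_section_class hs hr
      have h2 : s = r := by
        refine hf.pointClass_injective ?_
        have h3 : (pointClass r : Pic f) = pointClass p + β := hq
        have h4 := (two_nsmul β).symm.trans hβ2
        rw [← sub_eq_zero] at h1 ⊢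
        rw [← h1, h3, show (pointClass p + β + (pointClass p + β) + pointClass s -
          (pointClass p + pointClass p + (pointClass p + β)) : Pic f) =
          pointClass s - (pointClass p + β) + (β + β) by abel, h4, add_zero]
      subst h2
      exact ⟨_, _, hs⟩
  obtain ⟨p₁, p₂, h12, h1o, h2o, ⟨w₁, h1⟩, w₂, h2⟩ := hf.exists_tangents_of_flex hk ho
  obtain ⟨o', ho'⟩ := hf.exists_translate hβ2 o
  -- A tangency point of a line from the flex `o` is good unless it is `o + β`; of two such points
  -- at least one qualifies.
  have key : ∀ (p : zeroLocus f) (w : Fin 3 → k), p ≠ o → p ≠ o' → IsLineSection p p o w →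
      ∃ (p q r : zeroLocus f) (w : Fin 3 → k), IsTranslate β p q ∧
      IsLineSection p p r w ∧ r ≠ p ∧ r ≠ q := by
    intro p w hpo hpo' hw
    obtain ⟨q, hq⟩ := hf.exists_translate hβ2 p
    refine ⟨p, q, o, w, hq, hw, hpo.symm, ?_⟩
    rintro rfl
    exact hpo' ((hf.existsUnique_translate hβ2 o).unique (hq.symm hβ2) ho')
  by_cases h1o' : p₁ = o'
  · exact key p₂ w₂ h2o (fun h => h12 (h1o'.trans h.symm)) h2
  · exact key p₁ w₁ h1o h1o' h1

end GoodPoint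

/-! ### Normal form of the cubic, with translation by `β` as conjugacy under a net of conics. -/

section NormalForm

variable {k : Type*} [Field k]

/-- The value at `X` of the cubic form `a y (x² + z²) + b x (y² + z²) + e x y z`. -/
def chordCubic (a b e : k) (X : Fin 3 → k) : k :=
  a * X 1 * (X 0 ^ 2 + X 2 ^ 2) + b * X 0 * (X 1 ^ 2 + X 2 ^ 2) + e * X 0 * X 1 * X 2

/-- The points `X` and `Y` are conjugate with respect to the net of conics
`x² = z²`, `y² = z²`, `2 a x z + 2 b y z + e x² = 0`. -/
def Conjugate (a b e : k) (X Y : Fin 3 → k) : Prop :=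
  X 0 * Y 0 = X 2 * Y 2 ∧ X 1 * Y 1 = X 2 * Y 2 ∧
    a * (X 0 * Y 2 + X 2 * Y 0) + b * (X 1 * Y 2 + X 2 * Y 1) + e * (X 0 * Y 0) = 0

variable {a b e : k}

theorem Conjugate.symm {X Y : Fin 3 → k} (h : Conjugate a b e X Y) : Conjugate a b e Y X := by
  obtain ⟨h1, h2, h3⟩ := h
  exact ⟨by linear_combination h1, by linear_combination h2, by linear_combination h3⟩

theorem Conjugate.smul_right {X Y : Fin 3 → k} (h : Conjugate a b e X Y) (c : k) :
    Conjugate a b e X (c • Y) := by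
  obtain ⟨h1, h2, h3⟩ := h
  simp only [Conjugate, Pi.smul_apply, smul_eq_mul]
  exact ⟨by linear_combination c * h1, by linear_combination c * h2, by linear_combination c * h3⟩

/-- The matrix of the equations for the points conjugate to `X`. -/
def conjMatrix {R : Type*} [CommRing R] (a b e : R) (X : Fin 3 → R) : Matrix (Fin 3) (Fin 3) R :=
  !![X 0, -X 1, 0; 0, X 1, -X 2; a * X 2 + e * X 0, b * X 2, a * X 0 + b * X 1]

/-- The cubic is the Jacobian of the net: its points are exactly those for which the three linear
conjugacy conditions have a nonzero solution. -/
theorem det_conjMatrix (X : Fin 3 → k) : (conjMatrix a b e X).det = chordCubic a b e X := by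
  simp [conjMatrix, Matrix.det_fin_three, chordCubic]
  ring

theorem conjMatrix_mulVec_eq_zero_iff (X Y : Fin 3 → k) :
    (conjMatrix a b e X).mulVec Y = 0 ↔ Conjugate a b e X Y := by
  simp only [conjMatrix, Conjugate, funext_iff, Fin.forall_fin_succ, Matrix.mulVec, dotProduct,
    Fin.sum_univ_three]
  simp
  constructor
  · rintro ⟨h1, h2, h3⟩
    exact ⟨by linear_combination h1 + h2, by linear_combination h2, by linear_combination h3⟩
  · rintro ⟨h1, h2, h3⟩
    exact ⟨by linear_combination h1 - h2, by linear_combination h2, by linear_combination h3⟩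

theorem Conjugate.chordCubic_eq_zero {X Y : Fin 3 → k} (h : Conjugate a b e X Y) (hY : Y ≠ 0) :
    chordCubic a b e X = 0 := by
  rw [← det_conjMatrix]
  exact Matrix.exists_mulVec_eq_zero_iff.1 ⟨Y, hY, (conjMatrix_mulVec_eq_zero_iff X Y).2 h⟩

theorem exists_conjugate {X : Fin 3 → k} (h : chordCubic a b e X = 0) :
    ∃ Y ≠ 0, Conjugate a b e X Y := by
  rw [← det_conjMatrix] at h
  obtain ⟨Y, hY, h0⟩ := Matrix.exists_mulVec_eq_zero_iff.2 h
  exact ⟨Y, hY, (conjMatrix_mulVec_eq_zero_iff X Y).1 h0⟩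

theorem eq_single_of_apply_eq_zero {X : Fin 3 → k} {i j l : Fin 3} (hi : X i = 0) (hj : X j = 0)
    (hij : i ≠ j) (hil : i ≠ l) (hjl : j ≠ l) : X = X l • Pi.single l 1 := by
  funext m
  obtain rfl | rfl | rfl : m = i ∨ m = j ∨ m = l := by omega
  · simp [hi, hil]
  · simp [hj, hjl]
  · simp

theorem eq_zero_of_dotProduct_eq_zero {P Q R v : Fin 3 → k} (h : crossProduct P Q ⬝ᵥ R ≠ 0)
    (hP : v ⬝ᵥ P = 0) (hQ : v ⬝ᵥ Q = 0) (hR : v ⬝ᵥ R = 0) : v = 0 := by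
  obtain ⟨c, rfl⟩ := eq_smul_cross (fun h0 => h (by rw [h0, zero_dotProduct])) hP hQ
  rw [smul_dotProduct, smul_eq_mul, mul_eq_zero, or_iff_left h] at hR
  rw [hR, zero_smul]

variable {f : CoordRing k} {β : Pic f} {M : Matrix (Fin 3) (Fin 3) k}

/-- The pure cubes vanish because the vertices lie on the curve; `x² z` and `y² z` vanish because
the tangents at `P` and `Q` pass through `R`. -/
theorem IsSmoothCubic.eval_basis (hf : IsSmoothCubic f) {P Q R : Fin 3 → k} (hP : eval P f = 0)
    (hQ : eval Q f = 0) (hR : eval R f = 0) (hPR : grad f P ⬝ᵥ R = 0) (hQR : grad f Q ⬝ᵥ R = 0) :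
    ∃ e : k, ∀ x y z : k, eval (x • P + (y • Q + z • R)) f =
      (grad f P ⬝ᵥ Q) * x ^ 2 * y + (grad f Q ⬝ᵥ P) * x * y ^ 2 + e * x * y * z +
        (grad f R ⬝ᵥ P) * x * z ^ 2 + (grad f R ⬝ᵥ Q) * y * z ^ 2 := by
  set q := ∑ j, C (P j) * pderiv j f with hq
  have hqv : ∀ v, grad f v ⬝ᵥ P = eval v q := fun v => (eval_polar P v).symm
  refine ⟨grad q Q ⬝ᵥ R, fun x y z => ?_⟩
  have h1 := eval_line hf.homogeneous P (y • Q + z • R) x 1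
  rw [one_smul, hqv, (eval_line_quadratic (isHomogeneous_polar hf.homogeneous P) Q R).1 y z,
    eval_line hf.homogeneous Q R y z, hP, hQ, hR, hQR, dotProduct_add, dotProduct_smul,
    dotProduct_smul, hPR] at h1
  rw [h1, ← hq, ← hqv, ← hqv]
  simp only [smul_eq_mul]
  ring

/-- Reads off the two polars that determine the third point of a chord from an explicit restriction
to the line; two values of `t` suffice when `2 ≠ 0`. -/
theorem third_point_coordinates (hk : (2 : k) ≠ 0) (hf : IsSmoothCubic f)
    {X T : Fin 3 → k} (hX : eval X f = 0) (hT : eval T f = 0) {A B : k}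
    (h : ∀ t : k, eval (X + t • T) f = A * t + B * t ^ 2) :
    grad f X ⬝ᵥ T = A ∧ grad f T ⬝ᵥ X = B := by
  have h1 : ∀ t : k, (grad f X ⬝ᵥ T) * t + (grad f T ⬝ᵥ X) * t ^ 2 = A * t + B * t ^ 2 := by
    intro t
    rw [← h, ← one_smul k X, eval_line hf.homogeneous, one_smul, hX, hT]
    ring
  exact ⟨linear_coeff_eq hk (b := grad f T ⬝ᵥ X) (b' := B) (c := 0) fun t => by linear_combination h1 t, quadratic_coeff_eq hk h1⟩

/-- The case in which `X` is one of the two vertices `p₀`, `q₀`: there the chords used in the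
general argument degenerate, and the conjugate is the other vertex. -/
theorem isTranslate_of_conjugate_single (hβ2 : 2 • β = 0) {p₀ q₀ : zeroLocus f}
    (h₀ : IsTranslate β p₀ q₀) (hp₀ : Represents (M.mulVec (Pi.single 0 1)) p₀.1)
    (hq₀ : Represents (M.mulVec (Pi.single 1 1)) q₀.1) (ha : a ≠ 0) (hb : b ≠ 0)
    {p q : zeroLocus f} {X Y : Fin 3 → k} (hX : Represents (M.mulVec X) p.1)
    (hY : Represents (M.mulVec Y) q.1) (h : Conjugate a b e X Y)
    (hz : X 2 = 0) (hxy : X 0 = 0 ∨ X 1 = 0) : IsTranslate β p q := by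
  have hX0 : X ≠ 0 := by rintro rfl; exact hX.ne_zero (Matrix.mulVec_zero _)
  obtain ⟨h1, h2, h3⟩ := h
  rw [hz, zero_mul] at h1 h2
  rw [h1] at h3
  have hpt : ∀ {s t : zeroLocus f} {i : Fin 3} {Z : Fin 3 → k}, Represents (M.mulVec Z) s.1 →
      Represents (M.mulVec (Pi.single i 1)) t.1 → Z = Z i • Pi.single i 1 → s = t := by
    intro s t i Z hs ht h
    refine Subtype.ext ((hs.eq_iff ht).2 ⟨Z i, ?_⟩)
    rw [← Matrix.mulVec_smul, ← h]
  rcases hxy with hx | hy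
  · have hy : X 1 ≠ 0 := fun hy => hX0 (by funext i; fin_cases i <;> assumption)
    have hy' := (mul_eq_zero.1 h2).resolve_left hy
    have hz' : Y 2 = 0 := by simpa [hx, hz, hb, hy] using h3
    have := hpt hX hq₀ (eq_single_of_apply_eq_zero hx hz (by decide) (by decide) (by decide))
    subst this
    have := hpt hY hp₀ (eq_single_of_apply_eq_zero hy' hz' (by decide) (by decide) (by decide))
    subst this
    exact h₀.symm hβ2
  · have hx : X 0 ≠ 0 := fun hx => hX0 (by funext i; fin_cases i <;> assumption)
    have hx' := (mul_eq_zero.1 h1).resolve_left hx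
    have hz' : Y 2 = 0 := by simpa [hy, hz, ha, hx] using h3
    have := hpt hX hp₀ (eq_single_of_apply_eq_zero hy hz (by decide) (by decide) (by decide))
    subst this
    have := hpt hY hq₀ (eq_single_of_apply_eq_zero hx' hz' (by decide) (by decide) (by decide))
    subst this
    exact h₀

/-- The curve `f = 0` with the translation by `β`, in coordinates given by the matrix `M`. -/
structure IsNormalForm (β : Pic f) (M : Matrix (Fin 3) (Fin 3) k) (a b e : k) : Prop where
  isUnit_det : IsUnit M.det
  a_ne_zero : a ≠ 0
  b_ne_zero : b ≠ 0
  eval_eq : ∀ X, eval (M.mulVec X) f = chordCubic a b e X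
  isTranslate_iff : ∀ (p q : zeroLocus f) (X Y : Fin 3 → k), Represents (M.mulVec X) p.1 →
    Represents (M.mulVec Y) q.1 → (IsTranslate β p q ↔ Conjugate a b e X Y)

theorem mulVec_ne_zero (hM : IsUnit M.det) {X : Fin 3 → k} (hX : X ≠ 0) : M.mulVec X ≠ 0 := by
  rw [← Matrix.mulVec_zero M]
  exact (Matrix.mulVec_injective_of_isUnit ((Matrix.isUnit_iff_isUnit_det M).2 hM)).ne hX

theorem exists_mulVec_eq (hM : IsUnit M.det) (v : Fin 3 → k) : ∃ X, M.mulVec X = v :=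
  ⟨M⁻¹.mulVec v, by rw [Matrix.mulVec_mulVec, Matrix.mul_nonsing_inv _ hM, Matrix.one_mulVec]⟩

variable [IsAlgClosed k]

theorem IsLineSection.of_translate (hf : IsSmoothCubic f) (hβ2 : 2 • β = 0) {p q r : zeroLocus f}
    {w : Fin 3 → k} (h : IsTranslate β p q) (hr : IsLineSection p p r w) :
    ∃ w', IsLineSection q q r w' := by
  obtain ⟨s, w', hs⟩ := hf.exists_third_point q q
  have h1 := hf.line_section_class hr hs
  have h4 := (two_nsmul β).symm.trans hβ2
  have h2 : r = s := by
    refine hf.pointClass_injective ?_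
    rw [← sub_eq_zero] at h1 ⊢
    rw [IsTranslate] at h
    rw [← h1, h, show (pointClass p + pointClass p + pointClass r - (pointClass p + β +
      (pointClass p + β) + pointClass s) : Pic f) = pointClass r - pointClass s - (β + β) by abel,
      h4, sub_zero]
  exact ⟨w', h2 ▸ hs⟩

/-- Were the points collinear, `p + q + r` and `2p + r` would both be line sections, whence `p = q`.
-/
theorem IsSmoothCubic.cross_dotProduct_ne_zero (hf : IsSmoothCubic f) (hβ : β ≠ 0)
    {p q r : zeroLocus f} {w : Fin 3 → k} (h : IsTranslate β p q) (hr : IsLineSection p p r w)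
    (hrp : r ≠ p) (hrq : r ≠ q) : crossProduct p.1.rep q.1.rep ⬝ᵥ r.1.rep ≠ 0 := by
  intro h0
  have hpq := h.ne hβ
  obtain ⟨s, -, hs⟩ := hf.third_point_chord (represents_rep p.1) (represents_rep q.1) hpq
  have hrs : r = s := by
    by_contra hrs
    have h1 := hs.2 r
    rw [if_neg hrp, if_neg hrq, if_neg hrs,
      hf.ord_eq_zero_iff r (isHomogeneous_lin _) (hf.lin_notMem hs.1), eval_lin] at h1
    exact h1 h0
  subst hrs
  have := hf.line_section_class hr hs
  exact hpq (hf.pointClass_injective (add_left_cancel (add_right_cancel this)))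

theorem IsSmoothCubic.grad_dotProduct_ne_zero (hf : IsSmoothCubic f) {P R : Fin 3 → k}
    (hPR : crossProduct P R ≠ 0) (hP : eval P f = 0) (hR : eval R f = 0)
    (h : grad f P ⬝ᵥ R = 0) : grad f R ⬝ᵥ P ≠ 0 := by
  intro h0
  obtain ⟨v, hv, hv0⟩ := hf.exists_eval_ne_zero hPR
  obtain ⟨x, z, rfl⟩ := exists_combination_of_cross hPR hv
  rw [eval_line hf.homogeneous, hP, hR, h, h0] at hv0
  simp at hv0

/-- A smooth cubic can be brought into a normal form adapted to a translation of order two. -/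
theorem IsSmoothCubic.exists_normal_form (hk : (2 : k) ≠ 0) (hf : IsSmoothCubic f) (hβ : β ≠ 0)
    (hβ2 : 2 • β = 0) : ∃ (M : Matrix (Fin 3) (Fin 3) k) (a b e : k) (p q : zeroLocus f),
      IsUnit M.det ∧ a ≠ 0 ∧ b ≠ 0 ∧ (∀ X, eval (M.mulVec X) f = chordCubic a b e X) ∧
      IsTranslate β p q ∧ Represents (M.mulVec (Pi.single 0 1)) p.1 ∧
      Represents (M.mulVec (Pi.single 1 1)) q.1 := by
  obtain ⟨p, q, r, w, hpq, hr, hrp, hrq⟩ := hf.exists_good_point hk hβ hβ2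
  obtain ⟨w', hr'⟩ := hr.of_translate hf hβ2 hpq
  have hdet := hf.cross_dotProduct_ne_zero hβ hpq hr hrp hrq
  have hPR := hf.grad_dotProduct_of_tangent hr
  have hQR := hf.grad_dotProduct_of_tangent hr'
  have hP := represents_rep p.1
  have hQ := represents_rep q.1
  have hR := represents_rep r.1
  have hPf : eval p.1.rep f = 0 := p.2
  have hQf : eval q.1.rep f = 0 := q.2
  have hRf : eval r.1.rep f = 0 := r.2
  have hPRc := cross_ne_zero_of_ne hP hR fun h => hrp (Subtype.ext h).symm
  have hQRc := cross_ne_zero_of_ne hQ hR fun h => hrq (Subtype.ext h).symm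
  generalize p.1.rep = P at *
  generalize q.1.rep = Q at *
  generalize r.1.rep = R at *
  have ha : grad f P ⬝ᵥ Q ≠ 0 := fun h => hf.grad_ne_zero hP.ne_zero hPf
    (eq_zero_of_dotProduct_eq_zero hdet (by rw [grad_dotProduct_self hf.homogeneous, hPf, mul_zero])
      h hPR)
  have hb : grad f Q ⬝ᵥ P ≠ 0 := fun h => hf.grad_ne_zero hQ.ne_zero hQf
    (eq_zero_of_dotProduct_eq_zero hdet h
      (by rw [grad_dotProduct_self hf.homogeneous, hQf, mul_zero]) hQR)
  have hc := hf.grad_dotProduct_ne_zero hPRc hPf hRf hPR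
  have hd := hf.grad_dotProduct_ne_zero hQRc hQf hRf hQR
  obtain ⟨e, he⟩ := hf.eval_basis hPf hQf hRf hPR hQR
  generalize grad f P ⬝ᵥ Q = a at *
  generalize grad f Q ⬝ᵥ P = b at *
  generalize grad f R ⬝ᵥ P = c at *
  generalize grad f R ⬝ᵥ Q = d at *
  -- Scaling `P` by `α` and `Q` by `η` makes the coefficients of `x² y` and `y z²` equal, and
  -- likewise those of `x y²` and `x z²`.
  obtain ⟨α, hα⟩ := IsAlgClosed.exists_pow_nat_eq (d / a) two_pos
  obtain ⟨η, hη⟩ := IsAlgClosed.exists_pow_nat_eq (c / b) two_pos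
  have hα0 : α ≠ 0 := by rintro rfl; exact div_ne_zero hd ha (by rw [← hα]; ring)
  have hη0 : η ≠ 0 := by rintro rfl; exact div_ne_zero hc hb (by rw [← hη]; ring)
  rw [eq_div_iff ha] at hα
  rw [eq_div_iff hb] at hη
  have hM : ∀ X : Fin 3 → k, (Matrix.of ![α • P, η • Q, R]).transpose.mulVec X =
      (X 0 * α) • P + ((X 1 * η) • Q + X 2 • R) := by
    intro X
    funext i
    simp [Matrix.mulVec, dotProduct, Fin.sum_univ_three]
    ring
  refine ⟨(Matrix.of ![α • P, η • Q, R]).transpose, d * η, c * α, e * α * η, p, q, ?_,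
    mul_ne_zero hd hη0, mul_ne_zero hc hα0, ?_, hpq, ?_, ?_⟩
  · rw [isUnit_iff_ne_zero, Matrix.det_transpose]
    have : (Matrix.of ![α • P, η • Q, R]).det = α * η * (crossProduct P Q ⬝ᵥ R) := by
      rw [cross_apply]
      simp [Matrix.det_fin_three, dotProduct, Fin.sum_univ_three]
      ring
    rw [this]
    exact mul_ne_zero (mul_ne_zero hα0 hη0) hdet
  · intro X
    rw [hM, he, chordCubic]
    linear_combination X 0 ^ 2 * X 1 * η * hα + X 0 * X 1 ^ 2 * α * hη
  · rw [hM]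
    simpa using hP.smul hα0
  · rw [hM]
    simpa using hQ.smul hη0

theorem isTranslate_of_conjugate (hk : (2 : k) ≠ 0) (hf : IsSmoothCubic f) (hβ2 : 2 • β = 0)
    {p₀ q₀ : zeroLocus f} (hM : IsUnit M.det)
    (hMf : ∀ X, eval (M.mulVec X) f = chordCubic a b e X)
    (h₀ : IsTranslate β p₀ q₀) (hp₀ : Represents (M.mulVec (Pi.single 0 1)) p₀.1)
    (hq₀ : Represents (M.mulVec (Pi.single 1 1)) q₀.1) (ha : a ≠ 0) (hb : b ≠ 0)
    {p q : zeroLocus f} {X Y : Fin 3 → k} (hX : Represents (M.mulVec X) p.1)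
    (hY : Represents (M.mulVec Y) q.1) (h : Conjugate a b e X Y) : IsTranslate β p q := by
  by_cases hXs : X 2 = 0 ∧ (X 0 = 0 ∨ X 1 = 0)
  · exact isTranslate_of_conjugate_single hβ2 h₀ hp₀ hq₀ ha hb hX hY h hXs.1 hXs.2
  by_cases hYs : Y 2 = 0 ∧ (Y 0 = 0 ∨ Y 1 = 0)
  · exact (isTranslate_of_conjugate_single hβ2 h₀ hp₀ hq₀ ha hb hY hX h.symm hYs.1 hYs.2).symm hβ2
  have hXf : chordCubic a b e X = 0 := by
    rw [← hMf]; exact (hX.eval_eq_zero_iff hf.homogeneous).2 p.2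
  have hYf : chordCubic a b e Y = 0 := by
    rw [← hMf]; exact (hY.eval_eq_zero_iff hf.homogeneous).2 q.2
  have hinj : ∀ {s t : zeroLocus f} {i : Fin 3} {Z : Fin 3 → k}, Represents (M.mulVec Z) s.1 →
      Represents (M.mulVec (Pi.single i 1)) t.1 → (∀ c : k, Z ≠ c • Pi.single i 1) → s ≠ t := by
    rintro s t i Z hs ht hZ rfl
    obtain ⟨c, hc⟩ := (hs.eq_iff ht).1 rfl
    rw [← Matrix.mulVec_smul] at hc
    exact hZ c (Matrix.mulVec_injective_of_isUnit ((Matrix.isUnit_iff_isUnit_det M).2 hM) hc)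
  have hpq₀ : p ≠ q₀ := hinj hX hq₀ fun c hc => hXs ⟨by simp [hc], Or.inl (by simp [hc])⟩
  have hqp₀ : q ≠ p₀ := hinj hY hp₀ fun c hc => hYs ⟨by simp [hc], Or.inr (by simp [hc])⟩
  obtain ⟨r, hr, hrs⟩ := hf.third_point_chord hX hq₀ hpq₀
  obtain ⟨r', hr', hrs'⟩ := hf.third_point_chord hY hp₀ hqp₀
  obtain ⟨hg1, hg2⟩ := third_point_coordinates hk hf (by rw [hMf, hXf])
    ((hq₀.eval_eq_zero_iff hf.homogeneous).2 q₀.2)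
    (A := a * (X 0 ^ 2 + X 2 ^ 2) + 2 * b * X 0 * X 1 + e * X 0 * X 2) (B := b * X 0) fun t => by
      rw [← Matrix.mulVec_smul, ← Matrix.mulVec_add, hMf]
      simp only [chordCubic] at hXf ⊢
      simp
      linear_combination hXf
  obtain ⟨hg1', hg2'⟩ := third_point_coordinates hk hf (by rw [hMf, hYf])
    ((hp₀.eval_eq_zero_iff hf.homogeneous).2 p₀.2)
    (A := b * (Y 1 ^ 2 + Y 2 ^ 2) + 2 * a * Y 0 * Y 1 + e * Y 1 * Y 2) (B := a * Y 1) fun t => by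
      rw [← Matrix.mulVec_smul, ← Matrix.mulVec_add, hMf]
      simp only [chordCubic] at hYf ⊢
      simp
      linear_combination hYf
  rw [hg1, hg2, ← Matrix.mulVec_smul, ← Matrix.mulVec_smul, ← Matrix.mulVec_sub] at hr
  rw [hg1', hg2', ← Matrix.mulVec_smul, ← Matrix.mulVec_smul, ← Matrix.mulVec_sub] at hr'
  obtain ⟨h1, h2, h3⟩ := h
  -- These are the chords joining `X` to `q₀ = (0, 1, 0)` and `Y` to `p₀ = (1, 0, 0)`. They are
  -- distinct, and both third points turn out to be their intersection.
  have hl : crossProduct ![X 2, 0, -X 0] ![0, Y 2, -Y 1] ≠ 0 := by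
    intro h0
    have e0 := congrFun h0 0
    have e1 := congrFun h0 1
    have e2 := congrFun h0 2
    simp [cross_apply] at e0 e1 e2
    grind
  have hr0 : ((a * Y 1) • Y - (b * (Y 1 ^ 2 + Y 2 ^ 2) + 2 * a * Y 0 * Y 1 + e * Y 1 * Y 2) •
      Pi.single 0 1 : Fin 3 → k) ≠ 0 := by
    intro h0
    rw [h0] at hr'
    exact hr'.ne_zero (Matrix.mulVec_zero _)
  obtain ⟨c, hc⟩ := eq_smul_of_orthogonal hl hr0
    (m := (b * X 0) • X - (a * (X 0 ^ 2 + X 2 ^ 2) + 2 * b * X 0 * X 1 + e * X 0 * X 2) •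
      Pi.single 1 1)
    (by simp [dotProduct, Fin.sum_univ_three]; ring)
    (by simp [dotProduct, Fin.sum_univ_three]
        linear_combination -X 0 * h3 + (a * X 2 + e * X 0) * h1)
    (by simp [dotProduct, Fin.sum_univ_three]
        linear_combination -Y 1 * h3 + b * Y 2 * h2 + e * Y 1 * h1)
    (by simp [dotProduct, Fin.sum_univ_three]; ring)
  have hrr : r = r' := Subtype.ext ((hr.eq_iff hr').2 ⟨c, by rw [hc, Matrix.mulVec_smul]⟩)
  subst hrr
  -- With a common third point, `p + q₀ = q + p₀`, so `q - p = q₀ - p₀ = β`.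
  have hcl := hf.line_section_class hrs hrs'
  rw [IsTranslate] at h₀ ⊢
  rw [← sub_eq_zero] at hcl ⊢
  have h4 := (two_nsmul β).symm.trans hβ2
  rw [h₀] at hcl
  rw [← neg_eq_zero, ← hcl]
  abel

theorem IsSmoothCubic.exists_isNormalForm (hk : (2 : k) ≠ 0) (hf : IsSmoothCubic f) (hβ : β ≠ 0)
    (hβ2 : 2 • β = 0) : ∃ (M : Matrix (Fin 3) (Fin 3) k) (a b e : k), IsNormalForm β M a b e := by
  obtain ⟨M, a, b, e, p₀, q₀, hM, ha, hb, hMf, h₀, hp₀, hq₀⟩ := hf.exists_normal_form hk hβ hβ2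
  refine ⟨M, a, b, e, hM, ha, hb, hMf, fun p q X Y hX hY => ⟨fun h => ?_,
    isTranslate_of_conjugate hk hf hβ2 hM hMf h₀ hp₀ hq₀ ha hb hX hY⟩⟩
  have hXf : chordCubic a b e X = 0 := by
    rw [← hMf]; exact (hX.eval_eq_zero_iff hf.homogeneous).2 p.2
  have hX0 : X ≠ 0 := by rintro rfl; exact hX.ne_zero (Matrix.mulVec_zero _)
  -- For the converse, a conjugate of `X` exists and represents a translate of `p`; uniqueness of
  -- the translate identifies it with `Y` up to a scalar.
  obtain ⟨Z, hZ, hXZ⟩ := exists_conjugate hXf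
  obtain ⟨q', hq'⟩ := exists_point hf.homogeneous (mulVec_ne_zero hM hZ)
    (by rw [hMf, hXZ.symm.chordCubic_eq_zero hX0])
  have := (hf.existsUnique_translate hβ2 p).unique h
    (isTranslate_of_conjugate hk hf hβ2 hM hMf h₀ hp₀ hq₀ ha hb hX hq' hXZ)
  subst this
  obtain ⟨c, hc⟩ := (hY.eq_iff hq').1 rfl
  rw [← Matrix.mulVec_smul] at hc
  rw [Matrix.mulVec_injective_of_isUnit ((Matrix.isUnit_iff_isUnit_det M).2 hM) hc]
  exact hXZ.smul_right c

end NormalForm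

/-! ### Apolar symmetric matrices and the lines containing a conjugate pair. -/

section Cayleyan

/-- The matrix of the linear map `n ↦ S(n) U`, where `S(n)` runs through the symmetric matrices
that are apolar to the conics `x² = z²`, `y² = z²`, `2 a x z + 2 b y z + e x² = 0`. -/
def apolarMatrix {R : Type*} [CommRing R] (a b e : R) (U : Fin 3 → R) : Matrix (Fin 3) (Fin 3) R :=
  !![2 * a * U 0 - e * U 2, U 1, -b * U 2; 2 * a * U 1, U 0, a * U 2;
    2 * a * U 2 - e * U 0, 0, a * U 1 - b * U 0]

/-- A parametrization of the symmetric matrices that are apolar to the conics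
`x² = z²`, `y² = z²`, `2 a x z + 2 b y z + e x² = 0`. -/
def apolarTensor {R : Type*} [CommRing R] (a b e : R) (n : Fin 3 → R) : Matrix (Fin 3) (Fin 3) R :=
  !![2 * a * n 0, n 1, -(b * n 2 + e * n 0); n 1, 2 * a * n 0, a * n 2;
    -(b * n 2 + e * n 0), a * n 2, 2 * a * n 0]

variable {k : Type*} [Field k] {a b e : k}

theorem apolarMatrix_mulVec (U n : Fin 3 → k) :
    (apolarMatrix a b e U).mulVec n = (apolarTensor a b e n).mulVec U := by
  funext i
  fin_cases i <;> simp [apolarMatrix, apolarTensor, Matrix.mulVec, dotProduct,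
    Fin.sum_univ_three] <;> ring

theorem apolarTensor_symm (n : Fin 3 → k) (i j : Fin 3) :
    apolarTensor a b e n i j = apolarTensor a b e n j i := by
  fin_cases i <;> fin_cases j <;> rfl

theorem apolarTensor_combination (x y : k) (m n : Fin 3 → k) :
    apolarTensor a b e (x • m + y • n) = x • apolarTensor a b e m + y • apolarTensor a b e n := by
  ext i j
  fin_cases i <;> fin_cases j <;> simp [apolarTensor] <;> ring

theorem eq_zero_of_apolarTensor_eq_zero (hk : (2 : k) ≠ 0) (ha : a ≠ 0) {n : Fin 3 → k}
    (h : apolarTensor a b e n = 0) : n = 0 := by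
  have h0 := congrFun (congrFun h 0) 0
  have h1 := congrFun (congrFun h 0) 1
  have h2 := congrFun (congrFun h 1) 2
  simp [apolarTensor, hk, ha] at h0 h1 h2
  funext i
  fin_cases i <;> assumption

/-- The parameter of the symmetric matrix `a (X Yᵀ + Y Xᵀ)`. -/
def pairTensor (a : k) (X Y : Fin 3 → k) : Fin 3 → k :=
  ![X 0 * Y 0, a * (X 0 * Y 1 + X 1 * Y 0), X 1 * Y 2 + X 2 * Y 1]

theorem Conjugate.apolarTensor_pairTensor {X Y : Fin 3 → k} (h : Conjugate a b e X Y)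
    (i j : Fin 3) : apolarTensor a b e (pairTensor a X Y) i j = a * (X i * Y j + X j * Y i) := by
  obtain ⟨h1, h2, h3⟩ := h
  fin_cases i <;> fin_cases j <;> simp [apolarTensor, pairTensor] <;> grind

/-- Apolarity of `X Yᵀ + Y Xᵀ` to a conic is twice the conjugacy of `X` and `Y`. -/
theorem conjugate_of_apolarTensor (hk : (2 : k) ≠ 0) {n X Y : Fin 3 → k}
    (h : ∀ i j, apolarTensor a b e n i j = X i * Y j + X j * Y i) : Conjugate a b e X Y := by
  have h00 := h 0 0
  have h11 := h 1 1
  have h22 := h 2 2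
  have h02 := h 0 2
  have h12 := h 1 2
  simp [apolarTensor] at h00 h11 h22 h02 h12
  refine ⟨mul_left_cancel₀ hk ?_, mul_left_cancel₀ hk ?_, mul_left_cancel₀ hk ?_⟩
  · linear_combination h22 - h00
  · linear_combination h22 - h11
  · linear_combination -2 * a * h02 - 2 * b * h12 - e * h00

theorem pairTensor_ne_zero (hk : (2 : k) ≠ 0) (ha : a ≠ 0) {X Y : Fin 3 → k} (hX : X ≠ 0)
    (hY : Y ≠ 0) (h : Conjugate a b e X Y) : pairTensor a X Y ≠ 0 := by
  intro h0
  have key : ∀ i j, X i * Y j + X j * Y i = 0 := by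
    intro i j
    have := h.apolarTensor_pairTensor i j
    rw [h0, show apolarTensor a b e 0 i j = 0 by
      fin_cases i <;> fin_cases j <;> simp [apolarTensor]] at this
    exact (mul_eq_zero.1 this.symm).resolve_left ha
  obtain ⟨i, hi⟩ := Function.ne_iff.1 hX
  simp only [Pi.zero_apply] at hi
  have hYi : Y i = 0 := by
    have := key i i
    rw [← two_mul, mul_eq_zero, or_iff_right hk, mul_eq_zero, or_iff_right hi] at this
    exact this
  refine hY (funext fun j => ?_)
  have := key i j
  rw [hYi, mul_zero, add_zero, mul_eq_zero, or_iff_right hi] at this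
  exact this

theorem Conjugate.apolarMatrix_mulVec_pairTensor {X Y U : Fin 3 → k} (h : Conjugate a b e X Y)
    (hX : U ⬝ᵥ X = 0) (hY : U ⬝ᵥ Y = 0) : (apolarMatrix a b e U).mulVec (pairTensor a X Y) = 0 := by
  rw [apolarMatrix_mulVec]
  funext i
  simp only [dotProduct, Fin.sum_univ_three] at hX hY
  simp only [Matrix.mulVec, dotProduct, Fin.sum_univ_three, h.apolarTensor_pairTensor, Pi.zero_apply]
  linear_combination a * Y i * hX + a * X i * hY

theorem exists_orthogonal_basis {U : Fin 3 → k} (hU : U ≠ 0) : ∃ A B : Fin 3 → k, U ⬝ᵥ A = 0 ∧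
    U ⬝ᵥ B = 0 ∧ crossProduct A B ≠ 0 ∧ ∃ c : k, c ≠ 0 ∧ crossProduct A B = c • U := by
  obtain ⟨A, B, hA, hB, hAB⟩ := exists_orthogonal_pair U
  have hB0 : B ≠ 0 := by
    rintro rfl
    have := hAB 0 1 (by simp)
    simp at this
  have hcr : crossProduct A B ≠ 0 := by
    intro h
    obtain ⟨c, rfl⟩ := (cross_eq_zero_iff hB0).1 h
    have := hAB 1 (-c) (by simp)
    simp at this
  obtain ⟨c, rfl⟩ := eq_smul_cross hcr hA hB
  have hc := left_ne_zero_of_smul hU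
  exact ⟨A, B, hA, hB, hcr, c⁻¹, inv_ne_zero hc, by rw [smul_smul, inv_mul_cancel₀ hc, one_smul]⟩

/-- A linear form that on the plane `U · x = 0` vanishes on the multiples of `B` only. -/
theorem exists_separating {U B : Fin 3 → k} (hU : U ≠ 0) (hB : B ≠ 0) (hUB : U ⬝ᵥ B = 0) :
    ∃ φ : Fin 3 → k, φ ⬝ᵥ B = 0 ∧ ∀ X, U ⬝ᵥ X = 0 → φ ⬝ᵥ X = 0 → ∃ c : k, X = c • B := by
  obtain ⟨A, hA, hUA⟩ := exists_tangent_vector hB U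
  obtain ⟨ψ, φ, -, -, hφB, hφA⟩ := exists_dual_pair hA
  refine ⟨φ, hφB, fun X hX hφ => ?_⟩
  obtain ⟨c, rfl⟩ := eq_smul_cross hA hUB hUA
  rw [smul_dotProduct, smul_eq_mul, mul_eq_zero, or_iff_right (left_ne_zero_of_smul hU)] at hX
  obtain ⟨x, y, rfl⟩ := exists_combination_of_cross hA hX
  rw [dotProduct_add, dotProduct_smul, dotProduct_smul, hφB, hφA] at hφ
  simp at hφ
  exact ⟨x, by rw [hφ]; simp⟩

variable [IsAlgClosed k]

theorem exists_factor_binary_quadratic (hk : (2 : k) ≠ 0) (p q r : k) : ∃ x₀ x₁ y₀ y₁ : k,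
    p = 2 * x₀ * y₀ ∧ q = x₀ * y₁ + x₁ * y₀ ∧ r = 2 * x₁ * y₁ := by
  by_cases hp : p = 0
  · exact ⟨0, 1, q, r / 2, by simp [hp], by simp, by field_simp⟩
  · obtain ⟨δ, hδ⟩ := IsAlgClosed.exists_pow_nat_eq (q ^ 2 - p * r) two_pos
    refine ⟨1, (q - δ) / p, p / 2, (q + δ) / 2, by field_simp, by field_simp; ring, ?_⟩
    field_simp
    linear_combination hδ

/-- A symmetric matrix of size three with a nontrivial kernel is a sum `X Yᵀ + Y Xᵀ`. -/
theorem exists_eq_add_of_symm (hk : (2 : k) ≠ 0) {S : Matrix (Fin 3) (Fin 3) k}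
    (hS : ∀ i j, S i j = S j i) {U : Fin 3 → k} (hU : U ≠ 0) (h : S.mulVec U = 0) :
    ∃ X Y : Fin 3 → k, U ⬝ᵥ X = 0 ∧ U ⬝ᵥ Y = 0 ∧ ∀ i j, S i j = X i * Y j + X j * Y i := by
  obtain ⟨A, B, hA, hB, hcr, c, hc, hAB⟩ := exists_orthogonal_basis hU
  obtain ⟨φ, ψ, hφA, hφB, hψA, hψB⟩ := exists_dual_pair hcr
  have hexp : ∀ x, U ⬝ᵥ x = 0 → x = (φ ⬝ᵥ x) • A + (ψ ⬝ᵥ x) • B := by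
    intro x hx
    obtain ⟨s, t, rfl⟩ := exists_combination_of_cross hcr (x := x) (by
      rw [hAB, smul_dotProduct, hx, smul_zero])
    simp [dotProduct_add, dotProduct_smul, hφA, hφB, hψA, hψB]
  have hSt : S.transpose = S := by ext i j; exact hS j i
  have hrow : ∀ i, S i = (S.mulVec φ i) • A + (S.mulVec ψ i) • B := by
    intro i
    have := hexp (S i) (by rw [dotProduct_comm]; exact congrFun h i)
    rwa [dotProduct_comm φ, dotProduct_comm ψ] at this
  have hUS : ∀ x, U ⬝ᵥ S.mulVec x = 0 := by
    intro x
    rw [Matrix.dotProduct_mulVec, ← Matrix.mulVec_transpose, hSt, h, zero_dotProduct]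
  have hcomm : φ ⬝ᵥ S.mulVec ψ = ψ ⬝ᵥ S.mulVec φ := by
    rw [Matrix.dotProduct_mulVec, ← Matrix.mulVec_transpose, hSt, dotProduct_comm]
  obtain ⟨x₀, x₁, y₀, y₁, hp, hq, hr⟩ := exists_factor_binary_quadratic hk (φ ⬝ᵥ S.mulVec φ)
    (ψ ⬝ᵥ S.mulVec φ) (ψ ⬝ᵥ S.mulVec ψ)
  refine ⟨x₀ • A + x₁ • B, y₀ • A + y₁ • B, ?_, ?_, fun i j => ?_⟩
  · simp [dotProduct_add, dotProduct_smul, hA, hB]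
  · simp [dotProduct_add, dotProduct_smul, hA, hB]
  · have h1 := congrFun (hexp _ (hUS φ)) i
    have h2 := congrFun (hexp _ (hUS ψ)) i
    rw [hrow i]
    rw [hp, hq] at h1
    rw [hcomm, hq, hr] at h2
    simp only [Pi.add_apply, Pi.smul_apply, smul_eq_mul] at h1 h2 ⊢
    rw [h1, h2]
    ring

/-- A kernel vector `n` is an apolar matrix that kills `U`. Such a matrix lives on the line `U`,
where a binary quadratic form splits into two points, and apolarity makes these conjugate. -/
theorem exists_conjugate_of_apolarMatrix (hk : (2 : k) ≠ 0) (ha : a ≠ 0) {U n : Fin 3 → k}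
    (hU : U ≠ 0) (hn : n ≠ 0) (h : (apolarMatrix a b e U).mulVec n = 0) :
    ∃ X Y : Fin 3 → k, X ≠ 0 ∧ Y ≠ 0 ∧ U ⬝ᵥ X = 0 ∧ U ⬝ᵥ Y = 0 ∧ Conjugate a b e X Y ∧
      ∀ i j, apolarTensor a b e n i j = X i * Y j + X j * Y i := by
  rw [apolarMatrix_mulVec] at h
  obtain ⟨X, Y, hX, hY, hXY⟩ := exists_eq_add_of_symm hk (apolarTensor_symm n) hU h
  refine ⟨X, Y, ?_, ?_, hX, hY, conjugate_of_apolarTensor hk hXY, hXY⟩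
  · rintro rfl
    exact hn (eq_zero_of_apolarTensor_eq_zero (b := b) (e := e) hk ha (by ext i j; simp [hXY]))
  · rintro rfl
    exact hn (eq_zero_of_apolarTensor_eq_zero (b := b) (e := e) hk ha (by ext i j; simp [hXY]))

/-- The kernel of `apolarMatrix a b e U` has dimension at most one. -/
theorem eq_smul_of_apolarMatrix (hk : (2 : k) ≠ 0) (ha : a ≠ 0) {U B : Fin 3 → k} (hU : U ≠ 0)
    (hUB : U ⬝ᵥ B = 0) (hB : chordCubic a b e B ≠ 0) {m n : Fin 3 → k} (hm0 : m ≠ 0)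
    (hm : (apolarMatrix a b e U).mulVec m = 0) (hn : (apolarMatrix a b e U).mulVec n = 0) :
    ∃ c : k, n = c • m := by
  by_contra! hc
  have hB0 : B ≠ 0 := by rintro rfl; simp [chordCubic] at hB
  obtain ⟨φ, hφB, hφ⟩ := exists_separating hU hB0 hUB
  set v : (Fin 3 → k) → k := fun n => φ ⬝ᵥ (apolarTensor a b e n).mulVec φ with hv
  -- If the kernel contained a pencil, some member would have the arbitrary point `B` of the line in
  -- its pair; but members of conjugate pairs lie on the cubic, and `B` does not.
  obtain ⟨x, y, hxy, h0⟩ : ∃ x y : k, (x ≠ 0 ∨ y ≠ 0) ∧ x * v m + y * v n = 0 := by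
    by_cases h : v m = 0
    · exact ⟨1, 0, by simp, by simp [h]⟩
    · exact ⟨v n, -v m, Or.inr (neg_ne_zero.2 h), by ring⟩
  have hne : x • m + y • n ≠ 0 := by
    intro h
    by_cases hy : y = 0
    · subst hy
      simp [hm0] at h hxy
      exact hxy h
    · refine hc (-(y⁻¹ * x)) ?_
      rw [neg_smul, mul_smul, eq_neg_iff_add_eq_zero.2 h, smul_neg, neg_neg, smul_smul,
        inv_mul_cancel₀ hy, one_smul]
  obtain ⟨X, Y, hX0, hY0, hX, hY, hXY, hS⟩ := exists_conjugate_of_apolarMatrix hk ha hU hne (by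
    rw [Matrix.mulVec_add, Matrix.mulVec_smul, Matrix.mulVec_smul, hm, hn]; simp)
  have hvS : v (x • m + y • n) = 2 * (φ ⬝ᵥ X) * (φ ⬝ᵥ Y) := by
    simp only [hv, Matrix.mulVec, dotProduct, Fin.sum_univ_three, hS]
    ring
  have hv0 : v (x • m + y • n) = 0 := by
    rw [← h0]
    simp only [hv, apolarTensor_combination, Matrix.add_mulVec, Matrix.smul_mulVec, dotProduct_add,
      dotProduct_smul, smul_eq_mul]
  have key : ∀ X Y : Fin 3 → k, X ≠ 0 → Y ≠ 0 → U ⬝ᵥ X = 0 → Conjugate a b e X Y → φ ⬝ᵥ X ≠ 0 := by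
    intro X Y hX0 hY0 hX hXY h
    obtain ⟨c, rfl⟩ := hφ X hX h
    refine hB ?_
    have hc0 := left_ne_zero_of_smul hX0
    have := (hXY.symm.smul_right c⁻¹).symm
    rw [smul_smul, inv_mul_cancel₀ hc0, one_smul] at this
    exact this.chordCubic_eq_zero hY0
  rw [hvS] at hv0
  exact mul_ne_zero (mul_ne_zero hk (key X Y hX0 hY0 hX hXY)) (key Y X hY0 hX0 hY hXY.symm) hv0

/-- A line contains at most one conjugate pair. -/
theorem Conjugate.eq_or_eq (hk : (2 : k) ≠ 0) (ha : a ≠ 0) {U B X Y X' Y' : Fin 3 → k} (hU : U ≠ 0)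
    (hUB : U ⬝ᵥ B = 0) (hB : chordCubic a b e B ≠ 0) (h : Conjugate a b e X Y)
    (h' : Conjugate a b e X' Y') (hX'0 : X' ≠ 0) (hY'0 : Y' ≠ 0)
    (hX : U ⬝ᵥ X = 0) (hY : U ⬝ᵥ Y = 0) (hX' : U ⬝ᵥ X' = 0) (hY' : U ⬝ᵥ Y' = 0) :
    (∃ c : k, X = c • X') ∨ ∃ c : k, Y = c • X' := by
  obtain ⟨c, hc⟩ := eq_smul_of_apolarMatrix hk ha hU hUB hB (pairTensor_ne_zero hk ha hX'0 hY'0 h')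
    (h'.apolarMatrix_mulVec_pairTensor hX' hY') (h.apolarMatrix_mulVec_pairTensor hX hY)
  obtain ⟨φ, hφX', hφ⟩ := exists_separating hU hX'0 hX'
  -- The two pair matrices are proportional. Evaluating them at a form `φ` that vanishes at `X'`
  -- gives `φ(X) φ(Y) = 0`, so one of the points is `X'`.
  have key : ∀ {X Y : Fin 3 → k}, Conjugate a b e X Y →
      φ ⬝ᵥ (apolarTensor a b e (pairTensor a X Y)).mulVec φ = 2 * a * (φ ⬝ᵥ X) * (φ ⬝ᵥ Y) := by
    intro X Y h
    simp only [Matrix.mulVec, dotProduct, Fin.sum_univ_three, h.apolarTensor_pairTensor]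
    ring
  have h1 := key h
  have h2 := apolarTensor_combination (a := a) (b := b) (e := e) c 0 (pairTensor a X' Y') 0
  rw [zero_smul, zero_smul, add_zero, add_zero, ← hc] at h2
  rw [h2, Matrix.smul_mulVec, dotProduct_smul, key h', hφX'] at h1
  simp [hk, ha] at h1
  rcases h1 with h1 | h1
  · exact Or.inl (hφ X hX h1)
  · exact Or.inr (hφ Y hY h1)

end Cayleyan

/-! ### The chord map: existence, injectivity, image and irreducibility of the dual cubic. -/

section ChordMap

open scoped Matrix

variable {k : Type*} [Field k]

/-- The cubic form on the dual plane that vanishes at the chords. -/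
noncomputable def cayleyan (M : Matrix (Fin 3) (Fin 3) k) (a b e : k) : CoordRing k :=
  (apolarMatrix (C a) (C b) (C e) fun j => lin fun i => M i j).det

variable {a b e : k} {M : Matrix (Fin 3) (Fin 3) k}

theorem eval_apolarMatrix (M : Matrix (Fin 3) (Fin 3) k) (u : Fin 3 → k) (i j : Fin 3) :
    eval u (apolarMatrix (C a) (C b) (C e) (fun j => lin fun i => M i j) i j) =
      apolarMatrix a b e (u ᵥ* M) i j := by
  have h : ∀ j, (fun i => M i j) ⬝ᵥ u = (u ᵥ* M) j := fun j => dotProduct_comm _ _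
  fin_cases i <;> fin_cases j <;> simp [apolarMatrix, eval_lin, h]

theorem eval_cayleyan (u : Fin 3 → k) :
    eval u (cayleyan M a b e) = (apolarMatrix a b e (u ᵥ* M)).det := by
  rw [cayleyan, RingHom.map_det]
  congr 1
  ext i j
  exact eval_apolarMatrix M u i j

theorem isHomogeneous_apolarMatrix (M : Matrix (Fin 3) (Fin 3) k) (i j : Fin 3) :
    (apolarMatrix (C a) (C b) (C e) (fun j => lin fun i => M i j) i j).IsHomogeneous 1 := by
  have h : ∀ s j, (C s * lin fun i => M i j).IsHomogeneous 1 :=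
    fun s j => (isHomogeneous_lin _).C_mul s
  have h2 : (2 : CoordRing k) = C 2 := (map_ofNat C 2).symm
  fin_cases i <;> fin_cases j <;> simp [apolarMatrix, h2, ← C_mul, -map_mul]
  · exact (h _ 0).sub (h _ 2)
  · exact isHomogeneous_lin _
  · exact (h _ 2).neg
  · exact h _ 1
  · exact isHomogeneous_lin _
  · exact h _ 2
  · exact (h _ 2).sub (h _ 0)
  · exact isHomogeneous_zero _ _ _
  · exact (h _ 1).sub (h _ 0)

theorem isHomogeneous_cayleyan : (cayleyan M a b e).IsHomogeneous 3 := by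
  have h := isHomogeneous_apolarMatrix (a := a) (b := b) (e := e) M
  have h3 : ∀ i j i' j' i'' j'', _ := fun i j i' j' i'' j'' =>
    ((h i j).mul (h i' j')).mul (h i'' j'')
  rw [cayleyan, Matrix.det_fin_three]
  exact (((((h3 _ _ _ _ _ _).sub (h3 _ _ _ _ _ _)).sub (h3 _ _ _ _ _ _)).add
    (h3 _ _ _ _ _ _)).add (h3 _ _ _ _ _ _)).sub (h3 _ _ _ _ _ _)

theorem exists_vecMul_eq (hM : IsUnit M.det) (U : Fin 3 → k) : ∃ u, u ᵥ* M = U :=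
  ⟨U ᵥ* M⁻¹, by rw [Matrix.vecMul_vecMul, Matrix.nonsing_inv_mul _ hM, Matrix.vecMul_one]⟩

theorem vecMul_ne_zero (hM : IsUnit M.det) {u : Fin 3 → k} (hu : u ≠ 0) : u ᵥ* M ≠ 0 := by
  intro h
  apply hu
  rw [← Matrix.vecMul_one u, ← Matrix.mul_nonsing_inv _ hM, ← Matrix.vecMul_vecMul, h,
    Matrix.zero_vecMul]

theorem cayleyan_ne_zero (hk : (2 : k) ≠ 0) (hM : IsUnit M.det) (ha : a ≠ 0) :
    cayleyan M a b e ≠ 0 := by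
  intro h
  obtain ⟨u, hu⟩ := exists_vecMul_eq hM (Pi.single 1 1)
  have := eval_cayleyan (M := M) (a := a) (b := b) (e := e) u
  rw [h, hu] at this
  simp [apolarMatrix, Matrix.det_fin_three, ha, hk] at this

theorem exists_eq_C_mul {f G : CoordRing k} {d : ℕ} (hf : f.IsHomogeneous d)
    (hG : G.IsHomogeneous d) (h : G ∈ Ideal.span {f}) : ∃ c : k, G = C c * f := by
  obtain ⟨q, rfl⟩ := Ideal.mem_span_singleton'.1 h
  refine ⟨coeff 0 q, ?_⟩
  rw [← homogeneousComponent_zero, ← homogeneousComponent_mul_form q hf, zero_add,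
    homogeneousComponent_of_mem hG, if_pos rfl]

variable {f : CoordRing k} {β : Pic f}

theorem mem_zmultiples_iff (hβ2 : 2 • β = 0) (x : Pic f) :
    x ∈ AddSubgroup.zmultiples β ↔ x = 0 ∨ x = β := by
  constructor
  · rintro ⟨n, rfl⟩
    have h2 : (2 : ℤ) • β = 0 := by rw [← hβ2]; exact natCast_zsmul β 2
    obtain ⟨m, rfl | rfl⟩ := Int.even_or_odd' n
    · exact Or.inl (by simp only [mul_comm 2 m, mul_zsmul, h2, zsmul_zero])
    · exact Or.inr (by simp only [add_zsmul, mul_comm 2 m, mul_zsmul, h2, zsmul_zero, zero_add,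
        one_zsmul])
  · rintro (rfl | rfl)
    · exact zero_mem _
    · exact AddSubgroup.mem_zmultiples _

theorem IsTranslate.proj_eq {p q : zeroLocus f} (h : IsTranslate β p q) : proj β p = proj β q := by
  refine Quotient.sound (s := translateSetoid β) ?_
  change pointClass q - pointClass p ∈ AddSubgroup.zmultiples β
  rw [show pointClass q = pointClass p + β from h, add_sub_cancel_left]
  exact AddSubgroup.mem_zmultiples _

theorem proj_surjective : Function.Surjective (proj β) := Quotient.mk_surjective

theorem Incident.eq_of_ne {p q l m : Plane k} (hpq : p ≠ q) (hpl : Incident p l)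
    (hql : Incident q l) (hpm : Incident p m) (hqm : Incident q m) : l = m :=
  ((represents_rep l).eq_iff (represents_rep m)).2 (eq_smul_of_orthogonal
    (cross_ne_zero_of_ne (represents_rep p) (represents_rep q) hpq) m.rep_nonzero hpl hql hpm hqm)

theorem exists_line {p q : Plane k} (hpq : p ≠ q) : ∃ l, Incident p l ∧ Incident q l := by
  obtain ⟨l, hl⟩ := exists_represents
    (cross_ne_zero_of_ne (represents_rep p) (represents_rep q) hpq)
  have key : ∀ v, crossProduct p.rep q.rep ⬝ᵥ v = 0 → l.rep ⬝ᵥ v = 0 := by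
    intro v hv
    rw [dotProduct_comm] at hv ⊢
    exact hl.dotProduct_eq_zero_iff.1 hv
  exact ⟨l, key _ (by rw [dotProduct_comm, dot_self_cross]),
    key _ (by rw [dotProduct_comm, dot_cross_self])⟩

theorem ne_zero_of_cross {X Y : Fin 3 → k} (h : crossProduct X Y ≠ 0) : X ≠ 0 ∧ Y ≠ 0 :=
  ⟨by rintro rfl; simp at h, by rintro rfl; simp at h⟩

/-- The chord of a conjugate pair is given by cubic forms. -/
theorem Conjugate.exists_eq_smul {X Y : Fin 3 → k} (h : Conjugate a b e X Y) (hY : Y ≠ 0) :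
    ∃ s : k, ![X 0 * (X 1 ^ 2 - X 2 ^ 2), X 1 * (X 2 ^ 2 - X 0 ^ 2), X 2 * (X 0 ^ 2 - X 1 ^ 2)] =
      s • crossProduct X Y := by
  obtain ⟨h1, h2, -⟩ := h
  -- The first two conjugacy conditions make `Y` proportional to the standard quadratic transform of
  -- `X`; where the transform vanishes, the scalar is zero.
  have : crossProduct ![X 1 * X 2, X 0 * X 2, X 0 * X 1] Y = 0 := by
    funext i
    fin_cases i <;> simp [cross_apply]
    · linear_combination -X 0 * h2
    · linear_combination X 1 * h1
    · linear_combination X 2 * (h2 - h1)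
  obtain ⟨s, hs⟩ := (cross_eq_zero_iff hY).1 this
  refine ⟨s, ?_⟩
  rw [← LinearMap.map_smul, ← hs]
  funext i
  fin_cases i <;> simp [cross_apply] <;> ring

theorem eval_coordinate (hM : IsUnit M.det) (X : Fin 3 → k) (j : Fin 3) :
    eval (M.mulVec X) (lin (M⁻¹ j)) = X j := by
  rw [eval_lin]
  change (M⁻¹.mulVec (M.mulVec X)) j = X j
  rw [Matrix.mulVec_mulVec, Matrix.nonsing_inv_mul _ hM, Matrix.one_mulVec]

/-- The cubic form that vanishes at the points of `f = 0` whose chord contains a given point. -/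
theorem exists_chord_form (hM : IsUnit M.det) (w : Fin 3 → k) : ∃ G : CoordRing k,
    G.IsHomogeneous 3 ∧ ∀ X : Fin 3 → k, eval (M.mulVec X) G =
      w ⬝ᵥ ![X 0 * (X 1 ^ 2 - X 2 ^ 2), X 1 * (X 2 ^ 2 - X 0 ^ 2), X 2 * (X 0 ^ 2 - X 1 ^ 2)] := by
  set x : Fin 3 → CoordRing k := fun j => lin (M⁻¹ j) with hx
  have hx1 : ∀ j, (x j).IsHomogeneous 1 := fun j => isHomogeneous_lin _
  have hxe : ∀ j (X : Fin 3 → k), eval (M.mulVec X) (x j) = X j := fun j X => eval_coordinate hM X j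
  have hd : ∀ (s : k) (i j l : Fin 3), (C s * (x i * (x j ^ 2 - x l ^ 2))).IsHomogeneous 3 :=
    fun s i j l => ((hx1 i).mul (((hx1 j).pow 2).sub ((hx1 l).pow 2))).C_mul s
  refine ⟨C (w 0) * (x 0 * (x 1 ^ 2 - x 2 ^ 2)) + C (w 1) * (x 1 * (x 2 ^ 2 - x 0 ^ 2)) +
    C (w 2) * (x 2 * (x 0 ^ 2 - x 1 ^ 2)), ((hd _ _ _ _).add (hd _ _ _ _)).add (hd _ _ _ _), ?_⟩
  intro X
  simp [hxe, dotProduct, Fin.sum_univ_three]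

variable [IsAlgClosed k]

theorem proj_eq_iff (hf : IsSmoothCubic f) (hβ2 : 2 • β = 0) {p q : zeroLocus f} :
    proj β p = proj β q ↔ p = q ∨ IsTranslate β p q := by
  rw [proj, proj, Quotient.eq (r := translateSetoid β)]
  change pointClass q - pointClass p ∈ AddSubgroup.zmultiples β ↔ _
  rw [mem_zmultiples_iff hβ2, sub_eq_zero, hf.pointClass_injective.eq_iff, eq_comm,
    sub_eq_iff_eq_add', IsTranslate]

theorem IsSmoothCubic.existsUnique_isChordMap (hf : IsSmoothCubic f) (hβ : β ≠ 0)
    (hβ2 : 2 • β = 0) : ∃! c : QuotientCurve β → Plane k, IsChordMap β c := by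
  choose t ht using hf.exists_translate hβ2
  have hne : ∀ p, p.1 ≠ (t p).1 := fun p h => (ht p).ne hβ (Subtype.ext h)
  choose l hl hl' using fun p => exists_line (hne p)
  choose s hs using proj_surjective (β := β)
  refine ⟨fun x => l (s x), fun p q hpq => ⟨hpq.ne hβ, ?_⟩, fun c hc => funext fun x => ?_⟩
  · have huniq := (hf.existsUnique_translate hβ2 p).unique hpq (ht p)
    subst huniq
    -- The chosen representative of the class is `p` or `p + β`; in the second case the two
    -- endpoints of the chord are swapped.
    rcases (proj_eq_iff hf hβ2).1 (hs (proj β p)) with h | h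
    · simp only [h]
      exact ⟨hl p, hl' p⟩
    · have h1 : t (s (proj β p)) = p := (hf.existsUnique_translate hβ2 _).unique (ht _) h
      have h2 : t p = s (proj β p) :=
        (hf.existsUnique_translate hβ2 p).unique (ht p) (h.symm hβ2)
      have h3 := hl (s (proj β p))
      have h4 := hl' (s (proj β p))
      rw [h1] at h4
      rw [← h2] at h3 h4
      simp only [← h2]
      exact ⟨h4, h3⟩
  · obtain ⟨-, h1, h2⟩ := hc (s x) (t (s x)) (ht _)
    rw [hs] at h1 h2
    exact Incident.eq_of_ne (hne _) h1 h2 (hl _) (hl' _)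

variable {c : QuotientCurve β → Plane k}

theorem IsNormalForm.exists_pair (hN : IsNormalForm β M a b e) (hf : IsSmoothCubic f)
    (hβ2 : 2 • β = 0) (hc : IsChordMap β c) (p : zeroLocus f) :
    ∃ (q : zeroLocus f) (X Y : Fin 3 → k), IsTranslate β p q ∧ M.mulVec X = p.1.rep ∧
      M.mulVec Y = q.1.rep ∧ Conjugate a b e X Y ∧ crossProduct X Y ≠ 0 ∧
      ((c (proj β p)).rep ᵥ* M) ⬝ᵥ X = 0 ∧ ((c (proj β p)).rep ᵥ* M) ⬝ᵥ Y = 0 := by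
  obtain ⟨q, hq⟩ := hf.exists_translate hβ2 p
  obtain ⟨X, hX⟩ := exists_mulVec_eq hN.isUnit_det p.1.rep
  obtain ⟨Y, hY⟩ := exists_mulVec_eq hN.isUnit_det q.1.rep
  have hXp : Represents (M.mulVec X) p.1 := by rw [hX]; exact represents_rep _
  have hYq : Represents (M.mulVec Y) q.1 := by rw [hY]; exact represents_rep _
  obtain ⟨hne, h1, h2⟩ := hc p q hq
  refine ⟨q, X, Y, hq, hX, hY, (hN.isTranslate_iff p q X Y hXp hYq).1 hq, ?_, ?_, ?_⟩
  · have hY0 : Y ≠ 0 := by rintro rfl; exact hYq.ne_zero (Matrix.mulVec_zero _)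
    intro h
    obtain ⟨s, rfl⟩ := (cross_eq_zero_iff hY0).1 h
    exact hne (Subtype.ext ((hXp.eq_iff hYq).2 ⟨s, by rw [Matrix.mulVec_smul]⟩))
  · rw [← Matrix.dotProduct_mulVec, hX]; exact h1
  · rw [← Matrix.dotProduct_mulVec, hY]; exact h2

theorem IsNormalForm.exists_chordCubic_ne_zero (hN : IsNormalForm β M a b e)
    (hf : IsSmoothCubic f) {u : Fin 3 → k} (hu : u ≠ 0) :
    ∃ B, (u ᵥ* M) ⬝ᵥ B = 0 ∧ chordCubic a b e B ≠ 0 := by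
  obtain ⟨v, hv, hv0⟩ := hf.exists_eval_ne_zero hu
  obtain ⟨B, rfl⟩ := exists_mulVec_eq hN.isUnit_det v
  exact ⟨B, by rwa [← Matrix.dotProduct_mulVec], by rwa [← hN.eval_eq]⟩

theorem IsNormalForm.injective (hk : (2 : k) ≠ 0) (hN : IsNormalForm β M a b e)
    (hf : IsSmoothCubic f) (hβ2 : 2 • β = 0) (hc : IsChordMap β c) : Function.Injective c := by
  intro x x' h
  obtain ⟨p, rfl⟩ := proj_surjective x
  obtain ⟨p', rfl⟩ := proj_surjective x'
  obtain ⟨q, X, Y, hpq, hp, hq, hXY, hcr, hX, hY⟩ := hN.exists_pair hf hβ2 hc p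
  obtain ⟨q', X', Y', hpq', hp', hq', hXY', hcr', hX', hY'⟩ := hN.exists_pair hf hβ2 hc p'
  rw [← h] at hX' hY'
  have hu := (c (proj β p)).rep_nonzero
  obtain ⟨B, hUB, hB⟩ := hN.exists_chordCubic_ne_zero hf hu
  have hpt : ∀ {s t : zeroLocus f} {Z W : Fin 3 → k}, M.mulVec Z = s.1.rep →
      M.mulVec W = t.1.rep → (∃ r : k, Z = r • W) → s = t := by
    rintro s t Z W hs ht ⟨r, rfl⟩
    refine Subtype.ext (((represents_rep s.1).eq_iff (represents_rep t.1)).2 ⟨r, ?_⟩)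
    rw [← hs, ← ht, Matrix.mulVec_smul]
  rcases hXY.eq_or_eq hk hN.a_ne_zero (vecMul_ne_zero hN.isUnit_det hu) hUB hB hXY'
    (ne_zero_of_cross hcr').1 (ne_zero_of_cross hcr').2 hX hY hX' hY' with h | h
  · rw [hpt hp hp' h]
  · rw [hpq.proj_eq, hpt hq hp' h]

/-- A zero of the determinant is a line with a conjugate pair. Both members lie on the cubic and
differ by `β`, so the line is their chord. -/
theorem IsNormalForm.range_eq (hk : (2 : k) ≠ 0) (hN : IsNormalForm β M a b e)
    (hf : IsSmoothCubic f) (hc : IsChordMap β c) (hβ2 : 2 • β = 0) :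
    Set.range c = zeroLocus (cayleyan M a b e) := by
  ext l
  change _ ↔ eval l.rep (cayleyan M a b e) = 0
  rw [eval_cayleyan, ← Matrix.exists_mulVec_eq_zero_iff]
  constructor
  · rintro ⟨x, rfl⟩
    obtain ⟨p, rfl⟩ := proj_surjective x
    obtain ⟨q, X, Y, -, -, -, hXY, hcr, hX, hY⟩ := hN.exists_pair hf hβ2 hc p
    exact ⟨_, pairTensor_ne_zero hk hN.a_ne_zero (ne_zero_of_cross hcr).1 (ne_zero_of_cross hcr).2
      hXY, hXY.apolarMatrix_mulVec_pairTensor hX hY⟩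
  · rintro ⟨n, hn, h⟩
    obtain ⟨X, Y, hX0, hY0, hX, hY, hXY, -⟩ := exists_conjugate_of_apolarMatrix hk hN.a_ne_zero
      (vecMul_ne_zero hN.isUnit_det l.rep_nonzero) hn h
    obtain ⟨p, hp⟩ := exists_point hf.homogeneous (mulVec_ne_zero hN.isUnit_det hX0)
      (by rw [hN.eval_eq, hXY.chordCubic_eq_zero hY0])
    obtain ⟨q, hq⟩ := exists_point hf.homogeneous (mulVec_ne_zero hN.isUnit_det hY0)
      (by rw [hN.eval_eq, hXY.symm.chordCubic_eq_zero hX0])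
    obtain ⟨hne, h1, h2⟩ := hc p q ((hN.isTranslate_iff p q X Y hp hq).2 hXY)
    rw [← Matrix.dotProduct_mulVec] at hX hY
    exact ⟨proj β p, Incident.eq_of_ne (fun h => hne (Subtype.ext h)) h1 h2
      (hp.dotProduct_eq_zero_iff.1 hX) (hq.dotProduct_eq_zero_iff.1 hY)⟩

theorem infinite_line (w : Fin 3 → k) : {l : Plane k | w ⬝ᵥ l.rep = 0}.Infinite := by
  obtain ⟨A, B, hA, hB, hAB⟩ := exists_orthogonal_pair w
  have hne : ∀ t : k, A + t • B ≠ 0 := fun t h => by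
    have := hAB 1 t (by rwa [one_smul])
    simp at this
  choose l hl using fun t => exists_represents (hne t)
  refine Set.infinite_of_injective_forall_mem (f := l) ?_ ?_
  · intro t t' h
    obtain ⟨s, hs⟩ := ((hl t).eq_iff (hl t')).1 h
    have h0 := hAB (1 - s) (t - s * t') (by
      rw [sub_smul, sub_smul, mul_smul, one_smul, ← sub_eq_zero.2 hs, smul_add]; abel)
    rw [sub_eq_zero, sub_eq_zero] at h0
    rw [h0.2, ← h0.1, one_mul]
  · intro t
    change w ⬝ᵥ (l t).rep = 0
    rw [← (hl t).dotProduct_eq_zero_iff]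
    simp [dotProduct_add, dotProduct_smul, hA, hB]

theorem IsNormalForm.irreducible (hk : (2 : k) ≠ 0) (hN : IsNormalForm β M a b e)
    (hf : IsSmoothCubic f) (hβ2 : 2 • β = 0) (hc : IsChordMap β c) :
    Irreducible (cayleyan M a b e) := by
  by_contra hirr
  have hg0 := cayleyan_ne_zero (b := b) (e := e) hk hN.isUnit_det hN.a_ne_zero
  obtain ⟨w, q, -, hwq⟩ := exists_linear_factor isHomogeneous_cayleyan hg0 hirr
  obtain ⟨μ, rfl⟩ := exists_mulVec_eq hN.isUnit_det w
  obtain ⟨G, hG, hGe⟩ := exists_chord_form hN.isUnit_det μ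
  -- With a linear factor `w`, every line through the point `w` is a chord, so infinitely many
  -- points of the curve are zeros of `G`; hence `G` vanishes on the curve.
  have hGf : G ∈ Ideal.span {f} := by
    by_contra hGf
    refine infinite_line (M.mulVec μ) (((hf.finite_zeros hG hGf).image fun p => c (proj β p)).subset
      fun l hl => ?_)
    have hl0 : l ∈ Set.range c := by
      rw [hN.range_eq hk hf hc hβ2]
      change eval l.rep _ = 0
      rw [hwq, map_mul, eval_lin, show M.mulVec μ ⬝ᵥ l.rep = 0 from hl, zero_mul]
    obtain ⟨x, rfl⟩ := hl0
    obtain ⟨p, rfl⟩ := proj_surjective x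
    refine ⟨p, ?_, rfl⟩
    obtain ⟨q, X, Y, -, hp, -, hXY, hcr, hX, hY⟩ := hN.exists_pair hf hβ2 hc p
    change eval p.1.rep G = 0
    obtain ⟨s, hs⟩ := hXY.exists_eq_smul (ne_zero_of_cross hcr).2
    rw [← hp, hGe, hs, dotProduct_smul]
    obtain ⟨r, hr⟩ := eq_smul_cross hcr hX hY
    have hr0 := vecMul_ne_zero hN.isUnit_det (c (proj β p)).rep_nonzero
    rw [hr] at hr0
    have h1 : μ ⬝ᵥ ((c (proj β p)).rep ᵥ* M) = 0 := by
      rw [dotProduct_comm, ← Matrix.dotProduct_mulVec, dotProduct_comm]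
      exact hl
    rw [hr, dotProduct_smul, smul_eq_mul, mul_eq_zero,
      or_iff_right (left_ne_zero_of_smul hr0)] at h1
    rw [h1, smul_zero]
  obtain ⟨s, rfl⟩ := exists_eq_C_mul hf.homogeneous hG hGf
  have key : ∀ X, _ := hGe
  simp only [map_mul, eval_C, hN.eval_eq, chordCubic, dotProduct, Fin.sum_univ_three] at key
  -- For `G = s f`, the values at these four points force `s = 0` and `μ = 0`, since `G` and `f`
  -- have no monomials in common.
  have h1 := key ![1, 1, 0]
  have h2 := key ![-1, 1, 0]
  have h3 := key ![1, 0, 1]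
  have h4 := key ![-1, 0, 1]
  simp at h1 h2 h3 h4
  have hs : s = 0 := by
    have : 2 * 2 * (s * b) = 0 := by linear_combination h1 - h2 + h3 - h4
    simpa [hk, hN.b_ne_zero] using this
  subst hs
  have m0 : μ 0 = 0 := mul_left_cancel₀ hk (by linear_combination h2 - h1)
  have m1 : μ 1 = 0 := mul_left_cancel₀ hk (by linear_combination h1 + h2)
  have m2 : μ 2 = 0 := mul_left_cancel₀ hk (by linear_combination -h3 - h4)
  have hμ : μ = 0 := by funext i; fin_cases i <;> assumption
  rw [hμ, Matrix.mulVec_zero] at hwq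
  exact hg0 (by rw [hwq]; simp [lin])

end ChordMap

/-! ### Topology and regular functions induced from the plane. -/

section Spaces

variable {k : Type*} [Field k] {X : Type*}

theorem isOpen_compl_zeroLocus {d : ℕ} {G : CoordRing k} (hG : G.IsHomogeneous d) :
    IsOpen[(planeSpace k).top] (zeroLocus G)ᶜ :=
  TopologicalSpace.GenerateOpen.basic _ ⟨d, G, hG, rfl⟩

theorem exists_form_of_isOpen {V : Set (Plane k)} (hV : IsOpen[(planeSpace k).top] V)
    {p : Plane k} (hp : p ∈ V) : ∃ (d : ℕ) (E : CoordRing k), E.IsHomogeneous d ∧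
      eval p.rep E ≠ 0 ∧ ∀ q : Plane k, eval q.rep E ≠ 0 → q ∈ V := by
  induction hV with
  | basic V h =>
    obtain ⟨d, G, hG, rfl⟩ := h
    exact ⟨d, G, hG, hp, fun q hq => hq⟩
  | univ => exact ⟨0, 1, isHomogeneous_one _ _, by simp, fun q _ => trivial⟩
  | inter V W _ _ ihV ihW =>
    obtain ⟨d, E, hE, hpE, h⟩ := ihV hp.1
    obtain ⟨d', E', hE', hpE', h'⟩ := ihW hp.2
    refine ⟨_, _, hE.mul hE', by rw [map_mul]; exact mul_ne_zero hpE hpE', fun q hq => ?_⟩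
    rw [map_mul] at hq
    exact ⟨h q (left_ne_zero_of_mul hq), h' q (right_ne_zero_of_mul hq)⟩
  | sUnion S _ ih =>
    obtain ⟨V, hVS, hpV⟩ := hp
    obtain ⟨d, E, hE, hpE, h⟩ := ih V hVS hpV
    exact ⟨d, E, hE, hpE, fun q hq => ⟨V, hVS, h q hq⟩⟩

theorem isClosed_of_finite {S : Set (Plane k)} (hS : S.Finite) : IsClosed[(planeSpace k).top] S := by
  let _ := (planeSpace k).top
  have : T1Space (Plane k) := by
    rw [t1Space_iff_exists_open]
    intro p q hpq
    obtain ⟨φ, -, hp, hq, -, -⟩ := exists_dual_pair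
      (cross_ne_zero_of_ne (represents_rep p) (represents_rep q) hpq)
    refine ⟨(zeroLocus (lin φ))ᶜ, isOpen_compl_zeroLocus (isHomogeneous_lin φ), ?_, ?_⟩
    · simp [zeroLocus, eval_lin, hp]
    · simp [zeroLocus, eval_lin, hq]
  exact hS.isClosed

/-- A nonempty open set contains a nonempty set `E ≠ 0`, which is cofinite by hypothesis.
Conversely, finite sets are closed in the plane. Applied to both the curve and its quotient, this
reduces the comparison of topologies to finiteness. -/
theorem isOpen_induced_iff {h : X → Plane k} (hinj : Function.Injective h)
    (hfin : ∀ (d : ℕ) (G : CoordRing k), G.IsHomogeneous d →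
      {x | eval (h x).rep G = 0}.Finite ∨ ∀ x, eval (h x).rep G = 0) (V : Set X) :
    IsOpen[((planeSpace k).induced h).top] V ↔ (V.Nonempty → Vᶜ.Finite) := by
  change IsOpen[(planeSpace k).top.induced h] V ↔ _
  constructor
  · rintro ⟨O, hO, rfl⟩ ⟨x, hx⟩
    obtain ⟨d, E, hE, hxE, hEO⟩ := exists_form_of_isOpen hO hx
    refine ((hfin d E hE).resolve_right fun h0 => hxE (h0 x)).subset fun y hy => ?_
    by_contra hyE
    exact hy (hEO _ hyE)
  · intro hV
    rcases V.eq_empty_or_nonempty with rfl | hne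
    · exact @isOpen_empty _ ((planeSpace k).top.induced h)
    · refine ⟨(h '' Vᶜ)ᶜ, (isClosed_of_finite ((hV hne).image h)).isOpen_compl, ?_⟩
      rw [Set.preimage_compl, Set.preimage_image_eq _ hinj, compl_compl]

/-- Multiplying numerator and denominator by a form `E` whose nonvanishing locus lies in `V` absorbs
the neighbourhood into the denominator. -/
theorem induced_regular_iff (h : X → Plane k) (U : Set X) (ψ : X → k) :
    ((planeSpace k).induced h).Regular U ψ ↔ ∀ x ∈ U, ∃ (d : ℕ) (A B : CoordRing k),
      A.IsHomogeneous d ∧ B.IsHomogeneous d ∧ eval (h x).rep B ≠ 0 ∧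
      ∀ y ∈ U, eval (h y).rep B ≠ 0 → ψ y = eval (h y).rep A / eval (h y).rep B := by
  refine forall₂_congr fun x hx => ⟨?_, ?_⟩
  · rintro ⟨V, φ, hV, hxV, hφ, hψ⟩
    obtain ⟨d, A, B, hA, hB, hxB, hAB⟩ := hφ _ hxV
    obtain ⟨d', E, hE, hxE, hEV⟩ := exists_form_of_isOpen hV hxV
    refine ⟨_, _, _, hA.mul hE, hB.mul hE, by rw [map_mul]; exact mul_ne_zero hxB hxE,
      fun y hy hyBE => ?_⟩
    rw [map_mul] at hyBE
    have hyE := right_ne_zero_of_mul hyBE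
    have hyV := hEV _ hyE
    rw [hψ y hy hyV, hAB _ hyV (left_ne_zero_of_mul hyBE), map_mul, map_mul,
      mul_div_mul_right _ _ hyE]
  · rintro ⟨d, A, B, hA, hB, hxB, hAB⟩
    exact ⟨(zeroLocus B)ᶜ, fun q => eval q.rep A / eval q.rep B, isOpen_compl_zeroLocus hB, hxB,
      fun q hq => ⟨d, A, B, hA, hB, hq, fun _ _ _ => rfl⟩, hAB⟩

end Spaces

/-! ### Symmetric bihomogeneous forms in a pair of points. -/

section SymmetricForms

variable {k : Type*} [Field k]

/-- `Φ P Q` is, on pairs of vectors for which `P_i Q_j + P_j Q_i` is proportional to `T i j`,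
given by a form of degree `d` in the `T i j`. -/
def IsFormIn (T : Fin 3 → Fin 3 → CoordRing k) (d : ℕ) (Φ : (Fin 3 → k) → (Fin 3 → k) → k) :
    Prop :=
  ∃ H : CoordRing k, H.IsHomogeneous (2 * d) ∧ ∀ (u P Q : Fin 3 → k) (σ : k),
    (∀ i j, eval u (T i j) = σ * (P i * Q j + P j * Q i)) → eval u H = σ ^ d * Φ P Q

variable {T : Fin 3 → Fin 3 → CoordRing k} {d d' : ℕ} {Φ Ψ : (Fin 3 → k) → (Fin 3 → k) → k}

theorem IsFormIn.add (h : IsFormIn T d Φ) (h' : IsFormIn T d Ψ) :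
    IsFormIn T d fun P Q => Φ P Q + Ψ P Q := by
  obtain ⟨H, hH, hHe⟩ := h
  obtain ⟨H', hH', hHe'⟩ := h'
  exact ⟨H + H', hH.add hH', fun u P Q σ hT => by
    rw [map_add, hHe u P Q σ hT, hHe' u P Q σ hT, mul_add]⟩

theorem IsFormIn.mul (h : IsFormIn T d Φ) (h' : IsFormIn T d' Ψ) :
    IsFormIn T (d + d') fun P Q => Φ P Q * Ψ P Q := by
  obtain ⟨H, hH, hHe⟩ := h
  obtain ⟨H', hH', hHe'⟩ := h'
  exact ⟨H * H', mul_add 2 d d' ▸ hH.mul hH', fun u P Q σ hT => by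
    rw [map_mul, hHe u P Q σ hT, hHe' u P Q σ hT]; ring⟩

theorem isFormIn_const (T : Fin 3 → Fin 3 → CoordRing k) (c : k) : IsFormIn T 0 fun _ _ => c :=
  ⟨C c, isHomogeneous_C _ c, fun u P Q σ _ => by simp⟩

theorem IsFormIn.const_mul (c : k) (h : IsFormIn T d Φ) : IsFormIn T d fun P Q => c * Φ P Q := by
  simpa using (isFormIn_const T c).mul h

theorem isFormIn_polar (hT : ∀ i j, (T i j).IsHomogeneous 2) (l m : Fin 3 → k) :
    IsFormIn T 1 fun P Q => (l ⬝ᵥ P) * (m ⬝ᵥ Q) + (l ⬝ᵥ Q) * (m ⬝ᵥ P) := by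
  refine ⟨∑ i, ∑ j, C (l i * m j) * T i j, IsHomogeneous.sum _ _ _ fun i _ =>
    IsHomogeneous.sum _ _ _ fun j _ => (hT i j).C_mul _, fun u P Q σ h => ?_⟩
  simp only [Fin.sum_univ_three, map_add, map_mul, eval_C, h, dotProduct]
  ring

theorem isFormIn_alternating (hT : ∀ i j, (T i j).IsHomogeneous 2) (l m l' m' : Fin 3 → k) :
    IsFormIn T 2 fun P Q => ((l ⬝ᵥ P) * (m ⬝ᵥ Q) - (l ⬝ᵥ Q) * (m ⬝ᵥ P)) *
      ((l' ⬝ᵥ P) * (m' ⬝ᵥ Q) - (l' ⬝ᵥ Q) * (m' ⬝ᵥ P)) := by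
  have h := ((isFormIn_polar hT l m').mul (isFormIn_polar hT m l')).add
    (((isFormIn_polar hT l l').mul (isFormIn_polar hT m m')).const_mul (-1))
  convert h using 3
  ring

/-- Induction on the degree through `2 (x y + x' y') = (x + x') (y + y') + (x - x') (y - y')`. The
antisymmetric terms require the second statement, in which a determinant factor makes them
symmetric; products of two determinants are covered by `isFormIn_alternating`. -/
theorem isFormIn_symmetrize (hk : (2 : k) ≠ 0) (hT : ∀ i j, (T i j).IsHomogeneous 2)
    (m : Fin 3 → k) (d : ℕ) {A : CoordRing k} (hA : A.IsHomogeneous d) :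
    IsFormIn T d (fun P Q => eval P A * (m ⬝ᵥ Q) ^ d + eval Q A * (m ⬝ᵥ P) ^ d) ∧
    ∀ l l' : Fin 3 → k, IsFormIn T (d + 1) fun P Q =>
      ((l ⬝ᵥ P) * (l' ⬝ᵥ Q) - (l ⬝ᵥ Q) * (l' ⬝ᵥ P)) *
        (eval P A * (m ⬝ᵥ Q) ^ d - eval Q A * (m ⬝ᵥ P) ^ d) := by
  induction d generalizing A with
  | zero =>
    obtain ⟨c, rfl⟩ : ∃ c, A = C c := ⟨_, (totalDegree_eq_zero_iff_eq_C.1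
      (Nat.le_zero.1 hA.totalDegree_le))⟩
    refine ⟨by simpa using isFormIn_const T (c + c), fun l l' => ?_⟩
    simpa using (isFormIn_polar hT l l').const_mul 0
  | succ d ih =>
    refine homogeneous_succ_induction (p := fun A =>
      IsFormIn T (d + 1) (fun P Q => eval P A * (m ⬝ᵥ Q) ^ (d + 1) + eval Q A * (m ⬝ᵥ P) ^ (d + 1)) ∧
      ∀ l l' : Fin 3 → k, IsFormIn T (d + 1 + 1) fun P Q =>
        ((l ⬝ᵥ P) * (l' ⬝ᵥ Q) - (l ⬝ᵥ Q) * (l' ⬝ᵥ P)) *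
          (eval P A * (m ⬝ᵥ Q) ^ (d + 1) - eval Q A * (m ⬝ᵥ P) ^ (d + 1))) ?_ ?_ hA
    · intro w G hG
      obtain ⟨h1, h2⟩ := ih hG
      constructor
      · have h := ((add_comm 1 d ▸ (isFormIn_polar hT w m).mul h1).add (h2 w m)).const_mul 2⁻¹
        convert h using 3
        rw [map_mul, map_mul, eval_lin, eval_lin]
        field_simp
        ring
      · intro l l'
        have h := ((add_comm 1 (d + 1) ▸ (isFormIn_polar hT w m).mul (h2 l l')).add
          ((show 2 + d = d + 1 + 1 by ring) ▸ (isFormIn_alternating hT l l' w m).mul h1)).const_mul 2⁻¹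
        convert h using 3
        rw [map_mul, map_mul, eval_lin, eval_lin]
        field_simp
        ring
    · rintro G H ⟨hG, hG'⟩ ⟨hH, hH'⟩
      constructor
      · convert hG.add hH using 3
        rw [map_add, map_add]; ring
      · intro l l'
        convert (hG' l l').add (hH' l l') using 3
        rw [map_add, map_add]; ring

end SymmetricForms

/-! ### Local formulas for the chord and its endpoints; comparison of regular functions. -/

section Embedding

open scoped Matrix

variable {k : Type*} [Field k]

theorem exists_cross_rows_eq {N : Matrix (Fin 3) (Fin 3) k} {m : Fin 3 → k} (hm : m ≠ 0)
    (h : N.mulVec m = 0) (i j : Fin 3) : ∃ s : k, crossProduct (N i) (N j) = s • m := by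
  rw [← cross_eq_zero_iff hm, cross_cross_eq_smul_sub_smul]
  have h' : ∀ i, N i ⬝ᵥ m = 0 := congrFun h
  simp [h']

theorem exists_kernel_pair {N : Matrix (Fin 3) (Fin 3) k}
    (h : ∀ i j, crossProduct (N i) (N j) = 0) : ∃ a b : Fin 3 → k, N.mulVec a = 0 ∧
      N.mulVec b = 0 ∧ ∀ x y : k, x • a + y • b = 0 → x = 0 ∧ y = 0 := by
  obtain ⟨r, hr⟩ : ∃ r : Fin 3 → k, ∀ i, ∃ s : k, N i = s • r := by
    by_cases h0 : ∃ i, N i ≠ 0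
    · obtain ⟨j, hj⟩ := h0
      exact ⟨N j, fun i => (cross_eq_zero_iff hj).1 (h i j)⟩
    · push Not at h0
      exact ⟨0, fun i => ⟨0, by rw [h0, smul_zero]⟩⟩
  obtain ⟨a, b, ha, hb, hab⟩ := exists_orthogonal_pair r
  have key : ∀ v, r ⬝ᵥ v = 0 → N.mulVec v = 0 := by
    intro v hv
    funext i
    obtain ⟨s, hs⟩ := hr i
    rw [Matrix.mulVec, hs, smul_dotProduct, hv, smul_zero, Pi.zero_apply]
  exact ⟨a, b, key a ha, key b hb, hab⟩

theorem eval_cross (v : Fin 3 → k) (A B : Fin 3 → CoordRing k) (i : Fin 3) :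
    eval v (crossProduct A B i) =
      crossProduct (fun j => eval v (A j)) (fun j => eval v (B j)) i := by
  fin_cases i <;> simp [cross_apply]

theorem isHomogeneous_cross {A B : Fin 3 → CoordRing k} {d d' : ℕ} (hA : ∀ i, (A i).IsHomogeneous d)
    (hB : ∀ i, (B i).IsHomogeneous d') (i : Fin 3) :
    (crossProduct A B i).IsHomogeneous (d + d') := by
  fin_cases i <;> simp only [cross_apply] <;>
    exact ((hA _).mul (hB _)).sub ((hA _).mul (hB _))

theorem eval_aeval_eq {φ : Fin 3 → CoordRing k} {v u : Fin 3 → k} {s : k}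
    (h : (fun i => eval v (φ i)) = s • u) {G : CoordRing k} {d : ℕ} (hG : G.IsHomogeneous d) :
    eval v (aeval φ G) = s ^ d * eval u G := by
  rw [eval_aeval, h, hG.eval_smul]

variable {a b e : k} {M : Matrix (Fin 3) (Fin 3) k}

theorem eval_conjMatrix {v X : Fin 3 → k} {x : Fin 3 → CoordRing k} (h : ∀ j, eval v (x j) = X j)
    (i j : Fin 3) : eval v (conjMatrix (C a) (C b) (C e) x i j) = conjMatrix a b e X i j := by
  fin_cases i <;> fin_cases j <;> simp [conjMatrix, h]

theorem isHomogeneous_conjMatrix {x : Fin 3 → CoordRing k} (h : ∀ j, (x j).IsHomogeneous 1)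
    (i j : Fin 3) : (conjMatrix (C a) (C b) (C e) x i j).IsHomogeneous 1 := by
  have h0 := isHomogeneous_zero (Fin 3) k 1
  fin_cases i <;> fin_cases j <;> simp [conjMatrix]
  · exact h 0
  · exact (h 1).neg
  · exact h0
  · exact h0
  · exact h 1
  · exact (h 2).neg
  · exact ((h 2).C_mul a).add ((h 0).C_mul e)
  · exact (h 2).C_mul b
  · exact ((h 0).C_mul a).add ((h 1).C_mul b)

theorem eval_apolarTensor {u n : Fin 3 → k} {ν : Fin 3 → CoordRing k} (h : ∀ j, eval u (ν j) = n j)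
    (i j : Fin 3) : eval u (apolarTensor (C a) (C b) (C e) ν i j) = apolarTensor a b e n i j := by
  fin_cases i <;> fin_cases j <;> simp [apolarTensor, h]

theorem isHomogeneous_apolarTensor {ν : Fin 3 → CoordRing k} {d : ℕ}
    (h : ∀ j, (ν j).IsHomogeneous d) (i j : Fin 3) :
    (apolarTensor (C a) (C b) (C e) ν i j).IsHomogeneous d := by
  have h2 : (2 : CoordRing k) = C 2 := (map_ofNat C 2).symm
  have h0 : (C (2 * a) * ν 0).IsHomogeneous d := (h 0).C_mul _
  have h02 : (-(C b * ν 2 + C e * ν 0)).IsHomogeneous d :=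
    (((h 2).C_mul b).add ((h 0).C_mul e)).neg
  fin_cases i <;> fin_cases j <;> simp only [apolarTensor, h2, ← C_mul] <;>
    first | exact h0 | exact h 1 | exact h02 | exact (h 2).C_mul a

variable {f : CoordRing k} {β : Pic f} [IsAlgClosed k]

/-- The translation is given locally by quadratic forms. -/
theorem IsNormalForm.exists_local_translate (hN : IsNormalForm β M a b e) (hf : IsSmoothCubic f)
    (hβ2 : 2 • β = 0) (p₀ : zeroLocus f) : ∃ φ : Fin 3 → CoordRing k,
      (∀ i, (φ i).IsHomogeneous 2) ∧ (fun i => eval p₀.1.rep (φ i)) ≠ 0 ∧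
      ∀ p q : zeroLocus f, IsTranslate β p q →
        ∃ s : k, (fun i => eval p.1.rep (φ i)) = s • q.1.rep := by
  set x : Fin 3 → CoordRing k := fun j => lin (M⁻¹ j)
  have hx1 : ∀ j, (x j).IsHomogeneous 1 := fun j => isHomogeneous_lin _
  set N := conjMatrix (C a) (C b) (C e) x
  have heval : ∀ (X : Fin 3 → k) (i j l : Fin 3), eval (M.mulVec X)
      (∑ r, C (M l r) * crossProduct (N i) (N j) r) = M.mulVec
        (crossProduct (conjMatrix a b e X i) (conjMatrix a b e X j)) l := by
    intro X i j l
    have hX : ∀ i j, eval (M.mulVec X) (N i j) = conjMatrix a b e X i j :=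
      eval_conjMatrix (eval_coordinate hN.isUnit_det X)
    simp only [map_sum, map_mul, eval_C, eval_cross, hX]
    rfl
  obtain ⟨X₀, hX₀⟩ := exists_mulVec_eq hN.isUnit_det p₀.1.rep
  have hpX₀ : Represents (M.mulVec X₀) p₀.1 := hX₀ ▸ represents_rep p₀.1
  have hX₀0 : X₀ ≠ 0 := by rintro rfl; exact hpX₀.ne_zero (Matrix.mulVec_zero _)
  -- If all rows of the conjugacy matrix at `X₀` were proportional, its kernel would contain two
  -- independent vectors, giving two translates of `p₀`. So some cross product of rows is nonzero at
  -- `p₀`, and everywhere on the curve it is a multiple of the conjugate point.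
  obtain ⟨i, j, hij⟩ : ∃ i j,
      crossProduct (conjMatrix a b e X₀ i) (conjMatrix a b e X₀ j) ≠ 0 := by
    by_contra! h0
    obtain ⟨A, B, hA, hB, hAB⟩ := exists_kernel_pair h0
    have hA0 : A ≠ 0 := by rintro rfl; simpa using hAB 1 0 (by simp)
    have hB0 : B ≠ 0 := by rintro rfl; simpa using hAB 0 1 (by simp)
    rw [conjMatrix_mulVec_eq_zero_iff] at hA hB
    have hpt : ∀ Y, Y ≠ 0 → Conjugate a b e X₀ Y →
        ∃ q : zeroLocus f, Represents (M.mulVec Y) q.1 ∧ IsTranslate β p₀ q := by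
      intro Y hY h
      obtain ⟨q, hq⟩ := exists_point hf.homogeneous (mulVec_ne_zero hN.isUnit_det hY)
        (by rw [hN.eval_eq, h.symm.chordCubic_eq_zero hX₀0])
      exact ⟨q, hq, (hN.isTranslate_iff p₀ q X₀ Y hpX₀ hq).2 h⟩
    obtain ⟨q, hq, hqt⟩ := hpt A hA0 hA
    obtain ⟨q', hq', hqt'⟩ := hpt B hB0 hB
    have := (hf.existsUnique_translate hβ2 p₀).unique hqt hqt'
    subst this
    obtain ⟨s, hs⟩ := (hq.eq_iff hq').1 rfl
    rw [← Matrix.mulVec_smul] at hs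
    have hs' := Matrix.mulVec_injective_of_isUnit
      ((Matrix.isUnit_iff_isUnit_det M).2 hN.isUnit_det) hs
    have := (hAB 1 (-s) (by rw [one_smul, hs', neg_smul, add_neg_cancel])).1
    exact one_ne_zero this
  refine ⟨fun l => ∑ r, C (M l r) * crossProduct (N i) (N j) r, fun l =>
    IsHomogeneous.sum _ _ _ fun r _ => (isHomogeneous_cross (isHomogeneous_conjMatrix hx1 i)
      (isHomogeneous_conjMatrix hx1 j) r).C_mul _, ?_, fun p q hpq => ?_⟩
  · simp only [← hX₀, heval]
    exact mulVec_ne_zero hN.isUnit_det hij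
  · obtain ⟨X, hX⟩ := exists_mulVec_eq hN.isUnit_det p.1.rep
    obtain ⟨Y, hY⟩ := exists_mulVec_eq hN.isUnit_det q.1.rep
    have hXp : Represents (M.mulVec X) p.1 := hX ▸ represents_rep p.1
    have hYq : Represents (M.mulVec Y) q.1 := hY ▸ represents_rep q.1
    have hY0 : Y ≠ 0 := by rintro rfl; exact hYq.ne_zero (Matrix.mulVec_zero _)
    obtain ⟨s, hs⟩ := exists_cross_rows_eq hY0 ((conjMatrix_mulVec_eq_zero_iff X Y).2
      ((hN.isTranslate_iff p q X Y hXp hYq).1 hpq)) i j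
    refine ⟨s, ?_⟩
    simp only [← hX, heval, hs, Matrix.mulVec_smul, hY]

variable {c : QuotientCurve β → Plane k}

/-- The chord construction is given locally by cubic forms. -/
theorem IsNormalForm.exists_local_chord (hN : IsNormalForm β M a b e) (hf : IsSmoothCubic f)
    (hβ2 : 2 • β = 0) (hc : IsChordMap β c) (p₀ : zeroLocus f) : ∃ φ : Fin 3 → CoordRing k,
      (∀ i, (φ i).IsHomogeneous 3) ∧ (fun i => eval p₀.1.rep (φ i)) ≠ 0 ∧
      ∀ p : zeroLocus f, ∃ s : k, (fun i => eval p.1.rep (φ i)) = s • (c (proj β p)).rep := by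
  obtain ⟨φ, hφ, hφ0, h⟩ := hN.exists_local_translate hf hβ2 p₀
  have heval : ∀ v : Fin 3 → k, (fun i => eval v (crossProduct X φ i)) =
      crossProduct v (fun i => eval v (φ i)) := by
    intro v
    funext i
    simp [eval_cross]
  refine ⟨crossProduct X φ, isHomogeneous_cross (isHomogeneous_X k) hφ, ?_, fun p => ?_⟩
  · obtain ⟨q₀, hq₀⟩ := hf.exists_translate hβ2 p₀
    obtain ⟨s, hs⟩ := h p₀ q₀ hq₀
    rw [hs] at hφ0
    rw [heval, hs, map_smul]
    exact smul_ne_zero (left_ne_zero_of_smul hφ0) (cross_ne_zero_of_ne (represents_rep _)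
      (represents_rep _) fun h => (hc p₀ q₀ hq₀).1 (Subtype.ext h))
  · obtain ⟨q, hq⟩ := hf.exists_translate hβ2 p
    obtain ⟨s, hs⟩ := h p q hq
    obtain ⟨hne, h1, h2⟩ := hc p q hq
    obtain ⟨t, ht⟩ := eq_smul_of_orthogonal (cross_ne_zero_of_ne (represents_rep _)
      (represents_rep _) fun h => hne (Subtype.ext h)) (c (proj β p)).rep_nonzero
      (m := crossProduct p.1.rep q.1.rep) (by rw [dotProduct_comm, dot_self_cross])
      (by rw [dotProduct_comm, dot_cross_self]) h1 h2
    exact ⟨s * t, by rw [heval, hs, map_smul, ht, smul_smul]⟩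

/-- The pairs of points of the curve that differ by `β` are given, locally and up to order, by
quadratic forms in the coordinates of their chord. -/
theorem IsNormalForm.exists_local_tensor (hk : (2 : k) ≠ 0) (hN : IsNormalForm β M a b e)
    (hf : IsSmoothCubic f) (hβ2 : 2 • β = 0) (hc : IsChordMap β c) (p₀ : zeroLocus f) :
    ∃ T : Fin 3 → Fin 3 → CoordRing k, (∀ i j, (T i j).IsHomogeneous 2) ∧
      ∀ p q : zeroLocus f, IsTranslate β p q → ∃ σ : k, (p = p₀ → σ ≠ 0) ∧ ∀ i j,
        eval (c (proj β p)).rep (T i j) =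
          σ * (p.1.rep i * q.1.rep j + p.1.rep j * q.1.rep i) := by
  set N := apolarMatrix (C a) (C b) (C e) fun j => lin fun i => M i j
  have hN1 : ∀ i j, (N i j).IsHomogeneous 1 := isHomogeneous_apolarMatrix M
  obtain ⟨q₀, X₀, Y₀, -, -, -, hXY₀, hcr₀, hX₀, hY₀⟩ := hN.exists_pair hf hβ2 hc p₀
  have hu₀ := (c (proj β p₀)).rep_nonzero
  obtain ⟨B, hUB, hB⟩ := hN.exists_chordCubic_ne_zero hf hu₀
  set U₀ := (c (proj β p₀)).rep ᵥ* M
  -- The one-dimensional kernel makes two rows independent at the chord of `p₀`; their cross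
  -- product, quadratic in the line, recovers the pair up to a scalar that is nonzero there.
  obtain ⟨i₀, j₀, hij⟩ : ∃ i j,
      crossProduct (apolarMatrix a b e U₀ i) (apolarMatrix a b e U₀ j) ≠ 0 := by
    by_contra! h0
    obtain ⟨m, n, hm, hn, hmn⟩ := exists_kernel_pair h0
    have hm0 : m ≠ 0 := by rintro rfl; simpa using hmn 1 0 (by simp)
    obtain ⟨s, rfl⟩ := eq_smul_of_apolarMatrix hk hN.a_ne_zero
      (vecMul_ne_zero hN.isUnit_det hu₀) hUB hB hm0 hm hn
    have := (hmn (-s) 1 (by rw [one_smul, neg_smul, neg_add_cancel])).2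
    exact one_ne_zero this
  set ν := crossProduct (N i₀) (N j₀)
  have hν : ∀ i, (ν i).IsHomogeneous 2 := isHomogeneous_cross (hN1 i₀) (hN1 j₀)
  have hνe : ∀ (u : Fin 3 → k) (i : Fin 3), eval u (ν i) = crossProduct
      (apolarMatrix a b e (u ᵥ* M) i₀) (apolarMatrix a b e (u ᵥ* M) j₀) i := by
    intro u i
    simp only [ν, eval_cross]
    simp only [N, eval_apolarMatrix]
  refine ⟨fun i j => ∑ r, ∑ s, C (M i r * M j s) * apolarTensor (C a) (C b) (C e) ν r s,
    fun i j => IsHomogeneous.sum _ _ _ fun r _ => IsHomogeneous.sum _ _ _ fun s _ =>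
      (isHomogeneous_apolarTensor hν r s).C_mul _, fun p q hpq => ?_⟩
  obtain ⟨q', X, Y, hpq', hX, hY, hXY, hcr, hUX, hUY⟩ := hN.exists_pair hf hβ2 hc p
  have := (hf.existsUnique_translate hβ2 p).unique hpq hpq'
  subst this
  obtain ⟨s, hs⟩ := exists_cross_rows_eq (pairTensor_ne_zero hk hN.a_ne_zero
    (ne_zero_of_cross hcr).1 (ne_zero_of_cross hcr).2 hXY)
    (hXY.apolarMatrix_mulVec_pairTensor hUX hUY) i₀ j₀
  refine ⟨s * a, ?_, fun i j => ?_⟩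
  · rintro rfl
    rw [hs] at hij
    exact mul_ne_zero (left_ne_zero_of_smul hij) hN.a_ne_zero
  · have hS : ∀ r t, apolarTensor a b e (s • pairTensor a X Y) r t =
        s * (a * (X r * Y t + X t * Y r)) := by
      intro r t
      have h := apolarTensor_combination (a := a) (b := b) (e := e) s 0 (pairTensor a X Y) 0
      rw [zero_smul, zero_smul, add_zero, add_zero] at h
      rw [h, Matrix.smul_apply, hXY.apolarTensor_pairTensor, smul_eq_mul]
    simp only [map_add, map_mul, eval_C, eval_apolarTensor (hνe _), hs, hS, ← hX, ← hY,
      Matrix.mulVec, dotProduct, Fin.sum_univ_three]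
    ring

/-- Composing `G` with the cubic formulas for the chord near an arbitrary `p₀` gives a form on the
curve. If it had infinitely many zeros it would vanish on the curve, in particular at `p₀`, where
the formulas are valid. -/
theorem IsNormalForm.zeros_finite_or_all (hN : IsNormalForm β M a b e) (hf : IsSmoothCubic f)
    (hβ2 : 2 • β = 0) (hc : IsChordMap β c) {d : ℕ} {G : CoordRing k} (hG : G.IsHomogeneous d) :
    {x | eval (c x).rep G = 0}.Finite ∨ ∀ x, eval (c x).rep G = 0 := by
  by_cases hfin : {p : zeroLocus f | eval (c (proj β p)).rep G = 0}.Finite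
  · left
    refine (hfin.image (proj β)).subset fun x hx => ?_
    obtain ⟨p, rfl⟩ := proj_surjective x
    exact ⟨p, hx, rfl⟩
  · right
    intro x
    obtain ⟨p₀, rfl⟩ := proj_surjective x
    obtain ⟨φ, hφ, hφ0, h⟩ := hN.exists_local_chord hf hβ2 hc p₀
    have hmem : aeval φ G ∈ Ideal.span {f} := by
      by_contra hmem
      refine hfin ((hf.finite_zeros (hG.aeval φ hφ) hmem).subset fun p hp => ?_)
      obtain ⟨s, hs⟩ := h p
      change eval _ _ = 0
      rw [eval_aeval_eq hs hG, show eval (c (proj β p)).rep G = 0 from hp, mul_zero]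
    obtain ⟨s, hs⟩ := h p₀
    rw [hs] at hφ0
    obtain ⟨q, hq⟩ := Ideal.mem_span_singleton'.1 hmem
    have h0 : eval p₀.1.rep (aeval φ G) = 0 := by
      rw [← hq, map_mul, show eval p₀.1.rep f = 0 from p₀.2, mul_zero]
    rw [eval_aeval_eq hs hG, mul_eq_zero,
      or_iff_right (pow_ne_zero _ (left_ne_zero_of_smul hφ0))] at h0
    exact h0

theorem IsSmoothCubic.zeros_finite_or_all (hf : IsSmoothCubic f) {d : ℕ} {G : CoordRing k}
    (hG : G.IsHomogeneous d) : {p : zeroLocus f | eval p.1.rep G = 0}.Finite ∨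
      ∀ p : zeroLocus f, eval p.1.rep G = 0 := by
  by_cases hGf : G ∈ Ideal.span {f}
  · right
    intro p
    obtain ⟨q, rfl⟩ := Ideal.mem_span_singleton'.1 hGf
    rw [map_mul, show eval p.1.rep f = 0 from p.2, mul_zero]
  · exact Or.inl (hf.finite_zeros hG hGf)

theorem finite_preimage_proj (hf : IsSmoothCubic f) (hβ2 : 2 • β = 0)
    {V : Set (QuotientCurve β)} : (proj β ⁻¹' V).Finite ↔ V.Finite := by
  constructor
  · intro h
    rw [← Set.image_preimage_eq V proj_surjective]
    exact h.image _
  · refine fun h => h.preimage' fun x _ => ?_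
    obtain ⟨p, rfl⟩ := proj_surjective x
    obtain ⟨q, hq⟩ := hf.exists_translate hβ2 p
    refine (Set.toFinite {p, q}).subset fun r hr => ?_
    rcases (proj_eq_iff hf hβ2).1 (Eq.symm hr) with h | h
    · exact Or.inl h.symm
    · exact Or.inr ((hf.existsUnique_translate hβ2 p).unique h hq)

theorem IsNormalForm.top_eq (hk : (2 : k) ≠ 0) (hN : IsNormalForm β M a b e)
    (hf : IsSmoothCubic f) (hβ2 : 2 • β = 0) (hc : IsChordMap β c) :
    (quotientSpace β).top = ((planeSpace k).induced c).top := by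
  refine TopologicalSpace.ext_iff.2 fun V => ?_
  rw [isOpen_induced_iff (hN.injective hk hf hβ2 hc) fun d G hG =>
    hN.zeros_finite_or_all hf hβ2 hc hG]
  change IsOpen[(curveSpace f).top.coinduced (proj β)] V ↔ _
  rw [isOpen_coinduced]
  change IsOpen[((planeSpace k).induced Subtype.val).top] _ ↔ _
  rw [isOpen_induced_iff Subtype.val_injective fun d G hG => hf.zeros_finite_or_all hG,
    ← Set.preimage_compl, finite_preimage_proj hf hβ2]
  refine imp_congr_left ⟨fun ⟨p, hp⟩ => ⟨_, hp⟩, fun ⟨x, hx⟩ => ?_⟩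
  obtain ⟨p, rfl⟩ := proj_surjective x
  exact ⟨p, hx⟩

theorem IsNormalForm.regular_of_induced (hN : IsNormalForm β M a b e) (hf : IsSmoothCubic f)
    (hβ2 : 2 • β = 0) (hc : IsChordMap β c) {U : Set (QuotientCurve β)} {φ : QuotientCurve β → k}
    (h : ((planeSpace k).induced c).Regular U φ) : (quotientSpace β).Regular U φ := by
  rw [induced_regular_iff] at h
  change ((planeSpace k).induced Subtype.val).Regular (proj β ⁻¹' U) (φ ∘ proj β)
  rw [induced_regular_iff]
  intro p₀ hp₀
  obtain ⟨d, A, B, hA, hB, hB0, hAB⟩ := h _ hp₀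
  obtain ⟨κ, hκ, hκ0, hκc⟩ := hN.exists_local_chord hf hβ2 hc p₀
  refine ⟨_, _, _, hA.aeval κ hκ, hB.aeval κ hκ, ?_, fun p hp hpB => ?_⟩
  · obtain ⟨s, hs⟩ := hκc p₀
    rw [hs] at hκ0
    rw [eval_aeval_eq hs hB]
    exact mul_ne_zero (pow_ne_zero _ (left_ne_zero_of_smul hκ0)) hB0
  · obtain ⟨s, hs⟩ := hκc p
    rw [eval_aeval_eq hs hB] at hpB ⊢
    rw [eval_aeval_eq hs hA, mul_div_mul_left _ _ (left_ne_zero_of_mul hpB)]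
    exact hAB _ hp (right_ne_zero_of_mul hpB)

/-- As `φ` takes one value on the pair `{p, p + β}`, it is also the quotient of the symmetrizations
of numerator and denominator over the pair, and these are forms in the chord. -/
theorem IsNormalForm.induced_of_regular (hk : (2 : k) ≠ 0) (hN : IsNormalForm β M a b e)
    (hf : IsSmoothCubic f) (hβ2 : 2 • β = 0) (hc : IsChordMap β c) {U : Set (QuotientCurve β)}
    {φ : QuotientCurve β → k} (h : (quotientSpace β).Regular U φ) :
    ((planeSpace k).induced c).Regular U φ := by
  change ((planeSpace k).induced Subtype.val).Regular (proj β ⁻¹' U) (φ ∘ proj β) at h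
  rw [induced_regular_iff] at h ⊢
  intro x hx
  obtain ⟨p₀, rfl⟩ := proj_surjective x
  obtain ⟨d, A, B, hA, hB, hB0, hAB⟩ := h p₀ hx
  obtain ⟨q₀, hq₀⟩ := hf.exists_translate hβ2 p₀
  -- Since `l` vanishes at `q₀` but not at `p₀` and `m` is one at `q₀`, the symmetrized denominator
  -- at `p₀` is a power of `σ` times `B(p₀)²`, whatever `B(q₀)` is.
  obtain ⟨l, m, hlp, hlq, -, hmq⟩ := exists_dual_pair (cross_ne_zero_of_ne (represents_rep p₀.1)
    (represents_rep q₀.1) fun h => (hc p₀ q₀ hq₀).1 (Subtype.ext h))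
  obtain ⟨T, hT, hTe⟩ := hN.exists_local_tensor hk hf hβ2 hc p₀
  obtain ⟨HA, hHA, hHAe⟩ := (isFormIn_symmetrize hk hT m _
    ((hA.mul hB).mul (isHomogeneous_lin l))).1
  obtain ⟨HB, hHB, hHBe⟩ := (isFormIn_symmetrize hk hT m _
    ((hB.mul hB).mul (isHomogeneous_lin l))).1
  beta_reduce at hHAe hHBe
  -- The extra factor `B` keeps the identity true at zeros of `B`, where `A / B` says nothing about
  -- `φ`.
  have key : ∀ p : zeroLocus f, proj β p ∈ U → eval p.1.rep (A * B * lin l) =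
      φ (proj β p) * eval p.1.rep (B * B * lin l) := by
    intro p hp
    simp only [map_mul]
    by_cases hpB : eval p.1.rep B = 0
    · simp [hpB]
    · have := hAB p hp hpB
      rw [Function.comp_apply, eq_div_iff hpB] at this
      linear_combination -(eval p.1.rep B) * eval p.1.rep (lin l) * this
  refine ⟨_, HA, HB, hHA, hHB, ?_, fun y hy hyB => ?_⟩
  · obtain ⟨σ, hσ, hσe⟩ := hTe p₀ q₀ hq₀
    rw [hHBe _ _ _ σ hσe, map_mul _ _ (lin l), map_mul _ _ (lin l), eval_lin, eval_lin, hlp, hlq,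
      hmq]
    simpa [hB0] using hσ rfl
  · obtain ⟨p, rfl⟩ := proj_surjective y
    obtain ⟨q, hq⟩ := hf.exists_translate hβ2 p
    obtain ⟨σ, -, hσe⟩ := hTe p q hq
    rw [eq_div_iff hyB, hHAe _ _ _ σ hσe, hHBe _ _ _ σ hσe, key p hy,
      key q (by rwa [← hq.proj_eq]), ← hq.proj_eq]
    ring

theorem IsNormalForm.isEmbedding (hk : (2 : k) ≠ 0) (hN : IsNormalForm β M a b e)
    (hf : IsSmoothCubic f) (hβ2 : 2 • β = 0) (hc : IsChordMap β c) :
    (quotientSpace β).IsEmbedding (planeSpace k) c where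
  injective := hN.injective hk hf hβ2 hc
  isClosed_range := by
    rw [hN.range_eq hk hf hc hβ2]
    exact (@isOpen_compl_iff _ _ (planeSpace k).top).1 (isOpen_compl_zeroLocus isHomogeneous_cayleyan)
  top_eq := hN.top_eq hk hf hβ2 hc
  regular_iff _ _ _ := ⟨hN.induced_of_regular hk hf hβ2 hc, hN.regular_of_induced hf hβ2 hc⟩

end Embedding
end ChordConstruction

open ChordConstruction in
theorem mainTheorem1 {k : Type*} [Field k] [IsAlgClosed k] (hk : (2 : k) ≠ 0)
    (f : CoordRing k) (hf : IsSmoothCubic f) (β : Pic f) (hβ : β ≠ 0) (hβ2 : 2 • β = 0) :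
    (∀ p : zeroLocus f, ∃! q : zeroLocus f, IsTranslate β p q) ∧
    (∃! c : QuotientCurve β → Plane k, IsChordMap β c) ∧
    ∀ c : QuotientCurve β → Plane k, IsChordMap β c →
      (quotientSpace β).IsEmbedding (planeSpace k) c ∧
      ∃ g : CoordRing k, g.IsHomogeneous 3 ∧ Irreducible g ∧ Set.range c = zeroLocus g := by
  refine ⟨hf.existsUnique_translate hβ2, hf.existsUnique_isChordMap hβ hβ2, fun c hc => ?_⟩
  obtain ⟨M, a, b, e, hN⟩ := hf.exists_isNormalForm hk hβ hβ2
  exact ⟨hN.isEmbedding hk hf hβ2 hc, cayleyan M a b e, isHomogeneous_cayleyan,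
    hN.irreducible hk hf hβ2 hc, hN.range_eq hk hf hc hβ2⟩
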